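/- **Conventions.** Let $\hbar$ be a formal parameter and $K=\mathbb C[\hbar,\hbar^{-1}]$. Functions of $\mathbf T=(T_0,T_1,\dots)$ and $\mathbf t=(t_1,t_2,\dots)$ are polynomials over $K$ unless said otherwise; functions $Z(\mathbf t^o)$ of the odd times are functions of $\mathbf T$ through $T_k=(2k+1)!!\,t_{2k+1}$. *Givental operators.* Let $R(z)\in 1+z\mathbb C[[z]]$ with $R(z)R(-z)=1$, so that $\log R(z)=\sum_{k\ge1}r_kz^{2k-1}$. Put $\widehat R=\exp\bigl(\sum_{k\ge1} r_k\widehat W_k\bigr)$, where $$\widehat W_k=-\sum_{m\ge0}\bigl(T_m-\hbar^{-1}\delta_{m,1}\bigr)\frac{\partial}{\partial T_{m+2k-1}}+\frac12\sum_{m=0}^{2k-2}(-1)^m\frac{\partial^2}{\partial T_m\partial T_{2k-2-m}} .$$ *Heisenberg–Virasoro group.* Let $\widehat J_k=\partial_{t_k}$ for $k>0$, $\widehat J_0=0$, $\widehat J_k=-k\,t_{-k}$ for $k<0$, and for $m\in\mathbb Z$ $$\widehat L_m=\frac12\sum_{a+b=-m}ab\,t_at_b+\sum_{k\ge1}k\,t_k\frac{\partial}{\partial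 t_{k+m}}+\frac12\sum_{a+b=m}\frac{\partial^2}{\partial t_a\partial t_b}\qquad(a,b\ge1;\ \text{terms with } \partial_{t_j},\ j\le0, \text{ omitted}).$$ Elements of the group generated by the $\widehat J_k$, $\widehat L_k$ and the unit are taken in the normally ordered form $$G=c\;e^{\sum_{k>0}b'_k\widehat J_{-k}}\,e^{\sum_{k>0}a'_k\widehat L_{-k}}\,u^{\widehat L_0}\,e^{\sum_{k>0}b_k\widehat J_k}\,e^{\sum_{k>0}a_k\widehat L_k},\qquad c,u\in K^\times,\ a_k,b_k,a'_k,b'_k\in K,$$ which maps polynomials in $\mathbf t$ to formal power series in $\mathbf t$. We say that $\widehat R$ *coincides with $G$ up to a linear change of variables* if there are linearly independent (possibly infinite) linear forms $T_k(\mathbf t)$, $k\ge0$, over $K$ such that $\bigl.\widehat R\cdot Z\bigr|_{\mathbf T=\mathbf T(\mathbf t)}=G\cdot Z(\mathbf t^o)$ for all $Z$. *The family.* For $p,q\in\mathbb C$ with $p+q\ne0$ let, with the Bernoulli numbers $B_{2k}$, $$R_{q,p}(z)=\exp\Bigl(-\sum_{k=1}^\infty\frac{B_{2k}}{2k(2k-1)}\Bigl(p^{2k-1}+q^{2k-1}-\Bigl(\frac{pq}{p+q}\Bigr)^{2k-1}\Bigr)z^{2k-1}\Bigr).$$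 **Theorem.** (1) Let $R(z)\in 1+z\mathbb C[[z]]$ with $R(z)R(-z)=1$. The operator $\widehat R$ coincides up to a linear change of variables with an element of the Heisenberg–Virasoro group if and only if $R=1$ or $R=R_{q,p}$ for some $p,q\in\mathbb C$ with $p+q\neq0$. (2) Let $p,q\in\mathbb C$ with $p+q\ne0$, and let $\sqrt{p+q}$ be either of the square roots. Then $R_{q,p}(z)R_{q,p}(-z)=1$; there is a unique series $f\in z+z^2\mathbb C[[z]]$ with $$f\,df=dx:=\frac{z\,dz}{(1+\sqrt{p+q}\,z)(1+qz/\sqrt{p+q})},$$ and there are unique $a_k\in\mathbb C$ ($k\ge1$) with $f=e^{\sum_{k>0}a_k\mathtt l_k}\,z\,e^{-\sum_{k>0}a_k\mathtt l_k}$ as multiplication operators on $\mathbb C[[z]]$, where $\mathtt l_m=-z^m\bigl(z\partial_z+\frac{m+1}2\bigr)$. Put $y(z)=\int_0^z dx(\eta)/\eta$, $v_k=[z^k]\int_0^z(f-y)\,dx$, and define linear forms by $$T^{q,p}_0=t_1,\qquad T^{q,p}_k=\Bigl(q\widehat L_0+\tfrac{2q+p}{\sqrt{p+q}}\widehat L_{-1}+\bigl(\widehat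 L_{-2}-\tfrac{t_1^2}{2}\bigr)\Bigr)\cdot T^{q,p}_{k-1}.$$ Then $$\Bigl.\widehat R_{q,p}\cdot Z(\mathbf t^o)\Bigr|_{\mathbf T=\mathbf T^{q,p}(\mathbf t)}=e^{\hbar^{-1}\sum_{k\ge4}v_k\partial_{t_k}}\;e^{\sum_{k>0}a_k\widehat L_k}\cdot Z(\mathbf t^o)$$ for every polynomial $Z$, and also for every formal series $Z=\sum_{\alpha,m}Z_{\alpha,m}\hbar^m\mathbf T^\alpha$ ($m\in\mathbb Z$, $Z_{\alpha,m}\in\mathbb C$) for which both sides make sense, that is, for which only finitely many terms of $Z$ contribute to each coefficient of either side. -/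

import Mathlib

namespace GiventalKP

noncomputable section

/-- The coefficient ring `ℂ[ħ, ħ⁻¹]`. -/
abbrev Coef : Type := LaurentPolynomial ℂ

/-- `ħ⁻¹`. -/
def hbarInv : Coef := LaurentPolynomial.T (-1)

/-- Functions of the times `T_0, T_1, T_2, …` of the Givental side. -/
abbrev FunT : Type := MvPolynomial ℕ Coef

/-- Functions of the times `t_1, t_2, t_3, …` of the KP side. -/
abbrev Funt : Type := MvPolynomial ℕ+ Coef

/-- Formal power series in `t_1, t_2, t_3, …`. -/
abbrev Sert : Type := MvPowerSeries ℕ+ Coef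

/-- The exponential `∑ₙ Aⁿ / n!` of an operator, evaluated at a polynomial. It is used only for
operators that lower a weight, for which only finitely many terms are nonzero. -/
def opExp {M : Type} [AddCommGroup M] [Module ℂ M] (A : M → M) (P : M) : M :=
  ∑ᶠ n : ℕ, ((n.factorial : ℂ)⁻¹) • A^[n] P

/-! ### The Givental group -/

/-- `R(z) ∈ 1 + z ℂ[[z]]` with the symplectic condition `R(z) R(-z) = 1`. -/
def IsSymplectic (R : PowerSeries ℂ) : Prop :=
  PowerSeries.constantCoeff R = 1 ∧ R * PowerSeries.evalNegHom R = 1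

/-- The dilaton-shifted variable `T_m - ħ⁻¹ δ_{m,1}`. -/
def dilT (m : ℕ) : FunT :=
  MvPolynomial.X m - if m = 1 then MvPolynomial.C hbarInv else 0

/-- The quantization of multiplication by `z ^ n` for odd `n > 0`:
`- ∑_m (T_m - ħ⁻¹ δ_{m,1}) ∂/∂T_{m+n} + (1/2) ∑_{m=0}^{n-1} (-1)^m ∂²/∂T_m ∂T_{n-1-m}`.
The first order part is the derivation with `T_j ↦ -(T_{j-n} - ħ⁻¹ δ_{j-n,1})` for `j ≥ n`
and `T_j ↦ 0` for `j < n`. -/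
def quantZ (n : ℕ) (Z : FunT) : FunT :=
  MvPolynomial.mkDerivation Coef (fun j : ℕ => if n ≤ j then -dilT (j - n) else 0) Z
    + (1 / 2 : ℂ) • ∑ m ∈ Finset.range n,
        ((-1 : ℂ) ^ m) • MvPolynomial.pderiv m (MvPolynomial.pderiv (n - 1 - m) Z)

/-- The quantization of multiplication by an odd series `ℓ(z) = ∑ₖ ℓ_{2k+1} z^{2k+1}`. -/
def quantOdd (l : PowerSeries ℂ) (Z : FunT) : FunT :=
  ∑ᶠ k : ℕ, PowerSeries.coeff (2 * k + 1) l • quantZ (2 * k + 1) Z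

/-- The rank one Givental operator: the exponential of the quantization of `log R`. -/
def givental (R : PowerSeries ℂ) : FunT → FunT :=
  opExp (quantOdd (PowerSeries.logOf R))

/-! ### The Heisenberg–Virasoro group -/

/-- `t_k` for `k > 0`, and `0` otherwise. -/
def tVar (k : ℤ) : Funt :=
  if 0 < k then MvPolynomial.X k.toNat.toPNat' else 0

/-- `∂/∂t_k` for `k > 0`, and `0` otherwise. -/
def dVar (k : ℤ) (P : Funt) : Funt :=
  if 0 < k then MvPolynomial.pderiv k.toNat.toPNat' P else 0

/-- The Heisenberg operators: `∂/∂t_k` for `k > 0`, zero for `k = 0`, and multiplication by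
`-k t_{-k}` for `k < 0`. -/
def opJ (k : ℤ) (P : Funt) : Funt :=
  if 0 < k then dVar k P else (-k) • (tVar (-k) * P)

/-- The Virasoro operators
`(1/2) ∑_{a+b=-m} a b t_a t_b + ∑_{k≥1} k t_k ∂/∂t_{k+m} + (1/2) ∑_{a+b=m} ∂²/∂t_a ∂t_b`
with `a, b ≥ 1`. The first order part is the derivation with `t_j ↦ (j-m) t_{j-m}`, where `t_i`
is zero for `i ≤ 0`. -/
def opL (m : ℤ) (P : Funt) : Funt :=
  (1 / 2 : ℂ) • ∑ a ∈ Finset.Ioo 0 (-m), (a * (-m - a)) • (tVar a * tVar (-m - a) * P)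
    + MvPolynomial.mkDerivation Coef
        (fun j : ℕ+ => ((j : ℤ) - m) • tVar ((j : ℤ) - m)) P
    + (1 / 2 : ℂ) • ∑ a ∈ Finset.Ioo 0 m, dVar a (dVar (m - a) P)

/-- `exp (∑_{k>0} a_k L_k)`. -/
def expL (a : ℕ+ → Coef) : Funt → Funt :=
  opExp fun P => ∑ᶠ k : ℕ+, a k • opL k P

/-- `exp (∑_{k>0} b_k J_k) = exp (∑_{k>0} b_k ∂/∂t_k)`. -/
def expJ (b : ℕ+ → Coef) : Funt → Funt :=
  opExp fun P => ∑ᶠ k : ℕ+, b k • opJ k P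

/-- `u ^ {L_0}`, the scaling `t_k ↦ u ^ k t_k`. -/
def scaleL0 (u : Coefˣ) (P : Funt) : Funt :=
  MvPolynomial.aeval
    (fun k : ℕ+ => MvPolynomial.C ((u : Coef) ^ (k : ℕ)) * MvPolynomial.X k) P

/-- The weight of a monomial in the `t_k`, where `t_k` has weight `k`. -/
def wt (β : ℕ+ →₀ ℕ) : ℕ := β.sum fun k n => n * (k : ℕ)

/-- `exp (∑_{k>0} a_k L_{-k})`, which maps polynomials to power series. As `L_{-k}` raises the
weight by `k`, the coefficient of a monomial of weight `w` in `(∑_{k>0} a_k L_{-k})ⁿ P` involves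
only `k ≤ w` and vanishes for `n > w`. -/
def expLneg (a : ℕ+ → Coef) (P : Funt) : Sert := fun β =>
  ∑ n ∈ Finset.range (wt β + 1), ((n.factorial : ℂ)⁻¹) •
    MvPolynomial.coeff β
      ((fun Q : Funt => ∑ k ∈ Finset.Icc 1 (wt β), a k.toPNat' • opL (-(k : ℤ)) Q)^[n] P)

/-- The series `exp (∑_{k>0} k b_k t_k)`; multiplication by it is `exp (∑_{k>0} b_k J_{-k})`. -/
def expJneg (b : ℕ+ → Coef) : Sert := fun β =>
  β.prod fun k n => ((n.factorial : ℂ)⁻¹) • ((k : ℕ) • b k) ^ n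

/-- Elements of the Heisenberg–Virasoro group, generated by all `J_k`, `L_k` (`k ∈ ℤ`) and the
unit, in the normally ordered (triangular) form
`c · e^{∑_{k>0} b'_k J_{-k}} e^{∑_{k>0} a'_k L_{-k}} u^{L_0} e^{∑_{k>0} b_k J_k} e^{∑_{k>0} a_k L_k}`,
in which they act from polynomials to power series for arbitrary values of the parameters. -/
def IsHeisenbergVirasoro (G : Funt → Sert) : Prop :=
  ∃ (c u : Coefˣ) (a b a' b' : ℕ+ → Coef), ∀ P : Funt,
    G P = (c : Coef) • (expJneg b' * expLneg a' (scaleL0 u (expJ b (expL a P))))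

/-! ### Comparison of the two groups -/

/-- The identification `T_k = (2k+1)!! t_{2k+1}` of functions of the `T_k` with functions of the
odd times. -/
def oddTimes (Z : FunT) : Funt :=
  MvPolynomial.aeval (fun k : ℕ =>
    (((2 * k + 1).doubleFactorial : ℕ) • tVar (2 * k + 1) : Funt)) Z

/-- A (possibly infinite) linear combination of `t_1, t_2, t_3, …`. -/
def IsLinearForm (S : Sert) : Prop :=
  ∀ β : ℕ+ →₀ ℕ, MvPowerSeries.coeff β S ≠ 0 → β.degree = 1

/-- On functions `Z` of the odd times, the Givental operator of `R` coincides with an element of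
the Heisenberg–Virasoro group after a linear change of variables `T_k = T_k(t)`. -/
def CoincidesWithHV (R : PowerSeries ℂ) : Prop :=
  ∃ G : Funt → Sert, IsHeisenbergVirasoro G ∧
    ∃ T : ℕ → Sert, (∀ k, IsLinearForm (T k)) ∧ LinearIndependent Coef T ∧
      ∀ Z : FunT, MvPolynomial.aeval T (givental R Z) = G (oddTimes Z)

/-! ### The two-parameter family -/

/-- `R_{q,p}(z)`. -/
def Rqp (q p : ℂ) : PowerSeries ℂ :=
  (PowerSeries.exp ℂ).subst (-(PowerSeries.mk fun n : ℕ =>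
    if Odd n then ((bernoulli (n + 1) : ℚ) : ℂ) / (((n : ℂ) + 1) * n) *
      (p ^ n + q ^ n - (p * q / (p + q)) ^ n) else 0))

/-- The linear change of variables `T_k^{q,p}(t)`, where `s` is a square root of `p + q`. -/
def Tqp (q p s : ℂ) : ℕ → Funt
  | 0 => tVar 1
  | k + 1 => q • opL 0 (Tqp q p s k) + ((2 * q + p) / s) • opL (-1) (Tqp q p s k)
      + (opL (-2) (Tqp q p s k) - (1 / 2 : ℂ) • (tVar 1 ^ 2 * Tqp q p s k))

/-- The generators `l_m = -z^m (z ∂/∂z + (m+1)/2)`. -/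
def opl (m : ℕ+) (g : PowerSeries ℂ) : PowerSeries ℂ :=
  -(PowerSeries.X ^ (m : ℕ) *
    (PowerSeries.X * PowerSeries.derivative ℂ g + (((m : ℂ) + 1) / 2) • g))

/-- `∑_{k>0} a_k l_k`, coefficientwise a finite sum. -/
def suml (a : ℕ+ → ℂ) (g : PowerSeries ℂ) : PowerSeries ℂ :=
  PowerSeries.mk fun n => ∑ᶠ k : ℕ+, a k * PowerSeries.coeff n (opl k g)

/-- `exp (∑_{k>0} a_k l_k)`, coefficientwise a finite sum. -/
def expl (a : ℕ+ → ℂ) (g : PowerSeries ℂ) : PowerSeries ℂ :=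
  PowerSeries.mk fun n =>
    ∑ᶠ j : ℕ, ((j.factorial : ℂ)⁻¹) * PowerSeries.coeff n ((suml a)^[j] g)

/-- `f(z) = e^{∑ a_k l_k} z e^{-∑ a_k l_k}` as multiplication operators on `ℂ[[z]]`. -/
def IsConjugate (a : ℕ+ → ℂ) (f : PowerSeries ℂ) : Prop :=
  ∀ g : PowerSeries ℂ, expl a (PowerSeries.X * expl (-a) g) = f * g

/-- `1 / ((1 + s z)(1 + q z / s))`, which is `(1/z) dx/dz`. -/
def dyqp (q s : ℂ) : PowerSeries ℂ :=
  ((1 + PowerSeries.C s * PowerSeries.X) * (1 + PowerSeries.C (q / s) * PowerSeries.X))⁻¹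

/-- `dx/dz = z / ((1 + s z)(1 + q z / s))`. -/
def dxqp (q s : ℂ) : PowerSeries ℂ := PowerSeries.X * dyqp q s

/-- `f ∈ z + z² ℂ[[z]]` and `f df = dx`. -/
def IsfSeries (q s : ℂ) (f : PowerSeries ℂ) : Prop :=
  PowerSeries.coeff 0 f = 0 ∧ PowerSeries.coeff 1 f = 1 ∧
    f * PowerSeries.derivative ℂ f = dxqp q s

/-- `∫_0^z g`. -/
def integ (g : PowerSeries ℂ) : PowerSeries ℂ :=
  PowerSeries.mk fun n => if n = 0 then 0 else PowerSeries.coeff (n - 1) g / n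

/-- `v_k = [z^k] ∫_0^z (f - y) dx` with `y = ∫_0^z dx/η`. -/
def vCoef (q s : ℂ) (f : PowerSeries ℂ) (k : ℕ) : ℂ :=
  PowerSeries.coeff k (integ ((f - integ (dyqp q s)) * dxqp q s))

/-- `Z ↦ (R̂_{q,p} Z)` taken at `T = T^{q,p}(t)`. -/
def lhsOp (q p s : ℂ) (Z : FunT) : Funt :=
  MvPolynomial.aeval (Tqp q p s) (givental (Rqp q p) Z)

/-- `Z ↦ e^{ħ⁻¹ ∑_{k≥4} v_k ∂/∂t_k} e^{∑_{k>0} a_k L_k} Z`. -/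
def rhsOp (q s : ℂ) (f : PowerSeries ℂ) (a : ℕ+ → ℂ) (Z : FunT) : Funt :=
  expJ (fun k => if 4 ≤ (k : ℕ) then vCoef q s f k • hbarInv else 0)
    (expL (fun k => LaurentPolynomial.C (a k)) (oddTimes Z))

/-! ### Action on arbitrary formal functions -/

/-- Formal functions `∑ Z_{α,m} ħ^m T^α`, with arbitrary complex coefficients `Z_{α,m}`. -/
abbrev FormalFun : Type := (ℕ →₀ ℕ) → ℤ → ℂ

/-- The contributions to the coefficient of `ħ^n t^β` in `D Z`, one for each term `ħ^m T^α`
of `Z`. -/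
def contrib (D : FunT → Funt) (Z : FormalFun) (β : ℕ+ →₀ ℕ) (n : ℤ) (x : (ℕ →₀ ℕ) × ℤ) : ℂ :=
  Z x.1 x.2 * (MvPolynomial.coeff β (D (MvPolynomial.monomial x.1 1))).coeff (n - x.2)

/-- `D Z` makes sense as a formal series: only finitely many terms of `Z` contribute to each
coefficient. -/
def MakesSense (D : FunT → Funt) (Z : FormalFun) : Prop :=
  ∀ β n, (Function.support (contrib D Z β n)).Finite

/-- The coefficient of `ħ^n t^β` in `D Z`. -/
def formalApply (D : FunT → Funt) (Z : FormalFun) (β : ℕ+ →₀ ℕ) (n : ℤ) : ℂ :=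
  ∑ᶠ x : (ℕ →₀ ℕ) × ℤ, contrib D Z β n x

end

end GiventalKP

/-! Both kinds of operators are exponentials of quadratic expressions in a Heisenberg algebra, so
conjugation by them acts linearly on Heisenberg operators, that is, on their symbols in z
(`Fock.Shift.opExp_b`). Since they fix the vacuum 1, each obeys a recursion Φ(T_j Z) = m_j Φ(Z) +
Φ(∑ Q_jk ∂Z/∂T_k) and is determined by its mean m and covariance Q (`IsGaussian.ext`). On the
Givental side symbols are multiplied by ρ = 1/R. On the Virasoro side z is replaced by f = z/H, the
image of z under the flow of a vector field.

Explicit formula. Let f df = dx = z dz/U with U = (1+αz)(1+βz). The operator `opW` of the change of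
variables is -d/dx on symbols, so T_k is (-d/dx)^k z⁻¹, while the Virasoro means are the negative
parts of (2j-1)!! f^{-(2j+1)} = (-d/dx)^j f⁻¹. Truncating to negative parts produces correction
terms, which assemble into a series `rhoH H` playing the role of 1/R (`IsH.formM_eq`). Integration
by parts gives equality of the covariances (`IsH.covOdd_eq`), and residues of f dx and y dx give the
translation (`IsH.resFun_f_formM`, `resFun_y_formT`). This proves `lhsOp_eq_rhsOp` once `rhoH H` is
known to be 1/R_{q,p}.

Identification of `rhoH H`. It is the formal Laplace transform of 1 along the curve, with e^{-x/ħ}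
as kernel. For α = 1, β = 1/N the function e^{-(1-1/N)x} is rational in z, which yields a functional
equation relating ρ(z) to ρ(z/(1+(1-1/N)z)) (`rhoH_functional`). The combination of Stirling series
in R_{q,p} satisfies the same equation by Faulhaber's formula (`expnt_sub_mob`), and its solution
with constant term 1 is unique. The coefficients are polynomials in β, so agreement at all 1/N gives
all β, and rescaling z gives all α ≠ 0.

Classification. If R̂ coincides with a group element, constant terms do not see the change of
variables or the raising factors; moments of degree at most two give equality of the covariances of
R̂ and of some flow z/H (`exists_covOdd_eq`). The covariance of R̂ satisfies quadratic relations,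
which translate into relations between H and the series U defined by H³ = U(H - zH')
(`quadN_eq_zero`). The covariance is invariant under Möbius transformations (`covH_gauge`), so one
may normalize [z]H = 0; the relations then force U to be a polynomial of degree at most three
(`coeff_eq_zero_of_quadN`). A second Möbius transformation removes one of its three linear factors,
leaving the curves above. -/

namespace GiventalKP

open PowerSeries Finset

noncomputable section

/-! ### Exponentials of locally nilpotent operators -/

section Leibniz

variable {U V W W' : Type*} [AddCommGroup U] [Module ℂ U] [AddCommGroup V] [Module ℂ V]
  [AddCommGroup W] [Module ℂ W] [AddCommGroup W'] [Module ℂ W']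

/-- The divided power `S ^ k / k!` of an endomorphism. -/
def divPow (S : Module.End ℂ U) (k : ℕ) : Module.End ℂ U := ((k.factorial : ℂ)⁻¹) • S ^ k

lemma divPow_zero (S : Module.End ℂ U) (u : U) : divPow S 0 u = u := by simp [divPow]

lemma divPow_succ (S : Module.End ℂ U) (k : ℕ) (u : U) :
    ((k : ℂ) + 1) • divPow S (k + 1) u = S (divPow S k u) := by
  have h : ((k : ℂ) + 1) ≠ 0 := by exact_mod_cast k.succ_ne_zero
  simp only [divPow, LinearMap.smul_apply, map_smul, pow_succ', Module.End.mul_apply, smul_smul,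
    Nat.factorial_succ, Nat.cast_mul, Nat.cast_add, Nat.cast_one, mul_inv]
  rw [← mul_assoc, mul_inv_cancel₀ h, one_mul]

lemma divPow_apply (S : Module.End ℂ U) (k : ℕ) (u : U) :
    divPow S k u = ((k.factorial : ℂ)⁻¹) • S^[k] u := by
  simp [divPow, Module.End.pow_apply]

/-- Divided powers absorb the binomial coefficients. In the induction step k + 1 is written as x.1 +
x.2 on the antidiagonal, and each half lowers one of the two indices. -/
theorem divPow_leibniz {β : U →ₗ[ℂ] V →ₗ[ℂ] W} {SU : Module.End ℂ U} {SV : Module.End ℂ V}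
    {SW : Module.End ℂ W} (h : ∀ u v, SW (β u v) = β (SU u) v + β u (SV v)) (k : ℕ) (u : U)
    (v : V) : divPow SW k (β u v) =
      ∑ x ∈ antidiagonal k, β (divPow SU x.1 u) (divPow SV x.2 v) := by
  induction k with
  | zero => simp [divPow_zero]
  | succ k ih =>
    have hk : ((k : ℂ) + 1) ≠ 0 := by exact_mod_cast k.succ_ne_zero
    apply smul_right_injective W hk
    simp only
    rw [divPow_succ, ih, map_sum]
    simp only [h, ← divPow_succ, map_smul, LinearMap.smul_apply, sum_add_distrib]
    have e : ((k : ℂ) + 1) • ∑ x ∈ antidiagonal (k + 1), β (divPow SU x.1 u) (divPow SV x.2 v) =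
        ∑ x ∈ antidiagonal (k + 1), (x.1 : ℂ) • β (divPow SU x.1 u) (divPow SV x.2 v) +
        ∑ x ∈ antidiagonal (k + 1), (x.2 : ℂ) • β (divPow SU x.1 u) (divPow SV x.2 v) := by
      rw [smul_sum, ← sum_add_distrib]
      refine sum_congr rfl fun x hx => ?_
      rw [← add_smul]
      congr 1
      have := HasAntidiagonal.mem_antidiagonal.mp hx
      exact_mod_cast this.symm
    rw [e, Finset.Nat.sum_antidiagonal_succ, Finset.Nat.sum_antidiagonal_succ']
    simp

/-- The exponential turns a Leibniz rule into multiplicativity, in a finite form: `π` is a map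
after which only finitely many terms survive. -/
theorem sum_divPow_leibniz {β : U →ₗ[ℂ] V →ₗ[ℂ] W} {SU : Module.End ℂ U} {SV : Module.End ℂ V}
    {SW : Module.End ℂ W} (h : ∀ u v, SW (β u v) = β (SU u) v + β u (SV v)) (π : W →ₗ[ℂ] W')
    (u : U) (v : V) {N K : ℕ} (hK : 2 * N ≤ K)
    (hN : ∀ m n, N ≤ m ∨ N ≤ n → π (β (divPow SU m u) (divPow SV n v)) = 0) :
    ∑ k ∈ range K, π (divPow SW k (β u v)) =
      π (β (∑ m ∈ range N, divPow SU m u) (∑ n ∈ range N, divPow SV n v)) := by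
  simp only [divPow_leibniz h, map_sum, LinearMap.sum_apply]
  rw [← Finset.sum_product_right', Finset.sum_sigma']
  symm
  -- The square of pairs below N lies in the triangle m + n < K because K ≥ 2N; the pairs of the
  -- triangle outside the square contribute zero by `hN`.
  refine Finset.sum_bij_ne_zero (fun x _ _ => ⟨x.1 + x.2, x⟩) ?_ ?_ ?_ ?_
  · intro x hx _
    simp only [mem_product, mem_range] at hx
    simp only [mem_sigma, mem_range, HasAntidiagonal.mem_antidiagonal, and_true]
    omega
  · intro x _ _ y _ _ hxy
    simp only [Sigma.mk.injEq] at hxy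
    exact eq_of_heq hxy.2
  · rintro ⟨k, x⟩ hx hne
    simp only [mem_sigma, mem_range, HasAntidiagonal.mem_antidiagonal] at hx
    refine ⟨x, ?_, hne, ?_⟩
    · simp only [mem_product, mem_range]
      by_contra hcon
      exact hne (hN x.1 x.2 (by omega))
    · obtain ⟨_, rfl⟩ := hx
      rfl
  · intro x _ _
    rfl

lemma divPow_eq_zero {S : Module.End ℂ U} {u : U} {N n : ℕ} (hN : divPow S N u = 0)
    (hn : N ≤ n) : divPow S n u = 0 := by
  have h : (S ^ N) u = 0 := by
    have h0 : ((N.factorial : ℂ)⁻¹) ≠ 0 := inv_ne_zero (by exact_mod_cast N.factorial_ne_zero)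
    simpa [divPow, h0, Nat.factorial_ne_zero] using hN
  obtain ⟨m, rfl⟩ := Nat.exists_eq_add_of_le' hn
  simp [divPow, pow_add, h]

end Leibniz

/-- The `finsum` in `opExp` is meaningful only for finite support; one vanishing divided power makes
all later ones vanish and provides it. -/
lemma opExp_eq_sum {M : Type} [AddCommGroup M] [Module ℂ M] (S : Module.End ℂ M) (P : M) {N : ℕ}
    (hN : divPow S N P = 0) : opExp S P = ∑ n ∈ range N, divPow S n P := by
  unfold opExp
  simp only [← divPow_apply]
  refine finsum_eq_sum_of_support_subset _ fun n hn => ?_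
  simp only [coe_range, Set.mem_Iio]
  by_contra hcon
  exact hn (divPow_eq_zero hN (not_lt.mp hcon))

/-! ### Exponentials on power series -/

lemma coeff_mul_congr {𝕜 : Type*} [CommRing 𝕜] {g g' h h' : 𝕜⟦X⟧} {n : ℕ} (hg : ∀ m ≤ n, coeff m g = coeff m g')
    (hh : ∀ m ≤ n, coeff m h = coeff m h') : coeff n (g * h) = coeff n (g' * h') := by
  rw [coeff_mul, coeff_mul]
  refine sum_congr rfl fun x hx => ?_
  have := HasAntidiagonal.mem_antidiagonal.mp hx
  rw [hg _ (by omega), hh _ (by omega)]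

lemma coeff_mul_eq_zero {𝕜 : Type*} [CommRing 𝕜] {g h : 𝕜⟦X⟧} {n a b : ℕ} (hab : n < a + b)
    (hg : ∀ m < a, coeff m g = 0) (hh : ∀ m < b, coeff m h = 0) : coeff n (g * h) = 0 := by
  rw [coeff_mul]
  refine sum_eq_zero fun x hx => ?_
  have := HasAntidiagonal.mem_antidiagonal.mp hx
  rcases lt_or_ge x.1 a with h1 | h1
  · rw [hg _ h1, zero_mul]
  · rw [hh _ (by omega), mul_zero]

section Expo

variable {𝕜 : Type*} [CommRing 𝕜] [Algebra ℂ 𝕜]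

/-- An operator on power series that raises the order. -/
def Raises (S : Module.End ℂ 𝕜⟦X⟧) : Prop :=
  ∀ (n : ℕ) (g : 𝕜⟦X⟧), (∀ m < n, coeff m g = 0) → ∀ m < n + 1, coeff m (S g) = 0

/-- The exponential of an operator that raises the order. -/
def expo (S : Module.End ℂ 𝕜⟦X⟧) (g : 𝕜⟦X⟧) : 𝕜⟦X⟧ :=
  mk fun n => ∑ j ∈ range (n + 1), coeff n (divPow S j g)

lemma Raises.coeff_divPow {S : Module.End ℂ 𝕜⟦X⟧} (hS : Raises S) (g : 𝕜⟦X⟧) {m k : ℕ}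
    (h : m < k) : coeff m (divPow S k g) = 0 := by
  have : ∀ m < k, coeff m ((S ^ k) g) = 0 := by
    clear h
    induction k with
    | zero => simp
    | succ k ih =>
      rw [pow_succ', Module.End.mul_apply]
      exact hS _ _ ih
  simp [divPow, this m h]

lemma Raises.coeff_divPow_of_le {S : Module.End ℂ 𝕜⟦X⟧} (hS : Raises S) (g : 𝕜⟦X⟧) {n : ℕ}
    (hg : ∀ m < n, coeff m g = 0) {m k : ℕ} (h : m < n + k) : coeff m (divPow S k g) = 0 := by
  have : ∀ m < n + k, coeff m ((S ^ k) g) = 0 := by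
    clear h
    induction k with
    | zero => simpa using hg
    | succ k ih =>
      rw [pow_succ', Module.End.mul_apply]
      exact hS _ _ ih
  simp [divPow, this m h]

lemma Raises.coeff_expo {S : Module.End ℂ 𝕜⟦X⟧} (hS : Raises S) (g : 𝕜⟦X⟧) {n N : ℕ}
    (h : n < N) : coeff n (expo S g) = coeff n (∑ j ∈ range N, divPow S j g) := by
  rw [expo, coeff_mk, map_sum]
  refine Finset.sum_subset (by simpa using h) fun x _ hx => ?_
  exact hS.coeff_divPow g (by simpa using hx)

/-- Three different operators are allowed so that the rule covers first order operators whose zeroth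
order terms add up under multiplication, as in `vf_mul`. -/
theorem expo_mul {S₁ S₂ S₃ : Module.End ℂ 𝕜⟦X⟧} (h₁ : Raises S₁) (h₂ : Raises S₂)
    (h₃ : Raises S₃) (h : ∀ g k, S₃ (g * k) = S₁ g * k + g * S₂ k) (g k : 𝕜⟦X⟧) :
    expo S₃ (g * k) = expo S₁ g * expo S₂ k := by
  ext n
  have key := sum_divPow_leibniz (β := LinearMap.mul ℂ 𝕜⟦X⟧) (SU := S₁) (SV := S₂) (SW := S₃)
    (by simpa using h) ((coeff n).restrictScalars ℂ : 𝕜⟦X⟧ →ₗ[ℂ] 𝕜) g k (N := n + 1)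
    (K := 2 * (n + 1)) le_rfl ?_
  · rw [h₃.coeff_expo _ (show n < 2 * (n + 1) by omega)]
    simp only [LinearMap.mul_apply', LinearMap.coe_restrictScalars] at key
    rw [map_sum, key]
    refine coeff_mul_congr (fun m hm => ?_) fun m hm => ?_
    · rw [h₁.coeff_expo _ (Nat.lt_succ_of_le hm)]
    · rw [h₂.coeff_expo _ (Nat.lt_succ_of_le hm)]
  · intro a b hab
    simp only [LinearMap.mul_apply', LinearMap.coe_restrictScalars]
    refine coeff_mul_eq_zero (a := a) (b := b) (by omega) (fun m hm => h₁.coeff_divPow _ hm)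
      fun m hm => h₂.coeff_divPow _ hm

/-- A pairing invariant under a pair of operators is invariant under their exponentials. -/
theorem expo_pairing {W : Type*} [AddCommGroup W] [Module ℂ W] {S₁ S₂ : Module.End ℂ 𝕜⟦X⟧}
    (h₁ : Raises S₁) (h₂ : Raises S₂) (β : 𝕜⟦X⟧ →ₗ[ℂ] 𝕜⟦X⟧ →ₗ[ℂ] W) (N : ℕ)
    (hβ₁ : ∀ g k, (∀ m < N, coeff m g = 0) → β g k = 0)
    (hβ₂ : ∀ g k, (∀ m < N, coeff m k = 0) → β g k = 0)
    (h : ∀ g k, β (S₁ g) k + β g (S₂ k) = 0) (g k : 𝕜⟦X⟧) :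
    β (expo S₁ g) (expo S₂ k) = β g k := by
  -- Invariance says that the pairing intertwines the two operators with 0, of which only the zeroth
  -- divided power survives.
  have key := sum_divPow_leibniz (β := β) (SU := S₁) (SV := S₂) (SW := 0)
    (by simp [h]) LinearMap.id g k (N := N) (K := 2 * N + 1) (by omega) ?_
  · rw [Finset.sum_range_succ'] at key
    have hz : ∀ j, divPow (0 : Module.End ℂ W) (j + 1) (β g k) = 0 := by
      intro j; simp [divPow]
    simp only [LinearMap.id_apply, hz, divPow_zero, sum_const_zero, zero_add] at key
    rw [key]
    have e1 : β (expo S₁ g - ∑ m ∈ range N, divPow S₁ m g) (expo S₂ k) = 0 :=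
      hβ₁ _ _ fun m hm => by rw [map_sub, h₁.coeff_expo _ hm, sub_self]
    have e2 : β (∑ m ∈ range N, divPow S₁ m g) (expo S₂ k - ∑ m ∈ range N, divPow S₂ m k) = 0 :=
      hβ₂ _ _ fun m hm => by rw [map_sub, h₂.coeff_expo _ hm, sub_self]
    rw [map_sub, LinearMap.sub_apply, sub_eq_zero] at e1
    rw [map_sub, sub_eq_zero] at e2
    rw [e1, e2]
  · rintro a b (hab | hab)
    · exact hβ₁ _ _ fun m hm => h₁.coeff_divPow _ (by omega)
    · exact hβ₂ _ _ fun m hm => h₂.coeff_divPow _ (by omega)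

lemma expo_of_apply_eq_zero {S : Module.End ℂ 𝕜⟦X⟧} {g : 𝕜⟦X⟧} (h : S g = 0) : expo S g = g := by
  ext n
  rw [expo, coeff_mk, Finset.sum_range_succ']
  simp [divPow, pow_succ, h]

/-- The exponential on power series controls the conjugation of an exponential on a module. -/
theorem opExp_bilin {M : Type} [AddCommGroup M] [Module ℂ M] {S : Module.End ℂ 𝕜⟦X⟧}
    (hS : Raises S) (A : Module.End ℂ M) (B : 𝕜⟦X⟧ →ₗ[ℂ] M →ₗ[ℂ] M)
    (hB : ∀ P, ∃ N, ∀ g, (∀ m < N, coeff m g = 0) → B g P = 0)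
    (h : ∀ g P, A (B g P) = B (S g) P + B g (A P)) (g : 𝕜⟦X⟧) (P : M)
    (hP : ∃ N, divPow A N P = 0) :
    (∃ N, divPow A N (B g P) = 0) ∧ opExp A (B g P) = B (expo S g) (opExp A P) := by
  obtain ⟨n₀, hn₀⟩ := hP
  choose c hc using hB
  -- From `n₀` on the divided powers of `A` kill `P`. For the finitely many smaller `n`, the bound
  -- also exceeds the order from which series act as zero on `divPow A n P`.
  set N := max n₀ ((range n₀).sup fun n => c (divPow A n P)) with hNdef
  have hkill : ∀ n g, (∀ m < N, coeff m g = 0) → B g (divPow A n P) = 0 := by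
    intro n g hg
    rcases lt_or_ge n n₀ with hn | hn
    · refine hc _ _ fun m hm => hg _ (lt_of_lt_of_le hm ?_)
      exact (Finset.le_sup (f := fun n => c (divPow A n P)) (mem_range.mpr hn)).trans
        (le_max_right _ _)
    · rw [divPow_eq_zero hn₀ hn, map_zero]
  have hN : ∀ m n, N ≤ m ∨ N ≤ n → B (divPow S m g) (divPow A n P) = 0 := by
    rintro m n (hm | hn)
    · exact hkill _ _ fun k hk => hS.coeff_divPow _ (by omega)
    · rw [divPow_eq_zero hn₀ ((le_max_left _ _).trans hn), map_zero]
  have hnil : divPow A (2 * N) (B g P) = 0 := by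
    rw [divPow_leibniz (β := B) h]
    refine sum_eq_zero fun x hx => hN _ _ ?_
    have := HasAntidiagonal.mem_antidiagonal.mp hx
    omega
  refine ⟨⟨_, hnil⟩, ?_⟩
  rw [opExp_eq_sum A _ hnil]
  have key := sum_divPow_leibniz (β := B) h LinearMap.id g P (N := N) (K := 2 * N) le_rfl
    (by simpa using hN)
  simp only [LinearMap.id_apply] at key
  rw [key, opExp_eq_sum A P (divPow_eq_zero hn₀ (le_max_left _ _) : divPow A N P = 0),
    ← sub_eq_zero, ← LinearMap.sub_apply, ← map_sub, map_sum]
  refine sum_eq_zero fun n _ => hkill _ _ fun m hm => ?_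
  rw [map_sub, hS.coeff_expo _ hm, sub_self]

end Expo


/-! ### Conjugation of Heisenberg operators -/

/-- A module generated from a vacuum by operators `b r` with `r < 0`, on which `b r` acts locally
trivially for large `r`. -/
structure Fock (𝕜 : Type*) (M : Type) [CommRing 𝕜] [AddCommGroup M] [Module 𝕜 M] where
  b : ℤ → M →ₗ[𝕜] M
  vac : M
  tame : ∀ P, ∃ N : ℕ, ∀ r : ℤ, N ≤ r → b r P = 0
  gen : ∀ p : Submodule 𝕜 M, vac ∈ p → (∀ P ∈ p, ∀ r < 0, b r P ∈ p) → ∀ P, P ∈ p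

namespace Fock

variable {𝕜 : Type*} {M : Type} [CommRing 𝕜] [AddCommGroup M] [Module 𝕜 M]

/-- Operators `op k` that shift the index of the Heisenberg operators by `k`. -/
structure Shift (F : Fock 𝕜 M) where
  op : ℕ → M →ₗ[𝕜] M
  y : ℕ → ℤ → 𝕜
  y_zero : ∀ r, y 0 r = 0
  op_vac : ∀ k, op k F.vac = 0
  comm : ∀ k r P, op k (F.b r P) = F.b r (op k P) + y k r • F.b (r + k) P

lemma finsum_coeff_eq_sum (F : Fock 𝕜 M) (i : ℕ) (g : 𝕜⟦X⟧) (P : M) {N : ℕ}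
    (hN : ∀ r : ℤ, (N : ℤ) - i ≤ r → F.b r P = 0) :
    ∑ᶠ n : ℕ, coeff n g • F.b (n - i) P = ∑ n ∈ range N, coeff n g • F.b (n - i) P := by
  refine finsum_eq_sum_of_support_subset _ fun n hn => ?_
  simp only [coe_range, Set.mem_Iio]
  by_contra hcon
  apply hn
  simp only
  rw [hN _ (by omega), smul_zero]

lemma exists_bound (F : Fock 𝕜 M) (i : ℕ) (P : M) :
    ∃ N : ℕ, ∀ r : ℤ, (N : ℤ) - i ≤ r → F.b r P = 0 := by
  obtain ⟨N, hN⟩ := F.tame P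
  exact ⟨N + i, fun r hr => hN r (by push_cast at hr; omega)⟩

namespace Shift

variable {F : Fock 𝕜 M} (Y : Shift F)

/-- The vectors killed by all but finitely many `op k` form a submodule; it contains the vacuum and
is stable under creation operators, hence is everything. -/
lemma op_tame (P : M) : ∃ N, ∀ k, N ≤ k → Y.op k P = 0 := by
  let p : Submodule 𝕜 M :=
    { carrier := {P | ∃ N, ∀ k, N ≤ k → Y.op k P = 0}
      add_mem' := by
        rintro P Q ⟨N, hN⟩ ⟨N', hN'⟩
        exact ⟨N + N', fun k hk => by rw [map_add, hN k (by omega), hN' k (by omega), add_zero]⟩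
      zero_mem' := ⟨0, fun k _ => map_zero _⟩
      smul_mem' := by
        rintro c P ⟨N, hN⟩
        exact ⟨N, fun k hk => by rw [map_smul, hN k hk, smul_zero]⟩ }
  refine F.gen p ⟨0, fun k _ => Y.op_vac k⟩ ?_ P
  rintro Q ⟨N, hN⟩ r _
  obtain ⟨N', hN'⟩ := F.tame Q
  refine ⟨N + N' + (-r).toNat, fun k hk => ?_⟩
  rw [Y.comm, hN k (by omega), hN' _ (by omega), map_zero, smul_zero, add_zero]

lemma finsum_op_eq_sum (P : M) {N : ℕ} (hN : ∀ k, N ≤ k → Y.op k P = 0) :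
    ∑ᶠ k, Y.op k P = ∑ k ∈ range N, Y.op k P := by
  refine finsum_eq_sum_of_support_subset _ fun n hn => ?_
  simp only [coe_range, Set.mem_Iio]
  by_contra hcon
  exact hn (hN n (not_lt.mp hcon))

/-- The sum of the operators `op k`. -/
def A : M →ₗ[𝕜] M where
  toFun P := ∑ᶠ k, Y.op k P
  map_add' P Q := by
    obtain ⟨N, hN⟩ := Y.op_tame P
    obtain ⟨N', hN'⟩ := Y.op_tame Q
    rw [Y.finsum_op_eq_sum P (N := N + N') fun k hk => hN k (by omega),
      Y.finsum_op_eq_sum Q (N := N + N') fun k hk => hN' k (by omega),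
      Y.finsum_op_eq_sum (P + Q) (N := N + N')
        fun k hk => by rw [map_add, hN k (by omega), hN' k (by omega), add_zero]]
    simp only [map_add, sum_add_distrib]
  map_smul' c P := by
    obtain ⟨N, hN⟩ := Y.op_tame P
    rw [Y.finsum_op_eq_sum P hN, Y.finsum_op_eq_sum (c • P) (N := N)
      fun k hk => by rw [map_smul, hN k hk, smul_zero]]
    simp only [map_smul, smul_sum, RingHom.id_apply]

lemma A_eq_sum (P : M) {N : ℕ} (hN : ∀ k, N ≤ k → Y.op k P = 0) :
    Y.A P = ∑ k ∈ range N, Y.op k P := Y.finsum_op_eq_sum P hN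

lemma A_vac : Y.A F.vac = 0 := by
  rw [Y.A_eq_sum F.vac (N := 0) fun k _ => Y.op_vac k]; simp

lemma A_b (r : ℤ) (P : M) {N : ℕ} (h1 : ∀ k, N ≤ k → Y.op k P = 0)
    (h2 : ∀ s : ℤ, r + N ≤ s → F.b s P = 0) :
    Y.A (F.b r P) = F.b r (Y.A P) + ∑ k ∈ range N, Y.y k r • F.b (r + k) P := by
  rw [Y.A_eq_sum P h1, Y.A_eq_sum (F.b r P) (N := N)]
  · simp only [Y.comm, sum_add_distrib, map_sum]
  · intro k hk
    rw [Y.comm, h1 k hk, h2 _ (by omega), map_zero, smul_zero, add_zero]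

section

variable [Algebra ℂ 𝕜]

/-- The action on the symbol `z⁻ⁱ g(z)` of a Heisenberg operator. -/
def S (i : ℕ) : Module.End ℂ 𝕜⟦X⟧ where
  toFun g := PowerSeries.mk fun m => ∑ n ∈ range m, Y.y (m - n) (n - i) * coeff n g
  map_add' g g' := by
    ext m
    simp [mul_add, sum_add_distrib]
  map_smul' c g := by
    ext m
    simp [smul_sum]

lemma coeff_S (i : ℕ) (g : 𝕜⟦X⟧) (m : ℕ) :
    coeff m (Y.S i g) = ∑ n ∈ range m, Y.y (m - n) (n - i) * coeff n g := by
  simp [S]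

lemma raises_S (i : ℕ) : Raises (Y.S i) := by
  intro n g hg m hm
  rw [coeff_S]
  exact sum_eq_zero fun k hk => by
    rw [hg k (by have := mem_range.mp hk; omega), mul_zero]

end

end Shift

variable [Algebra ℂ 𝕜] [Module ℂ M] [IsScalarTower ℂ 𝕜 M]

/-- The operator `∑ₙ gₙ b (n - i)`, that is the Heisenberg operator of `z⁻ⁱ g(z)`. -/
def B (F : Fock 𝕜 M) (i : ℕ) : 𝕜⟦X⟧ →ₗ[ℂ] M →ₗ[ℂ] M :=
  LinearMap.mk₂ ℂ (fun g P => ∑ᶠ n : ℕ, coeff n g • F.b (n - i) P)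
    (fun g g' P => by
      obtain ⟨N, hN⟩ := F.exists_bound i P
      rw [F.finsum_coeff_eq_sum i _ P hN, F.finsum_coeff_eq_sum i _ P hN,
        F.finsum_coeff_eq_sum i _ P hN]
      simp only [map_add, add_smul, sum_add_distrib])
    (fun c g P => by
      obtain ⟨N, hN⟩ := F.exists_bound i P
      rw [F.finsum_coeff_eq_sum i _ P hN, F.finsum_coeff_eq_sum i _ P hN]
      simp only [smul_sum, PowerSeries.coeff_smul, smul_assoc])
    (fun g P P' => by
      obtain ⟨N, hN⟩ := F.exists_bound i P
      obtain ⟨N', hN'⟩ := F.exists_bound i P'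
      have h1 : ∀ r : ℤ, ((N + N' : ℕ) : ℤ) - i ≤ r → F.b r P = 0 :=
        fun r hr => hN r (by push_cast at hr; omega)
      have h2 : ∀ r : ℤ, ((N + N' : ℕ) : ℤ) - i ≤ r → F.b r P' = 0 :=
        fun r hr => hN' r (by push_cast at hr; omega)
      rw [F.finsum_coeff_eq_sum i _ P h1, F.finsum_coeff_eq_sum i _ P' h2,
        F.finsum_coeff_eq_sum i _ (P + P') (N := N + N')
          fun r hr => by rw [map_add, h1 r hr, h2 r hr, add_zero]]
      simp only [map_add, smul_add, sum_add_distrib])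
    (fun c g P => by
      obtain ⟨N, hN⟩ := F.exists_bound i P
      have e : ∀ r, F.b r (c • P) = c • F.b r P := fun r => by
        rw [← algebraMap_smul 𝕜 c P, map_smul, algebraMap_smul]
      rw [F.finsum_coeff_eq_sum i _ P hN, F.finsum_coeff_eq_sum i _ (c • P) (N := N)
        fun r hr => by rw [e, hN r hr, smul_zero]]
      simp only [e, smul_sum]
      refine sum_congr rfl fun n _ => ?_
      rw [← algebraMap_smul 𝕜 c, ← algebraMap_smul 𝕜 c, smul_comm])

lemma B_eq_sum (F : Fock 𝕜 M) (i : ℕ) (g : 𝕜⟦X⟧) (P : M) {N : ℕ}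
    (hN : ∀ r : ℤ, (N : ℤ) - i ≤ r → F.b r P = 0) :
    F.B i g P = ∑ n ∈ range N, coeff n g • F.b (n - i) P :=
  F.finsum_coeff_eq_sum i g P hN

lemma B_one (F : Fock 𝕜 M) (i : ℕ) (P : M) : F.B i 1 P = F.b (-i) P := by
  obtain ⟨N, hN⟩ := F.exists_bound i P
  rw [F.B_eq_sum i 1 P (N := N + 1) fun r hr => hN r (by push_cast at hr; omega),
    sum_range_succ', sum_eq_zero fun n _ => by simp [coeff_one]]
  simp

lemma B_continuous (F : Fock 𝕜 M) (i : ℕ) (P : M) :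
    ∃ N, ∀ g : 𝕜⟦X⟧, (∀ m < N, coeff m g = 0) → F.B i g P = 0 := by
  obtain ⟨N, hN⟩ := F.exists_bound i P
  refine ⟨N, fun g hg => ?_⟩
  rw [F.B_eq_sum i g P hN]
  exact sum_eq_zero fun n hn => by rw [hg n (mem_range.mp hn), zero_smul]

namespace Shift

variable {F : Fock 𝕜 M} (Y : Shift F)

/-- Each commutator moves the index n to n + k. Collecting the terms by m = n + k produces the
coefficients of `S i g`. -/
theorem A_B (i : ℕ) (g : 𝕜⟦X⟧) (P : M) :
    Y.A (F.B i g P) = F.B i (Y.S i g) P + F.B i g (Y.A P) := by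
  obtain ⟨N0, h0⟩ := F.exists_bound i P
  obtain ⟨N1, h1⟩ := Y.op_tame P
  obtain ⟨N2, h2⟩ := F.exists_bound i (Y.A P)
  set N := N0 + N1 + N2 with hN
  have h0' : ∀ r : ℤ, (N : ℤ) - i ≤ r → F.b r P = 0 := fun r hr => h0 r (by omega)
  rw [F.B_eq_sum i g P h0', F.B_eq_sum i _ P h0', F.B_eq_sum i g (Y.A P) (N := N)
    fun r hr => h2 r (by omega), map_sum]
  simp only [map_smul]
  have step : ∀ n ∈ range N, coeff n g • Y.A (F.b (n - i) P) =
      coeff n g • F.b (n - i) (Y.A P) + ∑ m ∈ range N,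
        if n < m then (Y.y (m - n) (n - i) * coeff n g) • F.b (m - i) P else 0 := by
    intro n hn
    rw [Y.A_b (n - i) P (N := N) (fun k hk => h1 k (by omega))
      (fun s hs => h0' s (by omega)), smul_add]
    congr 1
    rw [smul_sum, ← Finset.sum_filter]
    have e : ∑ k ∈ range N, coeff n g • Y.y k (n - i) • F.b ((n : ℤ) - i + k) P =
        ∑ m ∈ Ico n (n + N), (Y.y (m - n) (n - i) * coeff n g) • F.b ((m : ℤ) - i) P := by
      rw [Finset.sum_Ico_eq_sum_range]
      simp only [add_tsub_cancel_left]
      refine sum_congr rfl fun k _ => ?_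
      rw [smul_smul, mul_comm]
      congr 3
      push_cast
      ring
    rw [e]
    symm
    refine Finset.sum_subset (fun m hm => ?_) fun m hm hm' => ?_
    · simp only [mem_filter, mem_range] at hm
      simp only [mem_Ico]
      omega
    · simp only [mem_filter, mem_range, not_and, not_lt, mem_Ico] at hm hm'
      rcases lt_or_ge m N with hmN | hmN
      -- `S` sums over n < m only; the diagonal term is absent because `y 0` vanishes.
      · have : m = n := le_antisymm (hm' hmN) hm.1
        rw [this, Nat.sub_self, Y.y_zero, zero_mul, zero_smul]
      · rw [h0' _ (by omega), smul_zero]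
  rw [sum_congr rfl step, sum_add_distrib, add_comm, Finset.sum_comm]
  congr 1
  refine sum_congr rfl fun m hm => ?_
  rw [coeff_S, sum_smul, ← Finset.sum_filter]
  congr 1
  ext n
  simp only [mem_filter, mem_range] at *
  omega

/-- The sum of the operators `op k` as a complex endomorphism. -/
def Aℂ : Module.End ℂ M :=
  { toFun := Y.A, map_add' := map_add _, map_smul' := fun c P => by
      rw [← algebraMap_smul 𝕜 c P, map_smul, algebraMap_smul]; rfl }

/-- Local nilpotency spreads from the vacuum: a creation operator is `B i 1`, and the first half of
`opExp_bilin` says that such operators preserve the locally nilpotent vectors. -/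
lemma nilpotent (P : M) : ∃ N, divPow Y.Aℂ N P = 0 := by
  have hA : ∀ (c : 𝕜) (n : ℕ) (P : M), divPow Y.Aℂ n (c • P) = c • divPow Y.Aℂ n P := by
    intro c n P
    induction n with
    | zero => simp [divPow_zero]
    | succ n ih =>
      have hk : ((n : ℂ) + 1) ≠ 0 := by exact_mod_cast n.succ_ne_zero
      apply smul_right_injective M hk
      simp only
      rw [divPow_succ, ih, ← algebraMap_smul 𝕜 ((n : ℂ) + 1) (c • _), smul_comm, algebraMap_smul,
        divPow_succ]
      exact map_smul Y.A _ _
  let p : Submodule 𝕜 M :=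
    { carrier := {P | ∃ N, divPow Y.Aℂ N P = 0}
      add_mem' := by
        rintro P Q ⟨N, hN⟩ ⟨N', hN'⟩
        exact ⟨N + N', by rw [map_add, divPow_eq_zero hN (by omega),
          divPow_eq_zero hN' (by omega), add_zero]⟩
      zero_mem' := ⟨0, map_zero _⟩
      smul_mem' := by
        rintro c P ⟨N, hN⟩
        exact ⟨N, by rw [hA, hN, smul_zero]⟩ }
  refine F.gen p ⟨1, ?_⟩ ?_ P
  · simpa [divPow, Aℂ] using Y.A_vac
  · intro Q hQ r hr
    have hr' : r = -((-r).toNat : ℤ) := by omega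
    have := (opExp_bilin (Y.raises_S (-r).toNat) Y.Aℂ (F.B (-r).toNat)
      (F.B_continuous _) (Y.A_B _) 1 Q hQ).1
    rwa [F.B_one, ← hr'] at this

theorem opExp_B (i : ℕ) (g : 𝕜⟦X⟧) (P : M) :
    opExp Y.A (F.B i g P) = F.B i (expo (Y.S i) g) (opExp Y.A P) :=
  (opExp_bilin (Y.raises_S i) Y.Aℂ (F.B i) (F.B_continuous i) (Y.A_B i) g P (Y.nilpotent P)).2

/-- The symbol z⁻ⁱ of one creation operator is transformed by the exponential. Together with
`opExp_vac` this determines the exponential on the whole module. -/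
theorem opExp_b (i : ℕ) (P : M) :
    opExp Y.A (F.b (-i) P) = F.B i (expo (Y.S i) 1) (opExp Y.A P) := by
  rw [← opExp_B, F.B_one]

theorem opExp_vac : opExp Y.A F.vac = F.vac := by
  have h : divPow Y.Aℂ 1 F.vac = 0 := by simpa [divPow, Aℂ] using Y.A_vac
  have := opExp_eq_sum Y.Aℂ F.vac h
  rw [sum_range_one, divPow_zero] at this
  exact this

/-- `opExp` as a linear map. -/
def expA : M →ₗ[𝕜] M where
  toFun := opExp Y.A
  map_add' P Q := by
    obtain ⟨N, hN⟩ := Y.nilpotent P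
    obtain ⟨N', hN'⟩ := Y.nilpotent Q
    have e1 := opExp_eq_sum Y.Aℂ P (divPow_eq_zero hN (show N ≤ N + N' by omega))
    have e2 := opExp_eq_sum Y.Aℂ Q (divPow_eq_zero hN' (show N' ≤ N + N' by omega))
    have e3 := opExp_eq_sum Y.Aℂ (P + Q) (N := N + N') (by
      rw [map_add, divPow_eq_zero hN (by omega), divPow_eq_zero hN' (by omega), add_zero])
    simp only [map_add, sum_add_distrib, ← e1, ← e2] at e3
    exact e3
  map_smul' c P := by
    have hA : ∀ (n : ℕ), divPow Y.Aℂ n (c • P) = c • divPow Y.Aℂ n P := by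
      intro n
      have h : ∀ n, Y.A^[n] (c • P) = c • Y.A^[n] P := by
        intro n
        induction n with
        | zero => rfl
        | succ n ih => rw [Function.iterate_succ_apply', ih, map_smul,
            Function.iterate_succ_apply']
      rw [divPow_apply, divPow_apply]
      change _ • Y.A^[n] (c • P) = c • _ • Y.A^[n] P
      rw [h, ← algebraMap_smul 𝕜 ((n.factorial : ℂ)⁻¹) (c • _), smul_comm, algebraMap_smul]
    obtain ⟨N, hN⟩ := Y.nilpotent P
    have e1 := opExp_eq_sum Y.Aℂ P hN
    have e3 := opExp_eq_sum Y.Aℂ (c • P) (N := N) (by rw [hA, hN, smul_zero])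
    simp only [hA, ← smul_sum, ← e1] at e3
    exact e3

end Shift

end Fock


/-! ### The Heisenberg module of the Virasoro operators -/

/-- `∂/∂t_k` for `k > 0`, and `0` otherwise, as a derivation. -/
def dDer (k : ℤ) : Derivation Coef Funt Funt :=
  if 0 < k then MvPolynomial.pderiv k.toNat.toPNat' else 0

lemma dVar_eq (k : ℤ) (P : Funt) : dVar k P = dDer k P := by
  unfold dVar dDer; split_ifs <;> rfl

lemma toPNat'_coe (j : ℕ+) : ((j : ℕ) : ℤ).toNat.toPNat' = j := by
  simp

lemma tVar_coe (j : ℕ+) : tVar (j : ℤ) = MvPolynomial.X j := by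
  have h : (0 : ℤ) < j := by exact_mod_cast j.pos
  rw [tVar, if_pos h, toPNat'_coe]

lemma dDer_coe (j : ℕ+) : dDer (j : ℤ) = MvPolynomial.pderiv j := by
  have h : (0 : ℤ) < j := by exact_mod_cast j.pos
  rw [dDer, if_pos h, toPNat'_coe]

lemma exists_pnat {k : ℤ} (hk : 0 < k) : ∃ j : ℕ+, k = (j : ℤ) :=
  ⟨⟨k.toNat, by omega⟩, by simp; omega⟩

lemma dDer_of_nonpos {k : ℤ} (hk : k ≤ 0) : dDer k = 0 := by
  rw [dDer, if_neg (by omega)]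

lemma tVar_of_nonpos {k : ℤ} (hk : k ≤ 0) : tVar k = 0 := by
  rw [tVar, if_neg (by omega)]

lemma dDer_tVar (a j : ℤ) : dDer a (tVar j) = if 0 < j ∧ a = j then 1 else 0 := by
  rcases le_or_gt j 0 with hj | hj
  · rw [tVar_of_nonpos hj, map_zero, if_neg (by omega)]
  rcases le_or_gt a 0 with ha | ha
  · rw [dDer_of_nonpos ha, if_neg (by omega), Derivation.zero_apply]
  obtain ⟨j, rfl⟩ := exists_pnat hj
  obtain ⟨a, rfl⟩ := exists_pnat ha
  rw [dDer_coe, tVar_coe, MvPolynomial.pderiv_X]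
  by_cases h : a = j
  · subst h; simp
  · have : ¬ ((a : ℤ) = (j : ℤ)) := by exact_mod_cast h
    rw [if_neg (by tauto), Pi.single_eq_of_ne (by tauto)]

lemma mkDerivation_const_comm {σ 𝕜 : Type*} [CommRing 𝕜] (c c' : σ → 𝕜) (P : MvPolynomial σ 𝕜) :
    MvPolynomial.mkDerivation 𝕜 (fun k => MvPolynomial.C (c k) : σ → MvPolynomial σ 𝕜)
      (MvPolynomial.mkDerivation 𝕜 (fun k => MvPolynomial.C (c' k) : σ → MvPolynomial σ 𝕜) P) =
    MvPolynomial.mkDerivation 𝕜 (fun k => MvPolynomial.C (c' k) : σ → MvPolynomial σ 𝕜)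
      (MvPolynomial.mkDerivation 𝕜 (fun k => MvPolynomial.C (c k)) P) := by
  have : ⁅MvPolynomial.mkDerivation 𝕜 (fun k => MvPolynomial.C (c k) : σ → MvPolynomial σ 𝕜),
      MvPolynomial.mkDerivation 𝕜 (fun k => MvPolynomial.C (c' k) : σ → MvPolynomial σ 𝕜)⁆ = 0 := by
    apply MvPolynomial.derivation_ext
    intro i
    simp [Derivation.commutator_apply, MvPolynomial.mkDerivation_X, MvPolynomial.derivation_C]
  rw [← sub_eq_zero, ← Derivation.commutator_apply, this, Derivation.zero_apply]

lemma dDer_eq_mkDerivation (a : ℤ) : dDer a = MvPolynomial.mkDerivation Coef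
    (fun k : ℕ+ => MvPolynomial.C (if a = k then 1 else 0)) := by
  apply MvPolynomial.derivation_ext
  intro j
  rw [← tVar_coe, dDer_tVar, tVar_coe, MvPolynomial.mkDerivation_X]
  have : (0 : ℤ) < j := by exact_mod_cast j.pos
  simp only [this, true_and]
  split_ifs <;> simp

lemma dDer_comm (a b : ℤ) (P : Funt) : dDer a (dDer b P) = dDer b (dDer a P) := by
  rw [dDer_eq_mkDerivation, dDer_eq_mkDerivation, mkDerivation_const_comm]

/-- The first order part of the Virasoro operators. -/
def derL (m : ℤ) : Derivation Coef Funt Funt :=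
  MvPolynomial.mkDerivation Coef (fun j : ℕ+ => ((j : ℤ) - m) • tVar ((j : ℤ) - m))

lemma opL_of_nonneg {m : ℤ} (hm : 0 ≤ m) (P : Funt) :
    opL m P = derL m P + (1 / 2 : ℂ) • ∑ a ∈ Finset.Ioo 0 m, dDer a (dDer (m - a) P) := by
  rw [opL, Finset.Ioo_eq_empty (by omega), sum_empty, smul_zero, zero_add, derL]
  simp only [dVar_eq]

lemma opJ_of_pos {r : ℤ} (hr : 0 < r) (P : Funt) : opJ r P = dDer r P := by
  rw [opJ, if_pos hr, dVar_eq]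

lemma opJ_of_nonpos {r : ℤ} (hr : r ≤ 0) (P : Funt) : opJ r P = (-r) • (tVar (-r) * P) := by
  rw [opJ, if_neg (by omega)]

/-- The Heisenberg operators as linear maps. -/
def linJ (r : ℤ) : Funt →ₗ[Coef] Funt where
  toFun := opJ r
  map_add' P Q := by
    rcases le_or_gt r 0 with h | h
    · simp only [opJ_of_nonpos h, mul_add, smul_add]
    · simp only [opJ_of_pos h, map_add]
  map_smul' c P := by
    rcases le_or_gt r 0 with h | h
    · simp only [opJ_of_nonpos h, mul_smul_comm, RingHom.id_apply]
      rw [smul_comm]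
    · simp only [opJ_of_pos h, Derivation.map_smul, RingHom.id_apply]

lemma linJ_apply (r : ℤ) (P : Funt) : linJ r P = opJ r P := rfl

/-- The Virasoro operators of nonnegative index as linear maps. -/
def linL (k : ℕ) : Funt →ₗ[Coef] Funt where
  toFun := opL k
  map_add' P Q := by
    simp only [opL_of_nonneg (Int.natCast_nonneg k), map_add, sum_add_distrib, smul_add]
    abel
  map_smul' c P := by
    simp only [opL_of_nonneg (Int.natCast_nonneg k), Derivation.map_smul, RingHom.id_apply, smul_add,
      ← smul_sum]
    rw [smul_comm]

lemma dDer_dDer_tVar_mul (a b j : ℤ) (P : Funt) : dDer a (dDer b (tVar j * P)) =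
    tVar j * dDer a (dDer b P) + (if 0 < j ∧ b = j then dDer a P else 0)
      + (if 0 < j ∧ a = j then dDer b P else 0) := by
  rw [Derivation.leibniz, dDer_tVar]
  split_ifs with h1 h2 h3
  all_goals
    simp only [smul_eq_mul, mul_one, mul_zero, map_add, add_zero, Derivation.leibniz, dDer_tVar]
    first
      | rw [if_pos h2] | rw [if_neg h2] | rw [if_pos h3] | rw [if_neg h3]
    try ring

/-- The second order part gives ∂_{k-j} twice, cancelling the factor 1/2, and only for j < k; the
first order part gives a multiple of t_{j-k}, only for j > k. Both cases are the one operator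
J_{k-j}. -/
lemma opL_tVar_mul {k : ℕ} (hk : 0 < k) (j : ℕ+) (P : Funt) :
    opL k (tVar j * P) = tVar j * opL k P + opJ ((k : ℤ) - j) P := by
  have hj : (0 : ℤ) < j := by exact_mod_cast j.pos
  rw [opL_of_nonneg (by omega), opL_of_nonneg (by omega), Derivation.leibniz]
  have e1 : derL k (tVar j) = ((j : ℤ) - k) • tVar ((j : ℤ) - k) := by
    rw [tVar_coe, derL, MvPolynomial.mkDerivation_X]
  have e2 : ∑ a ∈ Finset.Ioo 0 (k : ℤ), dDer a (dDer (k - a) (tVar j * P)) =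
      tVar j * ∑ a ∈ Finset.Ioo 0 (k : ℤ), dDer a (dDer (k - a) P)
      + (2 : ℂ) • dDer ((k : ℤ) - j) P := by
    simp only [dDer_dDer_tVar_mul, sum_add_distrib, ← mul_sum, hj, true_and, add_assoc]
    congr 1
    rw [two_smul]
    rcases lt_or_ge (j : ℤ) k with h | h
    · congr 1
      · rw [sum_eq_single ((k : ℤ) - j)]
        · rw [if_pos (by omega)]
        · intro a _ ha
          rw [if_neg (by omega)]
        · intro ha
          simp only [mem_Ioo] at ha
          omega
      · rw [sum_eq_single (j : ℤ)]
        · rw [if_pos rfl]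
        · intro a _ ha
          rw [if_neg (by omega)]
        · intro ha
          simp only [mem_Ioo] at ha
          omega
    · rw [dDer_of_nonpos (k := (k : ℤ) - j) (by omega), Derivation.zero_apply]
      rw [sum_eq_zero, sum_eq_zero]
      · intro a ha
        simp only [mem_Ioo] at ha
        rw [if_neg (by omega)]
      · intro a ha
        simp only [mem_Ioo] at ha
        rw [if_neg (by omega)]
  rw [e1, e2, smul_add, smul_smul]
  norm_num
  have e3 : opJ ((k : ℤ) - j) P = ((j : ℤ) - k) • (tVar ((j : ℤ) - k) * P)
      + dDer ((k : ℤ) - j) P := by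
    rcases le_or_gt ((k : ℤ) - j) 0 with h | h
    · rw [opJ_of_nonpos h, dDer_of_nonpos h, Derivation.zero_apply, add_zero, neg_sub]
    · rw [opJ_of_pos h, tVar_of_nonpos (k := (j : ℤ) - k) (by omega), zero_mul, smul_zero, zero_add]
  rw [e3]
  simp only [mul_add, mul_smul_comm, zsmul_eq_mul]
  push_cast
  ring

lemma opL_dDer {k : ℕ} (r : ℕ+) (P : Funt) :
    opL k (dDer r P) = dDer r (opL k P) + (-(r : ℤ)) • dDer ((r : ℤ) + k) P := by
  have hr : (0 : ℤ) < r := by exact_mod_cast r.pos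
  have hb : ⁅derL k, dDer r⁆ = (-(r : ℤ)) • dDer ((r : ℤ) + k) := by
    apply MvPolynomial.derivation_ext
    intro j
    have hj : (0 : ℤ) < j := by exact_mod_cast j.pos
    rw [Derivation.commutator_apply, ← tVar_coe, dDer_tVar]
    have e0 : derL k (if 0 < (j : ℤ) ∧ (r : ℤ) = j then 1 else 0) = 0 := by
      split_ifs <;> simp
    rw [e0, tVar_coe, derL, MvPolynomial.mkDerivation_X, map_zsmul, dDer_tVar,
      Derivation.smul_apply, ← tVar_coe, dDer_tVar]
    by_cases h : (r : ℤ) = j - k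
    · rw [if_pos (by omega), if_pos (by omega), h]
      simp
    · rw [if_neg (by omega), if_neg (by omega)]
      simp
  have hb' : derL k (dDer r P) = dDer r (derL k P) + (-(r : ℤ)) • dDer ((r : ℤ) + k) P := by
    rw [← Derivation.smul_apply, ← hb, Derivation.commutator_apply]
    abel
  rw [opL_of_nonneg (by omega), opL_of_nonneg (by omega), hb', map_add]
  have : ∀ (c : ℂ) (Q : Funt), dDer r (c • Q) = c • dDer r Q := fun c Q => by
    rw [← algebraMap_smul Coef c Q, Derivation.map_smul, algebraMap_smul]
  rw [this, map_sum]
  simp only [dDer_comm _ (r : ℤ)]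
  abel

lemma opL_opJ {k : ℕ} (hk : 0 < k) (r : ℤ) (P : Funt) :
    opL k (opJ r P) = opJ r (opL k P) + (-r) • opJ (r + k) P := by
  rcases lt_trichotomy r 0 with hr | rfl | hr
  · obtain ⟨j, hj⟩ := exists_pnat (k := -r) (by omega)
    obtain rfl : r = -(j : ℤ) := by omega
    rw [opJ_of_nonpos (r := -(j : ℤ)) (by omega), opJ_of_nonpos (r := -(j : ℤ)) (by omega), neg_neg]
    have := map_zsmul (linL k) (j : ℤ) (tVar j * P)
    change opL k _ = _ • opL k _ at this
    rw [this, opL_tVar_mul hk, smul_add, neg_add_eq_sub]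
  · have h0 : ∀ Q, opJ 0 Q = 0 := fun Q => by simp [opJ_of_nonpos le_rfl]
    rw [h0, h0]
    rw [neg_zero, zero_smul, add_zero]
    exact map_zero (linL k)
  · obtain ⟨j, rfl⟩ := exists_pnat hr
    rw [opJ_of_pos hr, opJ_of_pos hr, opJ_of_pos (by omega), opL_dDer]

/-- The variables of `P` are bounded. -/
lemma exists_dDer_bound (P : Funt) : ∃ N : ℕ, ∀ j ∈ P.vars, (j : ℕ) < N :=
  ⟨(P.vars.sup fun j => (j : ℕ)) + 1,
    fun _ hj => Nat.lt_succ_of_le (Finset.le_sup (f := fun j : ℕ+ => (j : ℕ)) hj)⟩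

lemma dDer_eq_zero {P : Funt} {N : ℕ} (hN : ∀ j ∈ P.vars, (j : ℕ) < N) {r : ℤ} (hr : N ≤ r) :
    dDer r P = 0 := by
  rcases le_or_gt r 0 with h | h
  · rw [dDer_of_nonpos h, Derivation.zero_apply]
  · obtain ⟨j, rfl⟩ := exists_pnat h
    rw [dDer_coe]
    apply MvPolynomial.pderiv_eq_zero_of_notMem_vars
    intro hj
    have := hN j hj
    omega

/-- Polynomials in the `t_k` as a Heisenberg module. -/
def fockt : Fock Coef Funt where
  b := linJ
  vac := 1
  tame P := by
    obtain ⟨N, hN⟩ := exists_dDer_bound P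
    refine ⟨N + 1, fun r hr => ?_⟩
    rw [linJ_apply, opJ_of_pos (by omega), dDer_eq_zero hN (by omega)]
  gen p h1 hp P := by
    induction P using MvPolynomial.induction_on with
    | C a =>
      rw [← mul_one (MvPolynomial.C a), ← MvPolynomial.smul_eq_C_mul]
      exact p.smul_mem a h1
    | add P Q hP hQ => exact p.add_mem hP hQ
    | mul_X P j hP =>
      have hj : (0 : ℤ) < j := by exact_mod_cast j.pos
      have := hp P hP (-(j : ℤ)) (by omega)
      rw [linJ_apply, opJ_of_nonpos (by omega), neg_neg, tVar_coe] at this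
      -- `J_{-j}` multiplies by j t_j, so the factor j is divided out.
      have h2 := p.smul_mem (algebraMap ℂ Coef ((j : ℕ) : ℂ)⁻¹) this
      have h0 : (((j : ℕ) : ℂ)) ≠ 0 := by exact_mod_cast j.ne_zero
      rw [algebraMap_smul, ← Int.cast_smul_eq_zsmul ℂ, smul_smul, Int.cast_natCast,
        inv_mul_cancel₀ h0, one_smul, mul_comm] at h2
      exact h2

/-- The operators `a_k L_k` on the Heisenberg module. -/
def shiftL (a : ℕ+ → Coef) : fockt.Shift where
  op k := if h : 0 < k then a ⟨k, h⟩ • linL k else 0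
  y k r := if h : 0 < k then a ⟨k, h⟩ * (-r : ℤ) else 0
  y_zero r := by simp
  op_vac k := by
    split_ifs with h
    · have : opL k 1 = 0 := by
        rw [opL_of_nonneg (by omega)]
        simp
      change a ⟨k, h⟩ • opL k 1 = 0
      rw [this, smul_zero]
    · rfl
  comm k r P := by
    split_ifs with h
    · change a ⟨k, h⟩ • opL k (opJ r P) =
        linJ r (a ⟨k, h⟩ • opL k P) + _ • opJ (r + k) P
      rw [map_smul, opL_opJ h, smul_add, ← smul_smul]
      congr 2
      rw [Int.cast_smul_eq_zsmul]
    · simp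

lemma finsum_pnat_eq {M : Type*} [AddCommMonoid M] (u : ℕ → M) (h0 : u 0 = 0) :
    ∑ᶠ k : ℕ+, u k = ∑ᶠ k, u k := by
  rw [← finsum_mem_range PNat.coe_injective, ← finsum_mem_univ (f := u)]
  refine finsum_mem_inter_support_eq' _ _ _ fun k hk => ?_
  simp only [Set.mem_range, Set.mem_univ, iff_true]
  have : k ≠ 0 := fun h => hk (by rw [h, h0])
  exact ⟨⟨k, Nat.pos_of_ne_zero this⟩, rfl⟩

lemma expL_eq (a : ℕ+ → Coef) (P : Funt) : expL a P = (shiftL a).expA P := by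
  have : (fun P => ∑ᶠ k : ℕ+, a k • opL k P) = (shiftL a).A := by
    funext Q
    change _ = ∑ᶠ k, (shiftL a).op k Q
    rw [← finsum_pnat_eq]
    · refine finsum_congr fun k => ?_
      simp only [shiftL, k.pos, dif_pos]
      rfl
    · simp [shiftL]
  rw [expL, this]
  rfl


/-! ### The Heisenberg module of the Givental operators -/

lemma pderiv_dilT (i j : ℕ) : MvPolynomial.pderiv i (dilT j) = if i = j then 1 else 0 := by
  unfold dilT
  rw [map_sub, MvPolynomial.pderiv_X]
  have : MvPolynomial.pderiv i (if j = 1 then MvPolynomial.C hbarInv else 0 : FunT) = 0 := by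
    split_ifs <;> simp
  rw [this, sub_zero]
  by_cases h : i = j
  · subst h; simp
  · rw [if_neg h, Pi.single_eq_of_ne (by tauto)]

/-- The first order part of the quantization of `z ^ n`. -/
def derZ (n : ℕ) : Derivation Coef FunT FunT :=
  MvPolynomial.mkDerivation Coef (fun j : ℕ => if n ≤ j then -dilT (j - n) else 0)

lemma derZ_dilT (n j : ℕ) : derZ n (dilT j) = if n ≤ j then -dilT (j - n) else 0 := by
  conv_lhs => rw [dilT]
  rw [map_sub, derZ, MvPolynomial.mkDerivation_X]
  have : MvPolynomial.mkDerivation Coef (fun j : ℕ => if n ≤ j then -dilT (j - n) else 0)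
      (if j = 1 then MvPolynomial.C hbarInv else 0 : FunT) = 0 := by
    split_ifs <;> simp
  rw [this, sub_zero]

lemma quantZ_eq (n : ℕ) (P : FunT) : quantZ n P = derZ n P + (1 / 2 : ℂ) •
    ∑ m ∈ range n, ((-1 : ℂ) ^ m) • MvPolynomial.pderiv m (MvPolynomial.pderiv (n - 1 - m) P) :=
  rfl

lemma derivation_smul_complex {σ : Type*} (D : Derivation Coef (MvPolynomial σ Coef)
    (MvPolynomial σ Coef)) (c : ℂ) (P : MvPolynomial σ Coef) : D (c • P) = c • D P := by
  rw [← algebraMap_smul Coef c P, Derivation.map_smul, algebraMap_smul]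

/-- The quantization of `z ^ n` as a linear map. -/
def linZ (n : ℕ) : FunT →ₗ[Coef] FunT where
  toFun := quantZ n
  map_add' P Q := by
    simp only [quantZ_eq, map_add, sum_add_distrib, smul_add]
    abel
  map_smul' c P := by
    simp only [quantZ_eq, Derivation.map_smul, RingHom.id_apply, smul_add]
    simp only [smul_comm _ c, ← smul_sum]

/-- The Heisenberg operators on functions of the `T_k`: the dilaton shifted variable `T_j` has
index `-j-1` and `(-1)^(i+1) ∂/∂T_i` has index `i`. -/
def linT (r : ℤ) : FunT →ₗ[Coef] FunT :=
  if r < 0 then LinearMap.mulLeft Coef (dilT (-r - 1).toNat)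
  else ((-1 : Coef) ^ (r.toNat + 1)) • (MvPolynomial.pderiv r.toNat).toLinearMap

lemma linT_neg (j : ℕ) (P : FunT) : linT (-(j : ℤ) - 1) P = dilT j * P := by
  rw [linT, if_pos (by omega)]
  have : (-(-(j : ℤ) - 1) - 1).toNat = j := by omega
  rw [this, LinearMap.mulLeft_apply]

lemma linT_nonneg (i : ℕ) (P : FunT) :
    linT i P = ((-1 : Coef) ^ (i + 1)) • MvPolynomial.pderiv i P := by
  rw [linT, if_neg (by omega)]
  rfl

lemma derivation_sum_apply {σ ι : Type*} (s : Finset ι) (D : ι → Derivation Coef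
    (MvPolynomial σ Coef) (MvPolynomial σ Coef)) (P : MvPolynomial σ Coef) :
    (∑ n ∈ s, D n) P = ∑ n ∈ s, D n P := by
  induction s using Finset.cons_induction with
  | empty => rfl
  | cons n s hn ih => rw [sum_cons, sum_cons, Derivation.add_apply, ih]

lemma pderiv_comm {σ : Type*} (i j : σ) (P : MvPolynomial σ Coef) :
    MvPolynomial.pderiv i (MvPolynomial.pderiv j P) =
      MvPolynomial.pderiv j (MvPolynomial.pderiv i P) := by
  classical
  have : ⁅(MvPolynomial.pderiv i : Derivation Coef (MvPolynomial σ Coef) _),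
      (MvPolynomial.pderiv j : Derivation Coef (MvPolynomial σ Coef) _)⁆ = 0 := by
    apply MvPolynomial.derivation_ext
    intro k
    rw [Derivation.commutator_apply, MvPolynomial.pderiv_X, MvPolynomial.pderiv_X,
      Pi.single_apply, Pi.single_apply]
    split_ifs <;> simp
  rw [← sub_eq_zero, ← Derivation.commutator_apply, this, Derivation.zero_apply]

/-- For odd n the signs at m = j and m = n - 1 - j agree, so the two second order contributions add
instead of cancelling and the factor 1/2 disappears. -/
lemma quantZ_dilT_mul {n : ℕ} (hn : Odd n) (j : ℕ) (P : FunT) :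
    quantZ n (dilT j * P) = dilT j * quantZ n P - linT (-(j : ℤ) - 1 + n) P := by
  have h2 : ∀ m l, MvPolynomial.pderiv m (MvPolynomial.pderiv l (dilT j * P)) =
      dilT j * MvPolynomial.pderiv m (MvPolynomial.pderiv l P)
      + ((if l = j then MvPolynomial.pderiv m P else 0)
      + (if m = j then MvPolynomial.pderiv l P else 0)) := by
    intro m l
    rw [Derivation.leibniz, pderiv_dilT]
    simp only [smul_eq_mul, map_add, Derivation.leibniz, pderiv_dilT]
    split_ifs <;> (simp; try ring)
  have e : ∑ m ∈ range n, ((-1 : ℂ) ^ m) •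
      MvPolynomial.pderiv m (MvPolynomial.pderiv (n - 1 - m) (dilT j * P)) =
      dilT j * ∑ m ∈ range n, ((-1 : ℂ) ^ m) •
        MvPolynomial.pderiv m (MvPolynomial.pderiv (n - 1 - m) P)
      + if j < n then (2 * (-1 : ℂ) ^ j) • MvPolynomial.pderiv (n - 1 - j) P else 0 := by
    simp only [h2, smul_add, sum_add_distrib, mul_sum, mul_smul_comm]
    congr 1
    split_ifs with hj
    · rw [two_mul, add_smul]
      congr 1
      · rw [sum_eq_single (n - 1 - j)]
        · rw [if_pos (by omega)]
          congr 1
          obtain ⟨k, rfl⟩ := hn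
          rcases Nat.even_or_odd j with h | h
          · rw [h.neg_one_pow, Even.neg_one_pow]
            obtain ⟨l, rfl⟩ := h
            exact ⟨k - l, by omega⟩
          · rw [h.neg_one_pow, Odd.neg_one_pow]
            obtain ⟨l, rfl⟩ := h
            exact ⟨k - l - 1, by omega⟩
        · intro m hm hmj
          rw [mem_range] at hm
          rw [if_neg (by omega), smul_zero]
        · intro h
          rw [mem_range] at h
          omega
      · rw [sum_eq_single j]
        · rw [if_pos rfl]
        · intro m _ hmj
          rw [if_neg hmj, smul_zero]
        · intro h
          rw [mem_range] at h
          omega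
    · rw [sum_eq_zero, sum_eq_zero, add_zero]
      · intro m hm
        rw [mem_range] at hm
        rw [if_neg (by omega), smul_zero]
      · intro m hm
        rw [mem_range] at hm
        rw [if_neg (by omega), smul_zero]
  rw [quantZ_eq, quantZ_eq, e, Derivation.leibniz, derZ_dilT]
  split_ifs with h1 h3 h3
  · omega
  · have : -(j : ℤ) - 1 + n = -((j - n : ℕ) : ℤ) - 1 := by omega
    rw [this, linT_neg]
    simp only [smul_eq_mul, add_zero, mul_add, mul_smul_comm]
    ring
  · have : -(j : ℤ) - 1 + n = ((n - 1 - j : ℕ) : ℤ) := by omega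
    have hs : ((-1 : Coef) ^ (n - 1 - j + 1)) = algebraMap ℂ Coef (-(-1) ^ j) := by
      rw [map_neg, map_pow, map_neg, map_one]
      obtain ⟨k, rfl⟩ := hn
      rcases Nat.even_or_odd j with h | h
      · rw [h.neg_one_pow, Odd.neg_one_pow]
        obtain ⟨l, rfl⟩ := h
        exact ⟨k - l, by omega⟩
      · rw [h.neg_one_pow, Even.neg_one_pow, neg_neg]
        obtain ⟨l, rfl⟩ := h
        exact ⟨k - l, by omega⟩
    rw [this, linT_nonneg, hs, algebraMap_smul]
    simp only [smul_eq_mul, mul_zero, add_zero, mul_add, smul_add, mul_smul_comm, smul_smul,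
      neg_smul]
    norm_num
    ring_nf
  · omega

lemma quantZ_pderiv (n i : ℕ) (P : FunT) : quantZ n (MvPolynomial.pderiv i P) =
    MvPolynomial.pderiv i (quantZ n P) + MvPolynomial.pderiv (i + n) P := by
  have hb : ⁅derZ n, (MvPolynomial.pderiv i : Derivation Coef FunT FunT)⁆ =
      MvPolynomial.pderiv (i + n) := by
    apply MvPolynomial.derivation_ext
    intro j
    rw [Derivation.commutator_apply, MvPolynomial.pderiv_X, MvPolynomial.pderiv_X, derZ,
      MvPolynomial.mkDerivation_X, Pi.single_apply, Pi.single_apply]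
    have e0 : ∀ D : Derivation Coef FunT FunT, D (if j = i then 1 else 0) = 0 := by
      intro D
      split_ifs <;> simp
    rw [e0]
    split_ifs with h1 h2 h2
    · rw [map_neg, pderiv_dilT, if_pos (by omega)]
      simp
    · rw [map_neg, pderiv_dilT, if_neg (by omega)]
      simp
    · omega
    · simp
  have hb' : derZ n (MvPolynomial.pderiv i P) =
      MvPolynomial.pderiv i (derZ n P) + MvPolynomial.pderiv (i + n) P := by
    rw [← hb, Derivation.commutator_apply]
    abel
  rw [quantZ_eq, quantZ_eq, hb', map_add, derivation_smul_complex, map_sum]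
  simp only [derivation_smul_complex, pderiv_comm _ i]
  abel

/-- The sign (-1)^(i+1) built into `linT` makes the relation uniform: for odd n, the quantization of
z^n shifts every index by n with coefficient -1, also when a creation operator becomes an
annihilation operator. -/
lemma quantZ_linT {n : ℕ} (hn : Odd n) (r : ℤ) (P : FunT) :
    quantZ n (linT r P) = linT r (quantZ n P) - linT (r + n) P := by
  rcases lt_or_ge r 0 with hr | hr
  · obtain ⟨j, rfl⟩ : ∃ j : ℕ, r = -(j : ℤ) - 1 := ⟨(-r - 1).toNat, by omega⟩
    rw [linT_neg, linT_neg, quantZ_dilT_mul hn]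
  · obtain ⟨i, rfl⟩ : ∃ i : ℕ, r = i := ⟨r.toNat, by omega⟩
    rw [← Nat.cast_add, linT_nonneg, linT_nonneg, linT_nonneg]
    have := map_smul (linZ n) ((-1 : Coef) ^ (i + 1)) (MvPolynomial.pderiv i P)
    change quantZ n _ = _ • quantZ n _ at this
    rw [this, quantZ_pderiv, smul_add, show i + n + 1 = i + 1 + n by ring, pow_add _ (i + 1),
      hn.neg_one_pow]
    simp

lemma exists_vars_bound (P : FunT) : ∃ N : ℕ, ∀ j ∈ P.vars, j < N :=
  ⟨(P.vars.sup id) + 1, fun _ hj => Nat.lt_succ_of_le (Finset.le_sup (f := id) hj)⟩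

/-- Polynomials in the `T_k` as a Heisenberg module. -/
def fockT : Fock Coef FunT where
  b := linT
  vac := 1
  tame P := by
    obtain ⟨N, hN⟩ := exists_vars_bound P
    refine ⟨N, fun r hr => ?_⟩
    obtain ⟨i, rfl⟩ : ∃ i : ℕ, r = i := ⟨r.toNat, by omega⟩
    rw [linT_nonneg, MvPolynomial.pderiv_eq_zero_of_notMem_vars, smul_zero]
    intro hi
    have := hN i hi
    omega
  gen p h1 hp P := by
    induction P using MvPolynomial.induction_on with
    | C a =>
      rw [← mul_one (MvPolynomial.C a), ← MvPolynomial.smul_eq_C_mul]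
      exact p.smul_mem a h1
    | add P Q hP hQ => exact p.add_mem hP hQ
    | mul_X P j hP =>
      have h2 := hp P hP (-(j : ℤ) - 1) (by omega)
      rw [linT_neg, dilT, sub_mul] at h2
      have h3 : (if j = 1 then MvPolynomial.C hbarInv else 0 : FunT) * P ∈ p := by
        split_ifs
        · rw [← MvPolynomial.smul_eq_C_mul]
          exact p.smul_mem _ hP
        · rw [zero_mul]
          exact p.zero_mem
      have := p.add_mem h2 h3
      rwa [sub_add_cancel, mul_comm] at this

/-- The operators of the quantization of an odd series. -/
def shiftZ (l : ℂ⟦X⟧) : fockT.Shift where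
  op k := if Odd k then algebraMap ℂ Coef (coeff k l) • linZ k else 0
  y k _ := if Odd k then -algebraMap ℂ Coef (coeff k l) else 0
  y_zero r := by simp
  op_vac k := by
    split_ifs with h
    · have : quantZ k 1 = 0 := by
        rw [quantZ_eq]
        simp
      change algebraMap ℂ Coef (coeff k l) • quantZ k 1 = 0
      rw [this, smul_zero]
    · rfl
  comm k r P := by
    split_ifs with h
    · change algebraMap ℂ Coef (coeff k l) • quantZ k (linT r P) =
        linT r (algebraMap ℂ Coef (coeff k l) • quantZ k P) + _ • linT (r + k) P
      rw [map_smul, quantZ_linT h, smul_sub, neg_smul, sub_eq_add_neg]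
    · simp

lemma finsum_odd_eq {M : Type*} [AddCommMonoid M] (u : ℕ → M) (h0 : ∀ k, ¬ Odd k → u k = 0) :
    ∑ᶠ k : ℕ, u (2 * k + 1) = ∑ᶠ k, u k := by
  rw [← finsum_mem_range (g := fun k : ℕ => 2 * k + 1) (fun a b h => by simpa using h),
    ← finsum_mem_univ (f := u)]
  refine finsum_mem_inter_support_eq' _ _ _ fun k hk => ?_
  simp only [Set.mem_range, Set.mem_univ, iff_true]
  by_contra hcon
  refine hk (h0 k ?_)
  rintro ⟨m, rfl⟩
  exact hcon ⟨m, rfl⟩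

lemma givental_eq (R : ℂ⟦X⟧) (P : FunT) : givental R P = (shiftZ (logOf R)).expA P := by
  have : quantOdd (logOf R) = (shiftZ (logOf R)).A := by
    funext Q
    change _ = ∑ᶠ k, (shiftZ (logOf R)).op k Q
    rw [← finsum_odd_eq, quantOdd]
    · refine finsum_congr fun k => ?_
      have : Odd (2 * k + 1) := ⟨k, rfl⟩
      simp only [shiftZ, this, if_true]
      rw [← algebraMap_smul Coef (coeff (2 * k + 1) (logOf R))]
      rfl
    · intro k hk
      simp [shiftZ, hk]
  rw [givental, this]
  rfl

/-! ### Splitting Heisenberg operators into multiplication and derivation -/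

/-- The multiplication part of the Heisenberg operator with symbol `z⁻ⁱ g(z)` on `Funt`. -/
def mulJ (i : ℕ) (g : Coef⟦X⟧) : Funt :=
  ∑ n ∈ range i, coeff n g • (((i - n : ℕ) : ℂ) • tVar ((i : ℤ) - n))

/-- The derivation part of the Heisenberg operator with symbol `z⁻ⁱ g(z)` on `Funt`. -/
def derJ (i : ℕ) (g : Coef⟦X⟧) : Derivation Coef Funt Funt :=
  MvPolynomial.mkDerivation Coef (fun k : ℕ+ => MvPolynomial.C (coeff (i + k) g))

lemma fockt_B (i : ℕ) (g : Coef⟦X⟧) (P : Funt) :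
    fockt.B i g P = mulJ i g * P + derJ i g P := by
  obtain ⟨N, hN⟩ := exists_dDer_bound P
  rw [fockt.B_eq_sum i g P (N := i + (N + 1)), sum_range_add, mulJ, sum_mul]
  · congr 1
    · refine sum_congr rfl fun n hn => ?_
      rw [mem_range] at hn
      change coeff n g • opJ _ P = _
      rw [opJ_of_nonpos (by omega), neg_sub, smul_mul_assoc, smul_mul_assoc,
        ← Int.cast_smul_eq_zsmul ℂ]
      congr 2
      rw [Nat.cast_sub hn.le]
      push_cast
      ring
    · rw [sum_range_succ']
      -- The index n = i corresponds to `J_0`, which is zero and separates multiplications from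
      -- derivations.
      have h0 : coeff (i + 0) g • fockt.b (((i + 0 : ℕ) : ℤ) - i) P = 0 := by
        change _ • opJ _ P = 0
        rw [opJ_of_nonpos (by simp), tVar_of_nonpos (by simp)]
        simp
      rw [h0, add_zero]
      have h1 : ∀ n, coeff (i + (n + 1)) g • fockt.b (((i + (n + 1) : ℕ) : ℤ) - i) P =
          (coeff (i + (n + 1)) g • dDer ((n : ℤ) + 1)) P := by
        intro n
        change _ • opJ _ P = _
        rw [opJ_of_pos (by push_cast; omega), Derivation.smul_apply]
        congr 3
        push_cast
        ring
      have h2 : ∑ n ∈ range N, (coeff (i + (n + 1)) g • dDer ((n : ℤ) + 1)) P =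
          (∑ n ∈ range N, coeff (i + (n + 1)) g • dDer ((n : ℤ) + 1)) P := by
        rw [derivation_sum_apply]
      simp only [h1]
      rw [h2]
      apply MvPolynomial.derivation_eq_of_forall_mem_vars
      intro j hj
      have hjN := hN j hj
      have hj0 := j.pos
      rw [derJ, MvPolynomial.mkDerivation_X, derivation_sum_apply,
        sum_eq_single ((j : ℕ) - 1)]
      · rw [Derivation.smul_apply, ← tVar_coe, dDer_tVar, if_pos (by omega),
          show (j : ℕ) - 1 + 1 = j by omega, MvPolynomial.smul_eq_C_mul, mul_one]
      · intro n _ hn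
        rw [Derivation.smul_apply, ← tVar_coe, dDer_tVar, if_neg (by omega), smul_zero]
      · intro h
        rw [mem_range] at h
        omega
  · intro r hr
    change opJ r P = 0
    rw [opJ_of_pos (by push_cast at hr; omega), dDer_eq_zero hN (by push_cast at hr; omega)]

/-- The multiplication part of the Heisenberg operator with symbol `z⁻ⁱ g(z)` on `FunT`. -/
def mulT (i : ℕ) (g : Coef⟦X⟧) : FunT :=
  ∑ n ∈ range i, coeff n g • dilT (i - 1 - n)

/-- The derivation part of the Heisenberg operator with symbol `z⁻ⁱ g(z)` on `FunT`. -/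
def derT (i : ℕ) (g : Coef⟦X⟧) : Derivation Coef FunT FunT :=
  MvPolynomial.mkDerivation Coef
    (fun k : ℕ => MvPolynomial.C ((-1) ^ (k + 1) * coeff (i + k) g))

lemma fockT_B (i : ℕ) (g : Coef⟦X⟧) (P : FunT) :
    fockT.B i g P = mulT i g * P + derT i g P := by
  obtain ⟨N, hN⟩ := exists_vars_bound P
  rw [fockT.B_eq_sum i g P (N := i + N), sum_range_add, mulT, sum_mul]
  · congr 1
    · refine sum_congr rfl fun n hn => ?_
      rw [mem_range] at hn
      change coeff n g • linT _ P = _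
      rw [show (n : ℤ) - i = -((i - 1 - n : ℕ) : ℤ) - 1 by omega, linT_neg, smul_mul_assoc]
    · have h1 : ∀ n, coeff (i + n) g • fockT.b (((i + n : ℕ) : ℤ) - i) P =
          ((coeff (i + n) g * (-1) ^ (n + 1)) • MvPolynomial.pderiv n :
            Derivation Coef FunT FunT) P := by
        intro n
        change _ • linT _ P = _
        rw [show ((i + n : ℕ) : ℤ) - i = n by push_cast; ring, linT_nonneg, Derivation.smul_apply,
          smul_smul]
      have h2 : ∑ n ∈ range N, ((coeff (i + n) g * (-1) ^ (n + 1)) • MvPolynomial.pderiv n :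
            Derivation Coef FunT FunT) P =
          (∑ n ∈ range N, ((coeff (i + n) g * (-1) ^ (n + 1)) • MvPolynomial.pderiv n :
            Derivation Coef FunT FunT)) P := by
        rw [derivation_sum_apply]
      simp only [h1]
      rw [h2]
      apply MvPolynomial.derivation_eq_of_forall_mem_vars
      intro j hj
      have hjN := hN j hj
      rw [derT, MvPolynomial.mkDerivation_X, derivation_sum_apply,
        sum_eq_single j]
      · rw [Derivation.smul_apply, MvPolynomial.pderiv_X_self, MvPolynomial.smul_eq_C_mul, mul_one,
          mul_comm]
      · intro n _ hn
        rw [Derivation.smul_apply, MvPolynomial.pderiv_X_of_ne (by tauto), smul_zero]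
      · intro h
        rw [mem_range] at h
        omega
  · intro r hr
    obtain ⟨n, rfl⟩ : ∃ n : ℕ, r = n := ⟨r.toNat, by push_cast at hr; omega⟩
    change linT n P = 0
    rw [linT_nonneg, MvPolynomial.pderiv_eq_zero_of_notMem_vars, smul_zero]
    intro hi
    have := hN n hi
    push_cast at hr
    omega


/-! ### Gaussian operators -/

/-- An operator that satisfies a first order recursion by affine functions and constant vector
fields commutes with constant vector fields up to a linear transformation. -/
theorem gauss_derivation {σ 𝕜 : Type*} [CommRing 𝕜] {D : MvPolynomial σ 𝕜 →ₗ[𝕜] MvPolynomial σ 𝕜}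
    (h1 : D 1 = 1) (ℓ : σ → MvPolynomial σ 𝕜) (γ : σ → σ → 𝕜)
    (hD : ∀ i P, D (MvPolynomial.X i * P) = ℓ i * D P +
      MvPolynomial.mkDerivation 𝕜 (fun k => MvPolynomial.C (γ i k) : σ → MvPolynomial σ 𝕜) (D P))
    (c q : σ → 𝕜)
    (hq : ∀ i, MvPolynomial.mkDerivation 𝕜 (fun k => MvPolynomial.C (c k) : σ → MvPolynomial σ 𝕜)
      (ℓ i) = MvPolynomial.C (q i)) (P : MvPolynomial σ 𝕜) :
    MvPolynomial.mkDerivation 𝕜 (fun k => MvPolynomial.C (c k) : σ → MvPolynomial σ 𝕜) (D P) =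
      D (MvPolynomial.mkDerivation 𝕜 (fun k => MvPolynomial.C (q k)) P) := by
  induction P using MvPolynomial.induction_on with
  | C a =>
    have : D (MvPolynomial.C a) = MvPolynomial.C a := by
      rw [← mul_one (MvPolynomial.C a), ← MvPolynomial.smul_eq_C_mul, map_smul, h1]
    rw [this, MvPolynomial.derivation_C, MvPolynomial.derivation_C, map_zero]
  | add P Q hP hQ => rw [map_add, map_add, map_add, map_add, hP, hQ]
  | mul_X P i hP =>
    rw [mul_comm, hD, map_add, Derivation.leibniz, Derivation.leibniz, hq,
      MvPolynomial.mkDerivation_X, mkDerivation_const_comm, hP, map_add, smul_eq_mul, smul_eq_mul,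
      smul_eq_mul, smul_eq_mul, hD, mul_comm P, ← MvPolynomial.smul_eq_C_mul, map_smul,
      MvPolynomial.smul_eq_C_mul]
    ring

/-- The recursion that characterizes a Gaussian operator with mean `m` and covariance `Q`. -/
structure IsGaussian {R : Type*} [CommRing R] [Algebra Coef R] (Φ : FunT →ₗ[Coef] R)
    (m : ℕ → R) (Q : ℕ → ℕ → Coef) : Prop where
  map_one : Φ 1 = 1
  map_X_mul : ∀ j Z, Φ (MvPolynomial.X j * Z) = m j * Φ Z +
    Φ (MvPolynomial.mkDerivation Coef (fun k => MvPolynomial.C (Q j k) : ℕ → FunT) Z)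

namespace IsGaussian

variable {R : Type*} [CommRing R] [Algebra Coef R] {Φ Ψ : FunT →ₗ[Coef] R} {m : ℕ → R}
  {Q : ℕ → ℕ → Coef}

lemma map_X (h : IsGaussian Φ m Q) (j : ℕ) : Φ (MvPolynomial.X j) = m j := by
  have := h.map_X_mul j 1
  rwa [mul_one, h.map_one, mul_one, ← MvPolynomial.C_1, MvPolynomial.derivation_C, map_zero,
    add_zero] at this

lemma map_X_mul_X (h : IsGaussian Φ m Q) (j k : ℕ) :
    Φ (MvPolynomial.X j * MvPolynomial.X k) = m j * m k + algebraMap Coef R (Q j k) := by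
  rw [h.map_X_mul, h.map_X, MvPolynomial.mkDerivation_X, ← mul_one (MvPolynomial.C _),
    ← MvPolynomial.smul_eq_C_mul, map_smul, h.map_one, Algebra.algebraMap_eq_smul_one]

/-- This drives the induction in `ext`. The vanishing case is listed apart because for d = 0 there
is no smaller degree. -/
lemma totalDegree_mkDerivation_lt (c : ℕ → Coef) {d : ℕ} (Z : FunT) (hZ : Z.totalDegree ≤ d) :
    MvPolynomial.mkDerivation Coef (fun k => MvPolynomial.C (c k) : ℕ → FunT) Z = 0 ∨
    (MvPolynomial.mkDerivation Coef (fun k => MvPolynomial.C (c k) : ℕ → FunT) Z).totalDegree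
      + 1 ≤ d := by
  rcases Nat.eq_zero_or_pos d with rfl | hd
  · left
    rw [MvPolynomial.totalDegree_eq_zero_iff_eq_C.mp (Nat.le_zero.mp hZ),
      MvPolynomial.derivation_C]
  right
  suffices h : (MvPolynomial.mkDerivation Coef (fun k => MvPolynomial.C (c k) : ℕ → FunT)
      Z).totalDegree ≤ d - 1 by omega
  rw [← MvPolynomial.support_sum_monomial_coeff Z, map_sum]
  refine MvPolynomial.totalDegree_finsetSum_le fun s hs => ?_
  rw [MvPolynomial.mkDerivation_monomial]
  refine (MvPolynomial.totalDegree_smul_le _ _).trans ?_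
  refine MvPolynomial.totalDegree_finsetSum_le fun i hi => ?_
  beta_reduce
  rw [smul_eq_mul, mul_comm, ← MvPolynomial.smul_eq_C_mul]
  refine (MvPolynomial.totalDegree_smul_le _ _).trans ?_
  refine (MvPolynomial.totalDegree_monomial_le _ _).trans ?_
  have h1 : s.degree ≤ d := (MvPolynomial.le_totalDegree hs).trans hZ
  have h2 : (s - Finsupp.single i 1).degree + 1 = s.degree := by
    have : s - Finsupp.single i 1 + Finsupp.single i 1 = s :=
      tsub_add_cancel_of_le (Finsupp.single_le_iff.mpr (Nat.one_le_iff_ne_zero.mpr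
        (Finsupp.mem_support_iff.mp hi)))
    conv_rhs => rw [← this, map_add, Finsupp.degree_single]
  change (s - Finsupp.single i 1).degree ≤ d - 1
  omega

/-- The recursion replaces a monomial by terms of strictly smaller degree, so mean and covariance
determine the operator by induction on the degree. -/
theorem ext (hΦ : IsGaussian Φ m Q) (hΨ : IsGaussian Ψ m Q) : Φ = Ψ := by
  have hC : ∀ a, Φ (MvPolynomial.C a) = Ψ (MvPolynomial.C a) := by
    intro a
    rw [← mul_one (MvPolynomial.C a), ← MvPolynomial.smul_eq_C_mul, map_smul, map_smul,
      hΦ.map_one, hΨ.map_one]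
  have key : ∀ d, ∀ Z : FunT, Z.totalDegree ≤ d → Φ Z = Ψ Z := by
    intro d
    induction d using Nat.strong_induction_on with
    | _ d ih =>
    intro Z hZ
    rw [← MvPolynomial.support_sum_monomial_coeff Z, map_sum, map_sum]
    refine sum_congr rfl fun s hs => ?_
    have hsd : s.degree ≤ d := (MvPolynomial.le_totalDegree hs).trans hZ
    by_cases hs0 : s = 0
    · subst hs0
      exact hC _
    obtain ⟨j, hj⟩ := Finsupp.ne_iff.mp hs0
    have hs' : Finsupp.single j 1 + (s - Finsupp.single j 1) = s :=
      add_tsub_cancel_of_le (Finsupp.single_le_iff.mpr (Nat.one_le_iff_ne_zero.mpr hj))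
    have hdeg : 1 + (s - Finsupp.single j 1).degree = s.degree := by
      conv_rhs => rw [← hs', map_add, Finsupp.degree_single]
    have hm : MvPolynomial.monomial s (MvPolynomial.coeff s Z) = MvPolynomial.X j *
        MvPolynomial.monomial (s - Finsupp.single j 1) (MvPolynomial.coeff s Z) := by
      rw [MvPolynomial.X, MvPolynomial.monomial_mul, hs', one_mul]
    have hlow : (MvPolynomial.monomial (s - Finsupp.single j 1)
        (MvPolynomial.coeff s Z)).totalDegree ≤ d - 1 := by
      refine (MvPolynomial.totalDegree_monomial_le _ _).trans ?_
      change (s - Finsupp.single j 1).degree ≤ d - 1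
      omega
    rw [hm, hΦ.map_X_mul, hΨ.map_X_mul, ih (d - 1) (by omega) _ hlow]
    congr 1
    rcases totalDegree_mkDerivation_lt (Q j) _ hlow with h | h
    · rw [h, map_zero, map_zero]
    · exact ih (d - 1) (by omega) _ (by omega)
  exact LinearMap.ext fun Z => key _ Z le_rfl

lemma comp_algHom {R' : Type*} [CommRing R'] [Algebra Coef R'] (h : IsGaussian Φ m Q)
    (ψ : R →ₐ[Coef] R') : IsGaussian (ψ.toLinearMap ∘ₗ Φ) (fun j => ψ (m j)) Q where
  map_one := by simp [h.map_one]
  map_X_mul j Z := by simp [h.map_X_mul]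

end IsGaussian

/-! ### First order operators on power series -/

section VectorField

variable {𝕜 : Type*} [CommRing 𝕜]

lemma coeff_X_mul_derivative (g : 𝕜⟦X⟧) (n : ℕ) :
    coeff n (X * derivative 𝕜 g) = n * coeff n g := by
  cases n with
  | zero => simp
  | succ n => rw [coeff_succ_X_mul, coeff_derivative, mul_comm]; push_cast; rfl

/-- The series `∑_{k>0} a_k z^k`. -/
def serA (a : ℕ+ → 𝕜) : 𝕜⟦X⟧ := PowerSeries.mk fun n => if h : 0 < n then a ⟨n, h⟩ else 0

lemma constantCoeff_serA (a : ℕ+ → 𝕜) : constantCoeff (serA a) = 0 := by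
  rw [← coeff_zero_eq_constantCoeff_apply, serA, coeff_mk]
  simp

lemma coeff_serA (a : ℕ+ → 𝕜) (k : ℕ+) : coeff k (serA a) = a k := by
  rw [serA, coeff_mk, dif_pos k.pos]
  rfl

variable [Algebra ℂ 𝕜]

/-- The operator `C - A z ∂/∂z`. -/
def vf (A C : 𝕜⟦X⟧) : Module.End ℂ 𝕜⟦X⟧ where
  toFun g := C * g - A * (X * derivative 𝕜 g)
  map_add' g h := by rw [map_add]; ring
  map_smul' c g := by
    rw [← algebraMap_smul 𝕜 c g, Derivation.map_smul]
    simp only [mul_smul_comm, RingHom.id_apply, smul_sub, algebraMap_smul]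

lemma vf_apply (A C g : 𝕜⟦X⟧) : vf A C g = C * g - A * (X * derivative 𝕜 g) := rfl

lemma raises_vf {A C : 𝕜⟦X⟧} (hA : constantCoeff A = 0) (hC : constantCoeff C = 0) :
    Raises (vf A C) := by
  intro n g hg m hm
  rw [vf_apply, map_sub, coeff_mul_eq_zero (a := 1) (b := n) (by omega) _ hg,
    coeff_mul_eq_zero (a := 1) (b := n) (by omega), sub_zero]
  · intro k hk
    obtain rfl : k = 0 := by omega
    simpa using hA
  · intro k hk
    rw [coeff_X_mul_derivative, hg k hk, mul_zero]
  · intro k hk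
    obtain rfl : k = 0 := by omega
    simpa using hC

lemma vf_mul (A C C' g h : 𝕜⟦X⟧) : vf A (C + C') (g * h) = vf A C g * h + g * vf A C' h := by
  simp only [vf_apply, Derivation.leibniz, smul_eq_mul]
  ring

lemma expo_vf_mul {A C C' : 𝕜⟦X⟧} (hA : constantCoeff A = 0) (hC : constantCoeff C = 0)
    (hC' : constantCoeff C' = 0) (g h : 𝕜⟦X⟧) :
    expo (vf A (C + C')) (g * h) = expo (vf A C) g * expo (vf A C') h :=
  expo_mul (raises_vf hA hC) (raises_vf hA hC') (raises_vf hA (by simp [hC, hC'])) (vf_mul A C C')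
    g h

/-- The series `z / f(z)`, where `f` is the image of `z` under the flow of `-A z ∂/∂z`. -/
def flowH (A : 𝕜⟦X⟧) : 𝕜⟦X⟧ := expo (vf A A) 1

lemma constantCoeff_expo (S : Module.End ℂ 𝕜⟦X⟧) (g : 𝕜⟦X⟧) :
    constantCoeff (expo S g) = constantCoeff g := by
  rw [← coeff_zero_eq_constantCoeff_apply, expo, coeff_mk]
  simp [divPow_zero]

lemma expo_vf_nsmul {A : 𝕜⟦X⟧} (hA : constantCoeff A = 0) (g : 𝕜⟦X⟧) (i : ℕ) :
    expo (vf A ((i : 𝕜⟦X⟧) * A)) (g ^ i) = expo (vf A A) g ^ i := by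
  induction i with
  | zero =>
    rw [pow_zero, pow_zero]
    apply expo_of_apply_eq_zero
    simp [vf_apply]
  | succ i ih =>
    rw [pow_succ, pow_succ, ← ih, ← expo_vf_mul hA (by simp [hA]) hA]
    congr 2
    push_cast
    ring

/-- With f the image of z under the flow, z⁻ⁱ is sent to f⁻ⁱ = z⁻ⁱ Hⁱ; the zeroth order term i A
accounts for the factor z⁻ⁱ split off from the symbol. -/
lemma flowH_pow {A : 𝕜⟦X⟧} (hA : constantCoeff A = 0) (i : ℕ) :
    expo (vf A ((i : 𝕜⟦X⟧) * A)) 1 = flowH A ^ i := by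
  have := expo_vf_nsmul hA 1 i
  rwa [one_pow] at this

/-- `X` is annihilated by `vf A A`, hence fixed by its exponential, which by multiplicativity is the
product of the flow of `X` and `flowH A`. -/
lemma flow_mul_flowH {A : 𝕜⟦X⟧} (hA : constantCoeff A = 0) :
    expo (vf A 0) X * flowH A = X := by
  rw [flowH, ← expo_vf_mul hA (by simp) hA, mul_one]
  apply expo_of_apply_eq_zero
  simp [vf_apply]

lemma constantCoeff_flowH (A : 𝕜⟦X⟧) : constantCoeff (flowH A) = 1 := by
  rw [flowH, constantCoeff_expo, map_one]

lemma expo_vf_map {𝕜' : Type*} [CommRing 𝕜'] [Algebra ℂ 𝕜'] (φ : 𝕜 →ₐ[ℂ] 𝕜') (A C g : 𝕜⟦X⟧) :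
    expo (vf (PowerSeries.map φ.toRingHom A) (PowerSeries.map φ.toRingHom C))
      (PowerSeries.map φ.toRingHom g) = PowerSeries.map φ.toRingHom (expo (vf A C) g) := by
  have hd : ∀ g : 𝕜⟦X⟧, derivative 𝕜' (PowerSeries.map φ.toRingHom g) =
      PowerSeries.map φ.toRingHom (derivative 𝕜 g) := by
    intro g
    ext n
    simp [coeff_derivative]
  have h : ∀ j, (vf (PowerSeries.map φ.toRingHom A) (PowerSeries.map φ.toRingHom C) ^ j)
      (PowerSeries.map φ.toRingHom g) = PowerSeries.map φ.toRingHom ((vf A C ^ j) g) := by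
    intro j
    induction j with
    | zero => simp
    | succ j ih =>
      rw [pow_succ', pow_succ', Module.End.mul_apply, Module.End.mul_apply, ih, vf_apply, vf_apply,
        hd, map_sub, map_mul, map_mul, map_mul, PowerSeries.map_X]
  ext n
  rw [expo, coeff_mk, PowerSeries.coeff_map, expo, coeff_mk, map_sum]
  refine sum_congr rfl fun j _ => ?_
  rw [divPow, divPow, LinearMap.smul_apply, LinearMap.smul_apply, h, PowerSeries.coeff_smul,
    PowerSeries.coeff_smul, PowerSeries.coeff_map]
  exact (map_smul φ _ _).symm

lemma flowH_map {𝕜' : Type*} [CommRing 𝕜'] [Algebra ℂ 𝕜'] (φ : 𝕜 →ₐ[ℂ] 𝕜') (A : 𝕜⟦X⟧) :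
    flowH (PowerSeries.map φ.toRingHom A) = PowerSeries.map φ.toRingHom (flowH A) := by
  rw [flowH, ← map_one (PowerSeries.map φ.toRingHom), expo_vf_map, flowH]

lemma serA_map {𝕜' : Type*} [CommRing 𝕜'] [Algebra ℂ 𝕜'] (φ : 𝕜 →ₐ[ℂ] 𝕜') (a : ℕ+ → 𝕜) :
    serA (fun k => φ (a k)) = PowerSeries.map φ.toRingHom (serA a) := by
  ext n
  rw [serA, coeff_mk, PowerSeries.coeff_map, serA, coeff_mk]
  split_ifs <;> simp

end VectorField


/-! ### The Virasoro exponential as a Gaussian operator on functions of the odd times -/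

/-- The double factorial `(2 k - 1)!!`. -/
def dfac (k : ℕ) : ℂ := ((2 * k - 1).doubleFactorial : ℕ)

/-- Truncated subtraction turns (-1)!! into 0!!, which is 1 as it should be. -/
lemma dfac_zero : dfac 0 = 1 := by simp [dfac]

lemma doubleFactorial_odd (k : ℕ) : (((2 * k + 1).doubleFactorial : ℕ) : ℂ) = (2 * k + 1) * dfac k := by
  cases k with
  | zero => simp [dfac]
  | succ k =>
    rw [show 2 * (k + 1) + 1 = (2 * k + 1) + 2 by ring, Nat.doubleFactorial_add_two, dfac,
      show 2 * (k + 1) - 1 = 2 * k + 1 by omega]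
    push_cast
    ring

lemma dfac_succ (k : ℕ) : dfac (k + 1) = (2 * k + 1) * dfac k := by
  rw [← doubleFactorial_odd, dfac, show 2 * (k + 1) - 1 = 2 * k + 1 by omega]

lemma dfac_ne_zero (k : ℕ) : dfac k ≠ 0 := by
  unfold dfac
  exact_mod_cast (Nat.doubleFactorial_pos _).ne'

/-- The covariance of the Gaussian operator `exp (∑ a_k L_k)`, where `z⁻ⁱ Hⁱ` is the image of
`z⁻ⁱ`. -/
def covH {𝕜 : Type*} [CommRing 𝕜] (H : 𝕜⟦X⟧) (i j : ℕ) : 𝕜 :=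
  ∑ n ∈ range j, ((j - n : ℕ) : 𝕜) * coeff n (H ^ j) * coeff (i + (j - n)) (H ^ i)

/-- The relation [L_k, J_r] = -r J_{r+k} says that ∑ a_k L_k acts on symbols as -A z ∂/∂z with A = ∑
a_k z^k. Splitting off z⁻ⁱ adds the zeroth order term i A. -/
lemma shiftL_S (a : ℕ+ → Coef) (i : ℕ) :
    (shiftL a).S i = vf (serA a) ((i : Coef⟦X⟧) * serA a) := by
  refine LinearMap.ext fun g => PowerSeries.ext fun m => ?_
  have h1 : (i : Coef⟦X⟧) * serA a * g - serA a * (X * derivative Coef g) =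
      ((i : Coef⟦X⟧) * g - X * derivative Coef g) * serA a := by ring
  rw [Fock.Shift.coeff_S, vf_apply, h1, coeff_mul,
    Finset.Nat.sum_antidiagonal_eq_sum_range_succ_mk, sum_range_succ]
  have h2 : coeff (m - m) (serA a) = 0 := by
    rw [Nat.sub_self, coeff_zero_eq_constantCoeff_apply, constantCoeff_serA]
  rw [h2, mul_zero, add_zero]
  apply Finset.sum_congr rfl
  intro n hn
  rw [mem_range] at hn
  have h3 : coeff (m - n) (serA a) = a ⟨m - n, by omega⟩ := by
    rw [serA, coeff_mk, dif_pos (by omega)]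
  have h4 : (shiftL a).y (m - n) (n - i) = a ⟨m - n, by omega⟩ * ((-((n : ℤ) - i) : ℤ) : Coef) := by
    change (if h : 0 < m - n then a ⟨m - n, h⟩ * ((-((n : ℤ) - i) : ℤ) : Coef) else 0) = _
    rw [dif_pos (by omega)]
  have h5 : coeff n ((i : Coef⟦X⟧) * g - X * derivative Coef g) = ((i : Coef) - n) * coeff n g := by
    rw [map_sub, coeff_X_mul_derivative, ← map_natCast (PowerSeries.C (R := Coef)), coeff_C_mul]
    ring
  rw [h3, h4, h5]
  push_cast
  ring

lemma expA_opJ (a : ℕ+ → Coef) (i : ℕ) (P : Funt) :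
    (shiftL a).expA (opJ (-i) P) = mulJ i (flowH (serA a) ^ i) * (shiftL a).expA P +
      derJ i (flowH (serA a) ^ i) ((shiftL a).expA P) := by
  have := (shiftL a).opExp_b i P
  rw [shiftL_S, flowH_pow (constantCoeff_serA a), fockt_B] at this
  exact this

lemma tVar_nat_coe (i : ℕ+) : tVar ((i : ℕ) : ℤ) = MvPolynomial.X i := tVar_coe i

lemma expA_X_mul (a : ℕ+ → Coef) (i : ℕ+) (P : Funt) :
    ((i : ℕ) : ℂ) • (shiftL a).expA (MvPolynomial.X i * P) =
      mulJ i (flowH (serA a) ^ (i : ℕ)) * (shiftL a).expA P +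
      derJ i (flowH (serA a) ^ (i : ℕ)) ((shiftL a).expA P) := by
  rw [← expA_opJ, opJ_of_nonpos (by omega), neg_neg, tVar_coe, map_zsmul,
    ← Int.cast_smul_eq_zsmul ℂ]
  simp

lemma derJ_mulJ (i j : ℕ) (g h : Coef⟦X⟧) : derJ i g (mulJ j h) = MvPolynomial.C
    (∑ n ∈ range j, ((j - n : ℕ) : Coef) * coeff n h * coeff (i + (j - n)) g) := by
  rw [mulJ, map_sum, map_sum]
  refine sum_congr rfl fun n hn => ?_
  rw [mem_range] at hn
  rw [Derivation.map_smul, derivation_smul_complex]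
  obtain ⟨r, hr⟩ : ∃ r : ℕ+, (r : ℕ) = j - n := ⟨⟨j - n, by omega⟩, rfl⟩
  rw [show (j : ℤ) - n = ((r : ℕ) : ℤ) by omega, ← hr, tVar_coe, derJ,
    MvPolynomial.mkDerivation_X, ← algebraMap_smul Coef ((r : ℕ) : ℂ), MvPolynomial.smul_eq_C_mul,
    MvPolynomial.smul_eq_C_mul, ← map_mul, ← map_mul, map_natCast]
  ring_nf

lemma expA_one (a : ℕ+ → Coef) : (shiftL a).expA 1 = 1 := (shiftL a).opExp_vac

/-- The derivation takes constant values on the means, so `gauss_derivation` moves it inside the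
exponential. These constants are the covariances, divided by k because J_{-k} is multiplication by k
t_k. -/
lemma derJ_expA (a : ℕ+ → Coef) (i : ℕ) (P : Funt) :
    derJ i (flowH (serA a) ^ i) ((shiftL a).expA P) = (shiftL a).expA
      (MvPolynomial.mkDerivation Coef (fun k : ℕ+ => MvPolynomial.C
        ((((k : ℕ) : ℂ)⁻¹) • covH (flowH (serA a)) i k)) P) := by
  set H := flowH (serA a) with hH
  have hX : ∀ (j : ℕ+) (P : Funt), (shiftL a).expA (MvPolynomial.X j * P) =
      ((((j : ℕ) : ℂ)⁻¹) • mulJ j (H ^ (j : ℕ))) * (shiftL a).expA P +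
      MvPolynomial.mkDerivation Coef (fun k : ℕ+ => MvPolynomial.C
        ((((j : ℕ) : ℂ)⁻¹) • coeff ((j : ℕ) + k) (H ^ (j : ℕ)))) ((shiftL a).expA P) := by
    intro j P
    have h0 : (((j : ℕ) : ℂ)) ≠ 0 := by exact_mod_cast j.ne_zero
    apply smul_right_injective _ h0
    simp only
    rw [expA_X_mul, smul_add, smul_mul_assoc, smul_smul, mul_inv_cancel₀ h0, one_smul]
    congr 1
    have : derJ j (H ^ (j : ℕ)) = algebraMap ℂ Coef ((j : ℕ) : ℂ) •
        MvPolynomial.mkDerivation Coef (fun k : ℕ+ => MvPolynomial.C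
        ((((j : ℕ) : ℂ)⁻¹) • coeff ((j : ℕ) + k) (H ^ (j : ℕ))) : ℕ+ → Funt) := by
      apply MvPolynomial.derivation_ext
      intro k
      rw [derJ, MvPolynomial.mkDerivation_X, Derivation.smul_apply, MvPolynomial.mkDerivation_X,
        MvPolynomial.smul_eq_C_mul, ← map_mul, ← Algebra.smul_def, smul_smul, mul_inv_cancel₀ h0,
        one_smul]
    rw [this, Derivation.smul_apply, algebraMap_smul]
  refine gauss_derivation (expA_one a) _ _ hX _ _ (fun j => ?_) P
  rw [derivation_smul_complex]
  have := derJ_mulJ i j (H ^ i) (H ^ (j : ℕ))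
  rw [derJ] at this
  rw [this, ← algebraMap_smul Coef, MvPolynomial.smul_eq_C_mul, ← map_mul, ← Algebra.smul_def]
  rfl

/-- The index `2 k + 1`. -/
def oddIdx (k : ℕ) : ℕ+ := ⟨2 * k + 1, by omega⟩

lemma tVar_odd (k : ℕ) : tVar (2 * (k : ℤ) + 1) = MvPolynomial.X (oddIdx k) := by
  rw [← tVar_coe]
  rfl

/-- The identification `T_k = (2 k + 1)!! t_{2 k + 1}` as an algebra homomorphism. -/
def oddHom : FunT →ₐ[Coef] Funt :=
  MvPolynomial.aeval (fun k : ℕ =>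
    (((2 * k + 1).doubleFactorial : ℕ) • tVar (2 * k + 1) : Funt))

lemma oddTimes_eq (Z : FunT) : oddTimes Z = oddHom Z := rfl

lemma oddHom_X (k : ℕ) : oddHom (MvPolynomial.X k) =
    ((2 * k + 1) * dfac k) • MvPolynomial.X (oddIdx k) := by
  rw [oddHom, MvPolynomial.aeval_X, tVar_odd, ← doubleFactorial_odd, Nat.cast_smul_eq_nsmul]

lemma oddHom_C (x : Coef) : oddHom (MvPolynomial.C x) = MvPolynomial.C x := oddHom.commutes x

lemma mkDerivation_oddHom (c : ℕ+ → Coef) (Z : FunT) :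
    MvPolynomial.mkDerivation Coef (fun k : ℕ+ => MvPolynomial.C (c k) : ℕ+ → Funt) (oddHom Z) =
      oddHom (MvPolynomial.mkDerivation Coef (fun k => MvPolynomial.C
        (((2 * k + 1) * dfac k) • c (oddIdx k)) : ℕ → FunT) Z) := by
  induction Z using MvPolynomial.induction_on with
  | C a => rw [MvPolynomial.derivation_C, map_zero, oddHom_C, MvPolynomial.derivation_C]
  | add P Q hP hQ => simp only [map_add, hP, hQ]
  | mul_X P k hP =>
    rw [map_mul, Derivation.leibniz, Derivation.leibniz, map_add, hP, oddHom_X,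
      derivation_smul_complex, MvPolynomial.mkDerivation_X, MvPolynomial.mkDerivation_X,
      smul_eq_mul, smul_eq_mul, smul_eq_mul, smul_eq_mul, map_mul, map_mul, oddHom_X, oddHom_C,
      ← algebraMap_smul Coef, MvPolynomial.smul_eq_C_mul, ← map_mul, ← Algebra.smul_def]

/-- The covariance of `exp (∑ a_k L_k)` on functions of the odd times. -/
def covOdd {𝕜 : Type*} [CommRing 𝕜] [Algebra ℂ 𝕜] (H : 𝕜⟦X⟧) (j k : ℕ) : 𝕜 :=
  (dfac j * dfac k) • covH H (2 * j + 1) (2 * k + 1)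

/-- The operator `exp (∑ a_k L_k)` on functions of the odd times. -/
def oddExpL (a : ℕ+ → Coef) : FunT →ₗ[Coef] Funt := (shiftL a).expA ∘ₗ oddHom.toLinearMap

lemma expA_oddHom_X_mul (a : ℕ+ → Coef) (j : ℕ) (Z : FunT) :
    (shiftL a).expA (oddHom (MvPolynomial.X j * Z)) = dfac j •
      (((oddIdx j : ℕ) : ℂ) • (shiftL a).expA (MvPolynomial.X (oddIdx j) * oddHom Z)) := by
  rw [map_mul, oddHom_X, smul_mul_assoc, ← algebraMap_smul Coef, map_smul, algebraMap_smul,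
    smul_smul, mul_comm (dfac j)]
  have : ((oddIdx j : ℕ) : ℂ) = 2 * j + 1 := by simp [oddIdx]
  rw [this]

lemma mkDerivation_covH_oddHom (H : Coef⟦X⟧) (j : ℕ) (Z : FunT) :
    MvPolynomial.mkDerivation Coef (fun k : ℕ+ => MvPolynomial.C
        ((((k : ℕ) : ℂ)⁻¹) • covH H (2 * j + 1) k) : ℕ+ → Funt) (oddHom Z) =
      oddHom (MvPolynomial.mkDerivation Coef (fun k => MvPolynomial.C
        (dfac k • covH H (2 * j + 1) (2 * k + 1)) : ℕ → FunT) Z) := by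
  rw [mkDerivation_oddHom]
  have : (fun k : ℕ => MvPolynomial.C (((2 * (k : ℂ) + 1) * dfac k) •
      ((((oddIdx k : ℕ) : ℂ)⁻¹) • covH H (2 * j + 1) (oddIdx k))) : ℕ → FunT) =
      fun k => MvPolynomial.C (dfac k • covH H (2 * j + 1) (2 * k + 1)) := by
    funext k
    have h0 : (2 * (k : ℂ) + 1) ≠ 0 := by exact_mod_cast (2 * k).succ_ne_zero
    have h1 : (oddIdx k : ℕ) = 2 * k + 1 := rfl
    have h2 : (2 * (k : ℂ) + 1) * dfac k * (((2 * k + 1 : ℕ) : ℂ))⁻¹ = dfac k := by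
      push_cast
      field_simp
    rw [h1, smul_smul, h2]
  rw [this]

lemma mkDerivation_covOdd (H : Coef⟦X⟧) (j : ℕ) :
    MvPolynomial.mkDerivation Coef (fun k => MvPolynomial.C (covOdd H j k) : ℕ → FunT) =
      algebraMap ℂ Coef (dfac j) • MvPolynomial.mkDerivation Coef (fun k => MvPolynomial.C
        (dfac k • covH H (2 * j + 1) (2 * k + 1)) : ℕ → FunT) := by
  apply MvPolynomial.derivation_ext
  intro k
  rw [MvPolynomial.mkDerivation_X, Derivation.smul_apply, MvPolynomial.mkDerivation_X,
    MvPolynomial.smul_eq_C_mul, ← map_mul, ← Algebra.smul_def, smul_smul, covOdd]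

lemma oddExpL_apply (a : ℕ+ → Coef) (Z : FunT) :
    oddExpL a Z = (shiftL a).expA (oddHom Z) := rfl

/-- The factor `dfac j` arises from T_j = (2j+1)!! t_{2j+1}, which as a multiplication operator is
(2j-1)!! J_{-(2j+1)}. -/
theorem isGaussian_oddExpL (a : ℕ+ → Coef) : IsGaussian (oddExpL a)
    (fun j => dfac j • mulJ (2 * j + 1) (flowH (serA a) ^ (2 * j + 1)))
    (covOdd (flowH (serA a))) where
  map_one := by rw [oddExpL_apply, map_one, expA_one]
  map_X_mul j Z := by
    have h1 : (oddIdx j : ℕ) = 2 * j + 1 := rfl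
    rw [oddExpL_apply, oddExpL_apply, oddExpL_apply, expA_oddHom_X_mul, expA_X_mul, smul_add,
      smul_mul_assoc, mkDerivation_covOdd, Derivation.smul_apply, map_smul, map_smul,
      algebraMap_smul, ← mkDerivation_covH_oddHom, ← derJ_expA, h1]

/-! ### The Givental operator as a Gaussian operator -/

/-- The covariance of the Givental operator, where `ρ = 1 / R`. -/
def covR (ρ : ℂ⟦X⟧) (j k : ℕ) : ℂ :=
  ∑ n ∈ range (k + 1), coeff n ρ * ((-1) ^ (k - n + 1) * coeff (j + 1 + (k - n)) ρ)

/-- The mean of the Givental operator, where `ρ = 1 / R`. -/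
def meanR (ρ : ℂ⟦X⟧) (j : ℕ) : FunT :=
  ∑ n ∈ range (j + 1), coeff n ρ • dilT (j - n) + if j = 1 then MvPolynomial.C hbarInv else 0

/-- The inclusion of constants. -/
abbrev ofC : ℂ →ₐ[ℂ] Coef := Algebra.ofId ℂ Coef

/-- The commutators with the quantization of z^k have coefficients independent of the index, so on
symbols the operator is multiplication by -ℓ, whatever the power z⁻ⁱ split off. -/
lemma shiftZ_S (l : ℂ⟦X⟧) (hl : ∀ k, Even k → coeff k l = 0) (i : ℕ) :
    (shiftZ l).S i = vf 0 (PowerSeries.map ofC.toRingHom (-l)) := by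
  refine LinearMap.ext fun g => PowerSeries.ext fun m => ?_
  rw [Fock.Shift.coeff_S, vf_apply, zero_mul, sub_zero, mul_comm, coeff_mul,
    Finset.Nat.sum_antidiagonal_eq_sum_range_succ_mk, sum_range_succ]
  have h2 : coeff (m - m) (PowerSeries.map ofC.toRingHom (-l)) = 0 := by
    rw [Nat.sub_self, PowerSeries.coeff_map, map_neg, hl 0 (by simp)]
    simp
  simp only
  rw [h2, mul_zero, add_zero]
  apply Finset.sum_congr rfl
  intro n _
  rw [mul_comm, PowerSeries.coeff_map, map_neg, map_neg]
  congr 1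
  change (if Odd (m - n) then -algebraMap ℂ Coef (coeff (m - n) l) else 0) = _
  split_ifs with h
  · rfl
  · rw [hl _ (Nat.not_odd_iff_even.mp h), map_zero, neg_zero]

lemma expZ_dilT_mul (l : ℂ⟦X⟧) (hl : ∀ k, Even k → coeff k l = 0) (j : ℕ) (P : FunT) :
    (shiftZ l).expA (dilT j * P) =
      mulT (j + 1) (PowerSeries.map ofC.toRingHom (expo (vf 0 (-l)) 1)) * (shiftZ l).expA P +
      derT (j + 1) (PowerSeries.map ofC.toRingHom (expo (vf 0 (-l)) 1)) ((shiftZ l).expA P) := by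
  have := (shiftZ l).opExp_b (j + 1) P
  rw [shiftZ_S l hl, fockT_B] at this
  have h0 : fockT.b (-((j + 1 : ℕ) : ℤ)) P = dilT j * P := by
    rw [← linT_neg]
    change linT _ P = _
    congr 2
    push_cast
    ring
  have h1 := expo_vf_map ofC 0 (-l) 1
  rw [map_zero, map_one] at h1
  rw [h0, h1] at this
  exact this

lemma derT_dilT (i j : ℕ) (g : Coef⟦X⟧) :
    derT i g (dilT j) = MvPolynomial.C ((-1) ^ (j + 1) * coeff (i + j) g) := by
  unfold dilT
  rw [map_sub, derT, MvPolynomial.mkDerivation_X]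
  split_ifs <;> simp

theorem isGaussian_expZ (l : ℂ⟦X⟧) (hl : ∀ k, Even k → coeff k l = 0) :
    IsGaussian (shiftZ l).expA (meanR (expo (vf 0 (-l)) 1))
      (fun j k => ofC (covR (expo (vf 0 (-l)) 1) j k)) where
  map_one := (shiftZ l).opExp_vac
  map_X_mul j Z := by
    set ρ := expo (vf 0 (-l)) 1 with hρ
    have hmean : ∀ j, mulT (j + 1) (PowerSeries.map ofC.toRingHom ρ) +
        (if j = 1 then MvPolynomial.C hbarInv else 0) = meanR ρ j := by
      intro j
      rw [mulT, meanR]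
      congr 1
      refine sum_congr rfl fun n _ => ?_
      rw [PowerSeries.coeff_map, Nat.add_sub_cancel]
      exact algebraMap_smul Coef (coeff n ρ) (dilT (j - n))
    have hX : ∀ j P, (shiftZ l).expA (MvPolynomial.X j * P) = meanR ρ j * (shiftZ l).expA P +
        derT (j + 1) (PowerSeries.map ofC.toRingHom ρ) ((shiftZ l).expA P) := by
      intro j P
      -- The Heisenberg operator is the dilaton shifted variable; the constant ħ⁻¹ passes through
      -- the exponential unchanged, which is why `meanR` adds it back.
      have e : (MvPolynomial.X j : FunT) =
          dilT j + (if j = 1 then MvPolynomial.C hbarInv else 0) := by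
        rw [dilT, sub_add_cancel]
      conv_lhs => rw [e]
      rw [add_mul, map_add, expZ_dilT_mul l hl, ← hmean]
      have : (shiftZ l).expA ((if j = 1 then MvPolynomial.C hbarInv else 0) * P) =
          (if j = 1 then MvPolynomial.C hbarInv else 0) * (shiftZ l).expA P := by
        split_ifs
        · rw [← MvPolynomial.smul_eq_C_mul, map_smul, MvPolynomial.smul_eq_C_mul]
        · simp
      rw [this]
      ring
    rw [hX]
    congr 1
    refine gauss_derivation (shiftZ l).opExp_vac (meanR ρ) _ hX _ _ (fun k => ?_) Z
    have h0 : derT (j + 1) (PowerSeries.map ofC.toRingHom ρ)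
        (if k = 1 then MvPolynomial.C hbarInv else 0) = 0 := by
      split_ifs <;> simp
    rw [← hmean]
    change derT (j + 1) (PowerSeries.map ofC.toRingHom ρ) _ = _
    rw [map_add, h0, add_zero, mulT, map_sum, covR, map_sum, map_sum]
    refine sum_congr rfl fun n _ => ?_
    rw [Derivation.map_smul, derT_dilT, MvPolynomial.smul_eq_C_mul, ← map_mul,
      Nat.add_sub_cancel]
    congr 1
    rw [PowerSeries.coeff_map, PowerSeries.coeff_map, map_mul, map_mul, map_pow, map_neg, map_one]
    rfl


/-! ### Exponentials and logarithms of power series -/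

/-- Linear homogeneous equations of first order have unique solutions. -/
lemma eq_of_derivative_eq_mul {y w c : ℂ⟦X⟧} (hy : derivative ℂ y = c * y)
    (hw : derivative ℂ w = c * w) (hw0 : constantCoeff w ≠ 0)
    (h : constantCoeff y = constantCoeff w) : y = w := by
  have hu : w * w⁻¹ = 1 := PowerSeries.mul_inv_cancel w hw0
  have h1 : y * w⁻¹ = 1 := by
    apply PowerSeries.derivative.ext
    · rw [Derivation.leibniz, derivative_inv', hy, hw, derivative_one, smul_eq_mul, smul_eq_mul]
      linear_combination (-y * w⁻¹ * c) * hu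
    · rw [map_mul, h, ← map_mul, hu]
  linear_combination (-y) * hu + w * h1

/-- The exponential of a power series without constant term. -/
def pexp (v : ℂ⟦X⟧) : ℂ⟦X⟧ := (exp ℂ).subst v

lemma hasSubst_of {v : ℂ⟦X⟧} (hv : constantCoeff v = 0) : HasSubst v :=
  HasSubst.of_constantCoeff_zero' hv

lemma derivative_pexp {v : ℂ⟦X⟧} (hv : constantCoeff v = 0) :
    derivative ℂ (pexp v) = derivative ℂ v * pexp v := by
  rw [pexp, derivative_subst (hasSubst_of hv), derivative_exp, mul_comm]

lemma constantCoeff_subst_of {v : ℂ⟦X⟧} (hv : constantCoeff v = 0) (f : ℂ⟦X⟧) :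
    constantCoeff (f.subst v) = constantCoeff f := by
  have h1 : f.subst v = (f - PowerSeries.C (constantCoeff f)).subst v +
      PowerSeries.C (constantCoeff f) := by
    rw [subst_sub (hasSubst_of hv), subst_C]
    exact (sub_add_cancel _ _).symm
  rw [h1, map_add]
  have h2 : constantCoeff ((f - PowerSeries.C (constantCoeff f)).subst v) = 0 :=
    constantCoeff_subst_eq_zero hv _ (by simp)
  rw [h2]
  simp

lemma constantCoeff_pexp {v : ℂ⟦X⟧} (hv : constantCoeff v = 0) : constantCoeff (pexp v) = 1 := by
  rw [pexp, constantCoeff_subst_of hv, constantCoeff_exp]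

lemma pexp_zero : pexp 0 = 1 := by
  apply PowerSeries.derivative.ext
  · rw [derivative_pexp (map_zero _), map_zero, zero_mul, derivative_one]
  · rw [constantCoeff_pexp (map_zero _), map_one]

lemma pexp_add {u v : ℂ⟦X⟧} (hu : constantCoeff u = 0) (hv : constantCoeff v = 0) :
    pexp (u + v) = pexp u * pexp v := by
  have huv : constantCoeff (u + v) = 0 := by rw [map_add, hu, hv, add_zero]
  apply eq_of_derivative_eq_mul (derivative_pexp huv)
  · rw [Derivation.leibniz, derivative_pexp hu, derivative_pexp hv, map_add, smul_eq_mul,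
      smul_eq_mul]
    ring
  · simp [constantCoeff_pexp hu, constantCoeff_pexp hv]
  · simp [constantCoeff_pexp hu, constantCoeff_pexp hv, constantCoeff_pexp huv]

lemma pexp_mul_pexp_neg {u : ℂ⟦X⟧} (hu : constantCoeff u = 0) : pexp u * pexp (-u) = 1 := by
  rw [← pexp_add hu (by simp [hu]), add_neg_cancel, pexp_zero]

lemma derivative_logOf {u : ℂ⟦X⟧} (hu : constantCoeff u = 1) :
    u * derivative ℂ (logOf u) = derivative ℂ u := by
  have hv : constantCoeff (u - 1) = 0 := by simp [hu]
  rw [logOf_eq, derivative_subst (hasSubst_of hv), map_sub, derivative_one, sub_zero]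
  have h1 : derivative ℂ (log ℂ) * (1 + X) = 1 := by
    rw [deriv_log]
    ext n
    cases n with
    | zero => simp [mul_add]
    | succ n => simp [mul_add, coeff_succ_mul_X, pow_succ, coeff_one]
  have h2 := congrArg (fun f => PowerSeries.subst (u - 1) f) h1
  have e1 : (1 : ℂ⟦X⟧).subst (u - 1) = (1 : ℂ⟦X⟧) := by
    rw [← coe_substAlgHom (R := ℂ) (hasSubst_of hv), map_one]
  rw [subst_mul (hasSubst_of hv), subst_add (hasSubst_of hv), e1, subst_X (hasSubst_of hv)] at h2
  linear_combination derivative ℂ u * h2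

lemma logOf_pexp {v : ℂ⟦X⟧} (hv : constantCoeff v = 0) : logOf (pexp v) = v := by
  have h1 := constantCoeff_pexp hv
  apply PowerSeries.derivative.ext
  · have h2 := derivative_logOf h1
    rw [derivative_pexp hv, mul_comm (derivative ℂ v)] at h2
    apply mul_left_cancel₀ _ h2
    intro h
    rw [h, map_zero] at h1
    exact zero_ne_one h1
  · rw [constantCoeff_logOf h1, hv]

lemma pexp_logOf {u : ℂ⟦X⟧} (hu : constantCoeff u = 1) : pexp (logOf u) = u := by
  have h0 := constantCoeff_logOf hu
  apply eq_of_derivative_eq_mul (derivative_pexp h0)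
  · rw [mul_comm, derivative_logOf hu]
  · simp [hu]
  · rw [constantCoeff_pexp h0, hu]

lemma pexp_injective {u v : ℂ⟦X⟧} (hu : constantCoeff u = 0) (hv : constantCoeff v = 0)
    (h : pexp u = pexp v) : u = v := by
  rw [← logOf_pexp hu, h, logOf_pexp hv]

lemma rescale_pexp (c : ℂ) {v : ℂ⟦X⟧} (hv : constantCoeff v = 0) :
    rescale c (pexp v) = pexp (rescale c v) := by
  rw [rescale_eq_subst, rescale_eq_subst, pexp, pexp,
    subst_comp_subst_apply (hasSubst_of hv) (HasSubst.smul_X' c)]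

lemma expo_vf_zero_one {v : ℂ⟦X⟧} (hv : constantCoeff v = 0) : expo (vf 0 v) 1 = pexp v := by
  have hp : ∀ k g, ((vf 0 v) ^ k) g = v ^ k * g := by
    intro k
    induction k with
    | zero => simp
    | succ k ih =>
      intro g
      rw [pow_succ, Module.End.mul_apply, ih, vf_apply]
      ring
  ext n
  rw [expo, coeff_mk, pexp, coeff_subst' (hasSubst_of hv), finsum_eq_sum_of_support_subset
    (s := range (n + 1))]
  · refine sum_congr rfl fun j _ => ?_
    rw [divPow, LinearMap.smul_apply, hp, mul_one, PowerSeries.coeff_smul, coeff_exp]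
    simp
  · intro j hj
    rw [Function.mem_support] at hj
    by_contra hjn
    apply hj
    have : n < j := by simpa using hjn
    rw [coeff_of_lt_order (φ := v ^ j), smul_zero]
    refine lt_of_lt_of_le ?_ (le_order_pow_of_constantCoeff_eq_zero j hv)
    exact_mod_cast this

lemma evalNegHom_eq (f : ℂ⟦X⟧) : evalNegHom f = rescale (-1 : ℂ) f := rfl

/-- Taking logarithms, R(z) R(-z) = 1 says that log R is odd, so quantizing only the odd
coefficients loses nothing. -/
lemma IsSymplectic.coeff_logOf_even {R : ℂ⟦X⟧} (hR : IsSymplectic R) (k : ℕ) (hk : Even k) :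
    coeff k (logOf R) = 0 := by
  have h0 := constantCoeff_logOf hR.1
  have h0' : constantCoeff (rescale (-1 : ℂ) (logOf R)) = 0 := by
    rw [← coeff_zero_eq_constantCoeff_apply, coeff_rescale]
    simp [h0]
  have h1 : logOf R + rescale (-1 : ℂ) (logOf R) = 0 := by
    apply pexp_injective (by simp [h0, h0']) (map_zero _)
    rw [pexp_add h0 h0', ← rescale_pexp _ h0, pexp_logOf hR.1, pexp_zero, ← evalNegHom_eq, hR.2]
  have h2 := congrArg (coeff k) h1
  rw [map_add, coeff_rescale, hk.neg_one_pow, one_mul, map_zero] at h2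
  exact self_eq_neg.mp (eq_neg_of_add_eq_zero_left h2)

/-- The exponent of `1 / R_{q,p}`. -/
def expnt (q p : ℂ) : ℂ⟦X⟧ := PowerSeries.mk fun n : ℕ =>
    if Odd n then ((bernoulli (n + 1) : ℚ) : ℂ) / (((n : ℂ) + 1) * n) *
      (p ^ n + q ^ n - (p * q / (p + q)) ^ n) else 0

lemma constantCoeff_expnt (q p : ℂ) : constantCoeff (expnt q p) = 0 := by
  rw [← coeff_zero_eq_constantCoeff_apply, expnt, coeff_mk]
  simp

lemma Rqp_eq (q p : ℂ) : Rqp q p = pexp (-expnt q p) := rfl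

lemma isSymplectic_Rqp (q p : ℂ) : IsSymplectic (Rqp q p) := by
  have h0 : constantCoeff (-expnt q p) = 0 := by simp [constantCoeff_expnt]
  refine ⟨constantCoeff_pexp h0, ?_⟩
  rw [evalNegHom_eq, Rqp_eq, rescale_pexp _ h0]
  have : rescale (-1 : ℂ) (-expnt q p) = -(-expnt q p) := by
    ext n
    rw [coeff_rescale, map_neg, map_neg, map_neg, expnt, coeff_mk]
    split_ifs with h
    · rw [h.neg_one_pow]; ring
    · simp
  rw [this, pexp_mul_pexp_neg h0]

/-- The Givental operator is Gaussian. -/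
theorem isGaussian_givental {R : ℂ⟦X⟧} (hR : IsSymplectic R) :
    IsGaussian (shiftZ (logOf R)).expA (meanR R⁻¹) (fun j k => ofC (covR R⁻¹ j k)) := by
  have h0 := constantCoeff_logOf hR.1
  have h1 := isGaussian_expZ (logOf R) hR.coeff_logOf_even
  have h2 : expo (vf 0 (-logOf R)) 1 = R⁻¹ := by
    rw [expo_vf_zero_one (by simp [h0])]
    have h3 := pexp_mul_pexp_neg h0
    rw [pexp_logOf hR.1] at h3
    rw [PowerSeries.eq_inv_iff_mul_eq_one (by rw [hR.1]; exact one_ne_zero), mul_comm, h3]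
  rwa [h2] at h1


/-! ### Exponentials of vector fields -/

/-- Intertwining passes to exponentials when `L` is continuous: coefficient n of `L g` depends only
on the coefficients of `g` up to `e n`. The Laplace transform needs e n = 2n. -/
lemma Raises.apply_expo {𝕜 : Type*} [CommRing 𝕜] [Algebra ℂ 𝕜] {S S' : Module.End ℂ 𝕜⟦X⟧}
    (hS : Raises S) (hS' : Raises S') {L : 𝕜⟦X⟧ →ₗ[ℂ] 𝕜⟦X⟧} {e : ℕ → ℕ} (he : ∀ n, n ≤ e n)
    (hL : ∀ n g, (∀ m ≤ e n, coeff m g = 0) → coeff n (L g) = 0)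
    (h : ∀ g, L (S g) = S' (L g)) (g : 𝕜⟦X⟧) : L (expo S g) = expo S' (L g) := by
  have hd : ∀ j, L (divPow S j g) = divPow S' j (L g) := by
    intro j
    induction j with
    | zero => rw [divPow_zero, divPow_zero]
    | succ j ih =>
      have hj : ((j : ℂ) + 1) ≠ 0 := by exact_mod_cast j.succ_ne_zero
      apply smul_right_injective _ hj
      simp only
      rw [← map_smul, divPow_succ, divPow_succ, h, ih]
  ext n
  have h1 : coeff n (L (expo S g - ∑ j ∈ range (e n + 1), divPow S j g)) = 0 := by
    apply hL
    intro m hm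
    rw [map_sub, hS.coeff_expo g (N := e n + 1) (by omega), sub_self]
  rw [map_sub, map_sub, sub_eq_zero] at h1
  rw [h1, hS'.coeff_expo _ (N := e n + 1) (by have := he n; omega), map_sum]
  congr 1
  exact sum_congr rfl fun j _ => hd j

lemma expo_vf_zero {v : ℂ⟦X⟧} (hv : constantCoeff v = 0) (g : ℂ⟦X⟧) :
    expo (vf 0 v) g = pexp v * g := by
  have h := expo_vf_mul (A := (0 : ℂ⟦X⟧)) (C := v) (C' := 0) (by simp) hv (by simp) 1 g
  rw [add_zero, one_mul, expo_vf_zero_one hv] at h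
  rw [h, expo_of_apply_eq_zero (S := vf 0 0)]
  simp [vf_apply]

/-- The substitution `z ↦ z / (1 + c z)`. -/
def mob (c : ℂ) (g : ℂ⟦X⟧) : ℂ⟦X⟧ := expo (vf (PowerSeries.C c * X) 0) g

lemma mob_mul (c : ℂ) (g h : ℂ⟦X⟧) : mob c (g * h) = mob c g * mob c h := by
  have := expo_vf_mul (A := PowerSeries.C c * X) (C := 0) (C' := 0) (by simp) (by simp) (by simp) g h
  rwa [add_zero] at this

lemma constantCoeff_mob (c : ℂ) (g : ℂ⟦X⟧) : constantCoeff (mob c g) = constantCoeff g :=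
  constantCoeff_expo _ _

lemma coeff_vf_C_mul_X (c : ℂ) (g : ℂ⟦X⟧) (m : ℕ) :
    coeff (m + 1) (vf (PowerSeries.C c * X) 0 g) = -c * m * coeff m g := by
  rw [vf_apply, zero_mul, zero_sub, map_neg, mul_assoc, coeff_C_mul, coeff_succ_X_mul,
    coeff_X_mul_derivative]
  ring

lemma coeff_divPow_vf_C_mul_X (c : ℂ) (g : ℂ⟦X⟧) (j m : ℕ) :
    coeff (j + m + 1) (divPow (vf (PowerSeries.C c * X) 0) j g) =
      (-c) ^ j * (j + m).choose j * coeff (m + 1) g := by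
  induction j generalizing m with
  | zero => simp [divPow_zero]
  | succ j ih =>
    have hj : ((j : ℂ) + 1) ≠ 0 := by exact_mod_cast j.succ_ne_zero
    apply mul_left_cancel₀ hj
    have h1 := congrArg (coeff (j + 1 + m + 1)) (divPow_succ (vf (PowerSeries.C c * X) 0) j g)
    rw [PowerSeries.coeff_smul, smul_eq_mul, coeff_vf_C_mul_X,
      show j + 1 + m = j + m + 1 by ring, ih] at h1
    rw [show j + 1 + m = j + m + 1 by ring, h1]
    have h2 : (((j + m + 1).choose (j + 1) : ℕ) : ℂ) * (j + 1) = (j + m + 1) * ((j + m).choose j) := by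
      exact_mod_cast (Nat.add_one_mul_choose_eq (j + m) j).symm
    push_cast
    linear_combination c * (-c) ^ j * coeff (m + 1) g * h2

lemma raises_vf_C_mul_X (c : ℂ) : Raises (vf (PowerSeries.C c * X) 0 : Module.End ℂ ℂ⟦X⟧) :=
  raises_vf (by simp) (by simp)

lemma coeff_divPow_vf_C_mul_X_self (c : ℂ) (g : ℂ⟦X⟧) (m : ℕ) :
    coeff (m + 1) (divPow (vf (PowerSeries.C c * X) 0) (m + 1) g) = 0 := by
  induction m with
  | zero =>
    have h1 := congrArg (coeff 1) (divPow_succ (vf (PowerSeries.C c * X) 0) 0 g)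
    rw [PowerSeries.coeff_smul, coeff_vf_C_mul_X] at h1
    simpa using h1
  | succ m ih =>
    have hj : (((m + 1 : ℕ) : ℂ) + 1) ≠ 0 := by exact_mod_cast (m + 1).succ_ne_zero
    apply mul_left_cancel₀ hj
    have h1 := congrArg (coeff (m + 1 + 1)) (divPow_succ (vf (PowerSeries.C c * X) 0) (m + 1) g)
    rw [PowerSeries.coeff_smul, smul_eq_mul, coeff_vf_C_mul_X, ih] at h1
    rw [h1, mul_zero, mul_zero]

lemma coeff_mob (c : ℂ) (g : ℂ⟦X⟧) (m : ℕ) : coeff (m + 1) (mob c g) =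
    ∑ j ∈ range (m + 1), (-c) ^ j * m.choose j * coeff (m - j + 1) g := by
  rw [mob, (raises_vf_C_mul_X c).coeff_expo g (lt_add_one _), map_sum, sum_range_succ,
    coeff_divPow_vf_C_mul_X_self, add_zero]
  refine sum_congr rfl fun j hj => ?_
  rw [mem_range] at hj
  have := coeff_divPow_vf_C_mul_X c g j (m - j)
  rwa [show j + (m - j) = m by omega] at this

/-- If the lower nonconstant coefficients vanish, the identity in degree m + 2 reduces to c (m + 1)
g_{m+1} = 0. This is the uniqueness for the functional equation of ρ. -/
lemma eq_C_of_mob_eq {c : ℂ} (hc : c ≠ 0) {g : ℂ⟦X⟧} (h : mob c g = g) :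
    g = PowerSeries.C (constantCoeff g) := by
  have key : ∀ m, coeff (m + 1) g = 0 := by
    intro m
    induction m using Nat.strong_induction_on with
    | _ m ih =>
    have h1 := coeff_mob c g (m + 1)
    rw [h, sum_range_succ', sum_range_succ', sum_eq_zero] at h1
    · simp only [zero_add, pow_one, pow_zero, Nat.choose_one_right, Nat.choose_zero_right,
        Nat.add_sub_cancel, Nat.sub_zero, Nat.cast_one, one_mul] at h1
      have h2 : ((m + 1 : ℕ) : ℂ) ≠ 0 := by exact_mod_cast m.succ_ne_zero
      have h3 : c * ((m + 1 : ℕ) : ℂ) * coeff (m + 1) g = 0 := by linear_combination h1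
      exact (mul_eq_zero.mp h3).resolve_left (mul_ne_zero hc h2)
    · intro j hj
      rw [mem_range] at hj
      rw [show m + 1 - (j + 1 + 1) + 1 = (m - j - 1) + 1 by omega, ih _ (by omega), mul_zero]
  ext n
  cases n with
  | zero => simp
  | succ n => rw [key, coeff_C, if_neg n.succ_ne_zero]

lemma vf_mob (c : ℂ) (g : ℂ⟦X⟧) :
    mob c (vf (PowerSeries.C c * X) 0 g) = vf (PowerSeries.C c * X) 0 (mob c g) := by
  have hr := raises_vf_C_mul_X c
  refine (hr.apply_expo hr (e := id) (fun n => le_rfl) (fun n g hg => ?_) (fun g => rfl) g).symm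
  exact hr n _ (fun m hm => hg m hm.le) _ (by omega)

/-- Both sides solve the same linear differential equation, since `mob c` commutes with its own
vector field -c z² ∂/∂z. The condition c ≠ 0 allows cancelling c z². -/
lemma mob_pexp {c : ℂ} (hc : c ≠ 0) {r : ℂ⟦X⟧} (hr : constantCoeff r = 0) :
    mob c (pexp r) = pexp (mob c r) := by
  have hr' : constantCoeff (mob c r) = 0 := by rw [constantCoeff_mob, hr]
  refine eq_of_derivative_eq_mul (c := derivative ℂ (mob c r)) ?_ (derivative_pexp hr') ?_ ?_
  · have h1 := vf_mob c (pexp r)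
    have h2 := vf_mob c r
    rw [vf_apply, derivative_pexp hr, zero_mul, zero_sub] at h1
    rw [show -(PowerSeries.C c * X * (X * (derivative ℂ r * pexp r))) =
      vf (PowerSeries.C c * X) 0 r * pexp r by rw [vf_apply]; ring, mob_mul, h2, vf_apply,
      vf_apply, zero_mul, zero_sub, zero_mul, zero_sub] at h1
    have h3 : (PowerSeries.C c * X * X : ℂ⟦X⟧) ≠ 0 := by
      refine mul_ne_zero (mul_ne_zero ?_ X_ne_zero) X_ne_zero
      simpa using hc
    apply mul_left_cancel₀ h3
    linear_combination h1
  · rw [constantCoeff_pexp hr']; exact one_ne_zero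
  · rw [constantCoeff_pexp hr', constantCoeff_mob, constantCoeff_pexp hr]

lemma eq_of_sq_eq_sq {g h : ℂ⟦X⟧} (hg : constantCoeff g = 1) (hh : constantCoeff h = 1)
    (h2 : g ^ 2 = h ^ 2) : g = h := by
  rcases sq_eq_sq_iff_eq_or_eq_neg.mp h2 with h | h
  · exact h
  · rw [h, map_neg, hh] at hg
    norm_num at hg

/-- The series `log (1 + c z)`. -/
def lg (c : ℂ) : ℂ⟦X⟧ := PowerSeries.mk fun n => (-1) ^ (n + 1) * c ^ n / n

lemma coeff_lg (c : ℂ) (n : ℕ) : coeff n (lg c) = (-1) ^ (n + 1) * c ^ n / n := coeff_mk _ _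

lemma constantCoeff_lg (c : ℂ) : constantCoeff (lg c) = 0 := by
  rw [← coeff_zero_eq_constantCoeff_apply, coeff_lg]
  simp

lemma pexp_lg (c : ℂ) : pexp (lg c) = 1 + PowerSeries.C c * X := by
  have h1 : derivative ℂ (lg c) * (1 + PowerSeries.C c * X) = PowerSeries.C c := by
    have h2 : ∀ n, coeff n (derivative ℂ (lg c)) = (-1) ^ n * c ^ (n + 1) := by
      intro n
      have : ((n : ℂ) + 1) ≠ 0 := by exact_mod_cast n.succ_ne_zero
      rw [coeff_derivative, coeff_lg]
      push_cast
      field_simp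
      ring
    ext n
    rw [mul_add, mul_one, mul_left_comm, map_add, coeff_C_mul]
    cases n with
    | zero => simp [h2]
    | succ n =>
      rw [coeff_succ_mul_X, h2, h2, coeff_C, if_neg n.succ_ne_zero]
      ring
  refine eq_of_derivative_eq_mul (derivative_pexp (constantCoeff_lg c)) ?_ (by simp) ?_
  · rw [h1, map_add, derivative_one, zero_add, Derivation.leibniz, derivative_X, derivative_C]
    simp
  · rw [constantCoeff_pexp (constantCoeff_lg c)]
    simp

/-- The square root of `1 / (1 + c z)` as the value of an exponential of a vector field. -/
lemma expo_vf_one_eq (c : ℂ) : expo (vf (PowerSeries.C c * X) (PowerSeries.C (-(c / 2)) * X)) 1 =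
    pexp ((-(1 / 2) : ℂ) • lg c) := by
  set Y := expo (vf (PowerSeries.C c * X) (PowerSeries.C (-(c / 2)) * X)) 1 with hY
  have h0 : constantCoeff ((-(1 / 2) : ℂ) • lg c) = 0 := by
    rw [constantCoeff_smul, constantCoeff_lg, smul_zero]
  have h1 : Y * Y = expo (vf (PowerSeries.C c * X) (-(PowerSeries.C c * X))) 1 := by
    rw [hY, ← expo_vf_mul (by simp) (by simp) (by simp), one_mul, ← add_mul, ← map_add,
      ← neg_mul, ← map_neg]
    congr 4
    ring
  -- The exponential series stops after two terms: 1 ↦ c z ↦ 0.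
  have h2 : expo (vf (PowerSeries.C c * X) (PowerSeries.C c * X)) 1 =
      (1 + PowerSeries.C c * X : ℂ⟦X⟧) := by
    have hr : Raises (vf (PowerSeries.C c * X) (PowerSeries.C c * X) : Module.End ℂ ℂ⟦X⟧) :=
      raises_vf (by simp) (by simp)
    have e1 : divPow (vf (PowerSeries.C c * X) (PowerSeries.C c * X)) 1 (1 : ℂ⟦X⟧) =
        PowerSeries.C c * X := by
      rw [divPow_apply]
      simp [vf_apply]
    have e2 : divPow (vf (PowerSeries.C c * X) (PowerSeries.C c * X)) 2 (1 : ℂ⟦X⟧) = 0 := by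
      rw [divPow_apply]
      simp only [Function.iterate_succ, Function.iterate_zero, Function.comp_apply, id_eq, vf_apply,
        Derivation.leibniz, derivative_C, derivative_X, derivative_one, mul_zero, sub_zero, mul_one,
        smul_eq_mul, add_zero]
      rw [mul_comm X (PowerSeries.C c), sub_self, smul_zero]
    ext n
    rw [hr.coeff_expo 1 (N := n + 1 + 1) (by omega), sum_range_succ', sum_range_succ',
      sum_eq_zero, zero_add, divPow_zero, zero_add, e1, add_comm]
    intro j _
    exact divPow_eq_zero e2 (by omega)
  have h3 : Y ^ 2 * (1 + PowerSeries.C c * X) = 1 := by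
    rw [← h2, sq, h1, ← expo_vf_mul (by simp) (by simp) (by simp), one_mul, neg_add_cancel]
    apply expo_of_apply_eq_zero
    simp [vf_apply]
  have h4 : pexp ((-(1 / 2) : ℂ) • lg c) ^ 2 * (1 + PowerSeries.C c * X) = 1 := by
    rw [← pexp_lg, sq, ← pexp_add h0 h0, ← pexp_add (by simp [constantCoeff_lg]) (constantCoeff_lg c),
      ← add_smul, ← pexp_zero]
    congr 1
    module
  apply eq_of_sq_eq_sq
  · rw [hY, constantCoeff_expo, map_one]
  · exact constantCoeff_pexp h0
  · linear_combination pexp ((-(1 / 2) : ℂ) • lg c) ^ 2 * h3 - Y ^ 2 * h4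


/-! ### The asymptotic expansion attached to a curve -/

/-- The denominator `(1 + α z)(1 + β z)` of `dx`. -/
def curveU (α β : ℂ) : ℂ⟦X⟧ := (1 + PowerSeries.C α * X) * (1 + PowerSeries.C β * X)

lemma constantCoeff_curveU (α β : ℂ) : constantCoeff (curveU α β) = 1 := by simp [curveU]

lemma curveU_mul_inv (α β : ℂ) : curveU α β * (curveU α β)⁻¹ = 1 :=
  PowerSeries.mul_inv_cancel _ (by rw [constantCoeff_curveU]; exact one_ne_zero)

lemma curveU_comm (α β : ℂ) : curveU α β = curveU β α := mul_comm _ _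

/-- `H = z / f`, where `f df = z dz / ((1 + α z)(1 + β z))`. -/
structure IsH (α β : ℂ) (H : ℂ⟦X⟧) : Prop where
  const : constantCoeff H = 1
  eqn : H ^ 3 = curveU α β * (H - X * derivative ℂ H)

/-- The expansion of `1 / R` in terms of the curve. -/
def rhoH (H : ℂ⟦X⟧) : ℂ⟦X⟧ :=
  PowerSeries.mk fun n => if n = 0 then 1 else -dfac (n - 1) * coeff (2 * n) (H ^ (2 * n - 1))

lemma coeff_zero_rhoH (H : ℂ⟦X⟧) : coeff 0 (rhoH H) = 1 := by simp [rhoH]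

lemma coeff_succ_rhoH (H : ℂ⟦X⟧) (j : ℕ) :
    coeff (j + 1) (rhoH H) = -dfac j * coeff (2 * j + 2) (H ^ (2 * j + 1)) := by
  rw [rhoH, coeff_mk, if_neg j.succ_ne_zero, Nat.add_sub_cancel,
    show 2 * (j + 1) - 1 = 2 * j + 1 by omega, mul_add, mul_one]

/-- The formal Laplace transform along the curve. -/
def lap (α β : ℂ) (H : ℂ⟦X⟧) : ℂ⟦X⟧ →ₗ[ℂ] ℂ⟦X⟧ where
  toFun g := PowerSeries.mk fun k =>
    dfac k * coeff (2 * k) (H ^ (2 * k + 1) * (g * (curveU α β)⁻¹))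
  map_add' g h := by
    ext k
    simp only [coeff_mk, map_add, add_mul, mul_add]
  map_smul' c g := by
    ext k
    simp only [coeff_mk, smul_mul_assoc, mul_smul_comm, PowerSeries.coeff_smul, RingHom.id_apply,
      smul_eq_mul]
    ring

lemma coeff_lap (α β : ℂ) (H g : ℂ⟦X⟧) (k : ℕ) : coeff k (lap α β H g) =
    dfac k * coeff (2 * k) (H ^ (2 * k + 1) * (g * (curveU α β)⁻¹)) := by
  simp [lap]

namespace IsH

variable {α β : ℂ} {H : ℂ⟦X⟧}

lemma symm (hH : IsH α β H) : IsH β α H := ⟨hH.const, by rw [curveU_comm]; exact hH.eqn⟩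

lemma cube_mul_inv (hH : IsH α β H) :
    H ^ 3 * (curveU α β)⁻¹ = H - X * derivative ℂ H := by
  rw [hH.eqn]
  linear_combination (H - X * derivative ℂ H) * curveU_mul_inv α β

/-- Integration by parts: z d/dz multiplies the n-th coefficient of H^{i+1} h by n, and H³/U = H -
zH' converts the derivative of H^{i+1} into H^{i+3}/U. -/
lemma coeff_pow_mul (hH : IsH α β H) (h : ℂ⟦X⟧) (i n : ℕ) :
    (i + 1) * coeff n (H ^ (i + 3) * (h * (curveU α β)⁻¹)) =
      (i + 1 - n) * coeff n (H ^ (i + 1) * h) +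
        coeff n (H ^ (i + 1) * (X * derivative ℂ h)) := by
  have h1 : H ^ (i + 3) * (h * (curveU α β)⁻¹) = H ^ i * (H - X * derivative ℂ H) * h := by
    rw [← hH.cube_mul_inv]
    ring
  have h2 : PowerSeries.C ((i : ℂ) + 1) * (H ^ i * (H - X * derivative ℂ H) * h) =
      PowerSeries.C ((i : ℂ) + 1) * (H ^ (i + 1) * h) - X * derivative ℂ (H ^ (i + 1) * h) +
        H ^ (i + 1) * (X * derivative ℂ h) := by
    rw [Derivation.leibniz, derivative_pow, Nat.add_sub_cancel, map_add, map_natCast, map_one,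
      smul_eq_mul, smul_eq_mul]
    push_cast
    ring
  have h3 := congrArg (coeff n) h2
  rw [coeff_C_mul, map_add, map_sub, coeff_C_mul, coeff_X_mul_derivative] at h3
  rw [h1, h3]
  ring

lemma lap_one (hH : IsH α β H) : lap α β H 1 = rhoH H := by
  ext k
  rw [coeff_lap]
  cases k with
  | zero =>
    rw [coeff_zero_rhoH, dfac_zero]
    simp [hH.const, constantCoeff_curveU]
  | succ k =>
    have h1 := hH.coeff_pow_mul 1 (2 * k) (2 * (k + 1))
    rw [derivative_one, mul_zero, mul_zero, map_zero, add_zero, mul_one] at h1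
    rw [coeff_succ_rhoH, dfac_succ, show 2 * (k + 1) + 1 = 2 * k + 3 by ring]
    push_cast at h1
    rw [show 2 * (k + 1) = 2 * k + 2 by ring] at h1 ⊢
    linear_combination dfac k * h1

/-- The choice n = i + 1 in `coeff_pow_mul` kills the middle term. Analytically, z dz/U = dx, and
integrating h e^{-x/ħ} dx by parts gives ħ times the integral of e^{-x/ħ} dh. -/
lemma lap_X_mul (hH : IsH α β H) (h : ℂ⟦X⟧) :
    lap α β H (X * h) = X * lap α β H (curveU α β * derivative ℂ h) := by
  ext k
  cases k with
  | zero =>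
    rw [coeff_lap, coeff_zero_X_mul]
    simp
  | succ k =>
    rw [coeff_succ_X_mul, coeff_lap, coeff_lap]
    have h1 := hH.coeff_pow_mul h (2 * k) (2 * k + 1)
    push_cast at h1
    rw [sub_self, zero_mul, zero_add, mul_left_comm _ X, coeff_succ_X_mul] at h1
    rw [show 2 * (k + 1) = 2 * k + 1 + 1 by ring, mul_assoc X h, mul_left_comm _ X, coeff_succ_X_mul,
      dfac_succ, show 2 * k + 1 + 1 + 1 = 2 * k + 3 by ring, mul_right_comm (curveU α β),
      curveU_mul_inv, one_mul]
    linear_combination dfac k * h1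

/-- The function `x` on the curve. -/
lemma derivative_x (hH : IsH α β H) : derivative ℂ ((1 / 2 : ℂ) • (X ^ 2 * H⁻¹ ^ 2)) =
    X * (curveU α β)⁻¹ := by
  have h1 : H * H⁻¹ = 1 := PowerSeries.mul_inv_cancel H (by rw [hH.const]; exact one_ne_zero)
  have h2 := hH.cube_mul_inv
  have h3 : derivative ℂ (X ^ 2 * H⁻¹ ^ 2) = (2 : ℂ) • (X * (curveU α β)⁻¹) := by
    rw [Derivation.leibniz, derivative_pow, derivative_pow, derivative_inv', derivative_X]
    have e : ∀ g : ℂ⟦X⟧, (2 : ℂ) • g = 2 * g := fun g => by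
      rw [PowerSeries.smul_eq_C_mul]; rfl
    simp only [Nat.cast_ofNat, smul_eq_mul, Nat.add_one_sub_one, pow_one, mul_one, e]
    have h4 : (curveU α β)⁻¹ = H⁻¹ ^ 3 * (H - X * derivative ℂ H) := by
      rw [← h2]
      linear_combination (-(curveU α β)⁻¹) * (H ^ 2 * H⁻¹ ^ 2 + H * H⁻¹ + 1) * h1
    rw [h4]
    linear_combination (-2 * X * H⁻¹ ^ 2) * h1
  rw [Derivation.map_smul, h3, smul_smul]
  norm_num

/-- Multiplication by x = z²/(2H²) lowers the power of H by two and the degree by two, so it shifts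
k by one up to the factor (2k+1)/2; this is the operator z/2 + z² d/dz. -/
lemma lap_x_mul (hH : IsH α β H) (g : ℂ⟦X⟧) :
    lap α β H ((1 / 2 : ℂ) • (X ^ 2 * H⁻¹ ^ 2) * g) =
      (1 / 2 : ℂ) • (X * lap α β H g) + X * (X * derivative ℂ (lap α β H g)) := by
  have h1 : H * H⁻¹ = 1 := PowerSeries.mul_inv_cancel H (by rw [hH.const]; exact one_ne_zero)
  ext k
  rw [smul_mul_assoc, map_smul, map_add, PowerSeries.coeff_smul, PowerSeries.coeff_smul]
  cases k with
  | zero => simp [coeff_lap]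
  | succ k =>
    rw [coeff_succ_X_mul, coeff_succ_X_mul, coeff_X_mul_derivative, coeff_lap, coeff_lap]
    have h2 : H ^ (2 * (k + 1) + 1) * (X ^ 2 * H⁻¹ ^ 2 * g * (curveU α β)⁻¹) =
        X ^ 2 * (H ^ (2 * k + 1) * (g * (curveU α β)⁻¹)) := by
      rw [show 2 * (k + 1) + 1 = 2 * k + 1 + 2 by ring, pow_add]
      linear_combination H ^ (2 * k + 1) * X ^ 2 * g * (curveU α β)⁻¹ * (H * H⁻¹ + 1) * h1
    rw [h2, show 2 * (k + 1) = 2 * k + 2 by ring, coeff_X_pow_mul, dfac_succ, smul_eq_mul,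
      smul_eq_mul]
    ring

/-- The factor e^{-cx} replaces 1/ħ by 1/ħ + c in the Laplace kernel. Formally, `lap` intertwines
-cx with -c(z/2 + z² d/dz), whose exponential is the substitution z/(1+cz) followed by
multiplication by (1+cz)^{-1/2}. -/
lemma lap_pexp_mul (hH : IsH α β H) (c : ℂ) (g : ℂ⟦X⟧) :
    lap α β H (pexp ((-c) • ((1 / 2 : ℂ) • (X ^ 2 * H⁻¹ ^ 2))) * g) =
      pexp ((-(1 / 2) : ℂ) • lg c) * mob c (lap α β H g) := by
  set x : ℂ⟦X⟧ := (1 / 2 : ℂ) • (X ^ 2 * H⁻¹ ^ 2) with hx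
  have hx0 : constantCoeff ((-c) • x) = 0 := by simp [hx]
  have h1 := expo_vf_mul (A := PowerSeries.C c * X) (C := PowerSeries.C (-(c / 2)) * X) (C' := 0)
    (by simp) (by simp) (by simp) 1 (lap α β H g)
  rw [one_mul, add_zero, expo_vf_one_eq] at h1
  rw [mob, ← h1, ← expo_vf_zero hx0]
  refine Raises.apply_expo (raises_vf (by simp) hx0) (raises_vf (by simp) (by simp))
    (e := fun n => 2 * n) (fun n => by omega) (fun n g hg => ?_) (fun g => ?_) g
  · rw [coeff_lap, coeff_mul_eq_zero (a := 0) (b := 2 * n + 1) (by omega) (by simp), mul_zero]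
    intro m hm
    exact coeff_mul_eq_zero (a := 2 * n + 1) (b := 0) (by omega) (fun k hk => hg k (by omega))
      (by simp)
  · rw [vf_apply, vf_apply, zero_mul, sub_zero, smul_mul_assoc, map_smul, hx, hH.lap_x_mul]
    simp only [PowerSeries.smul_eq_C_mul, map_neg]
    have : (PowerSeries.C (c / 2) : ℂ⟦X⟧) = PowerSeries.C c * PowerSeries.C (1 / 2) := by
      rw [← map_mul]; congr 1; ring
    rw [this]
    ring

end IsH


/-! ### Stirling's series -/

/-- Stirling's series `∑ B_{n+1} / (n (n+1)) zⁿ`. -/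
def stirling : ℂ⟦X⟧ :=
  PowerSeries.mk fun n => ((bernoulli (n + 1) : ℚ) : ℂ) / (((n : ℂ) + 1) * n)

lemma coeff_stirling (n : ℕ) :
    coeff n stirling = ((bernoulli (n + 1) : ℚ) : ℂ) / (((n : ℂ) + 1) * n) := coeff_mk _ _

lemma expnt_eq (q p : ℂ) : expnt q p =
    rescale p stirling + rescale q stirling - rescale (p * q / (p + q)) stirling := by
  ext n
  simp only [map_sub, map_add, coeff_rescale, coeff_stirling]
  rw [expnt, coeff_mk]
  split_ifs with h
  · ring
  · rcases Nat.eq_zero_or_pos n with rfl | hn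
    · simp
    · rw [bernoulli_eq_zero_of_odd (Nat.not_odd_iff_even.mp h).add_one (by omega)]
      simp

lemma mob_rescale (M d : ℂ) (g : ℂ⟦X⟧) : mob (M * d) (rescale d g) = rescale d (mob M g) := by
  ext n
  cases n with
  | zero =>
    rw [coeff_zero_eq_constantCoeff_apply, constantCoeff_mob, coeff_rescale,
      coeff_zero_eq_constantCoeff_apply, constantCoeff_mob, ← coeff_zero_eq_constantCoeff_apply,
      coeff_rescale, coeff_zero_eq_constantCoeff_apply]
  | succ m =>
    rw [coeff_mob, coeff_rescale, coeff_mob, mul_sum]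
    refine sum_congr rfl fun j hj => ?_
    rw [mem_range] at hj
    rw [coeff_rescale, ← neg_mul, mul_pow]
    have : d ^ (m + 1) = d ^ j * d ^ (m - j + 1) := by
      rw [← pow_add]
      congr 1
      omega
    rw [this]
    ring

lemma choose_add_two_mul (m i : ℕ) :
    ((m : ℂ) + 2) * (m + 1) * m.choose i = (i + 2) * (i + 1) * (m + 2).choose (i + 2) := by
  have h1 : (m + 1) * m.choose i = (m + 1).choose (i + 1) * (i + 1) :=
    Nat.add_one_mul_choose_eq m i
  have h2 : (m + 2) * (m + 1).choose (i + 1) = (m + 2).choose (i + 2) * (i + 2) :=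
    Nat.add_one_mul_choose_eq (m + 1) (i + 1)
  have h1' : ((m : ℂ) + 1) * m.choose i = (m + 1).choose (i + 1) * (i + 1) := by exact_mod_cast h1
  have h2' : ((m : ℂ) + 2) * (m + 1).choose (i + 1) = (m + 2).choose (i + 2) * (i + 2) := by
    exact_mod_cast h2
  linear_combination ((m : ℂ) + 2) * h1' + (i + 1) * h2'

lemma sum_pow_eq (M m : ℕ) : ∑ k ∈ Ico 1 (M + 1), (k : ℂ) ^ (m + 1) =
    ∑ j ∈ range m, ((bernoulli' (m - 1 - j + 2) : ℚ) : ℂ) * (m + 2).choose (m - 1 - j + 2) *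
      (M : ℂ) ^ (j + 1) / (m + 2) + (M : ℂ) ^ (m + 1) / 2 + (M : ℂ) ^ (m + 2) / (m + 2) := by
  have h := congrArg (Rat.cast : ℚ → ℂ) (sum_Ico_pow M (m + 1))
  rw [sum_range_succ', sum_range_succ', ← sum_range_reflect] at h
  push_cast at h
  rw [h]
  have hm : ((m : ℂ) + 2) ≠ 0 := by exact_mod_cast (m + 1).succ_ne_zero
  congr 1
  · congr 1
    · refine sum_congr rfl fun j hj => ?_
      rw [mem_range] at hj
      rw [show m - (m - 1 - j) = j + 1 by omega]
      ring
    · have h2 : ((m : ℂ) + 1 + 1) ≠ 0 := by exact_mod_cast (m + 1).succ_ne_zero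
      simp only [bernoulli'_one, Nat.choose_one_right]
      push_cast
      field_simp
  · simp only [bernoulli'_zero, Nat.choose_zero_right]
    push_cast
    ring

/-- The formal counterpart of log Γ(x) - log Γ(x + M), with x = 1/z. The power sum, from Faulhaber's
formula, is the contribution of -∑_{k ≤ M} log(1 + k z). -/
lemma coeff_stirling_sub_mob (M m : ℕ) : coeff (m + 1) (stirling - mob M stirling) =
    (-1) ^ (m + 1) / (m + 1) * (∑ k ∈ Ico 1 (M + 1), (k : ℂ) ^ (m + 1)
      - (M : ℂ) ^ (m + 2) / (m + 2) - (M : ℂ) ^ (m + 1) / 2) := by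
  rw [map_sub, coeff_mob, sum_range_succ', sum_pow_eq, add_sub_cancel_right, add_sub_cancel_right,
    mul_sum]
  simp only [pow_zero, Nat.choose_zero_right, Nat.cast_one, one_mul, Nat.sub_zero]
  rw [sub_add_cancel_right, ← sum_neg_distrib]
  refine sum_congr rfl fun j hj => ?_
  rw [mem_range] at hj
  obtain ⟨i, rfl⟩ : ∃ i, m = i + j + 1 := ⟨m - 1 - j, by omega⟩
  rw [show i + j + 1 - 1 - j = i by omega, show i + j + 1 - (j + 1) = i by omega, coeff_stirling,
    bernoulli'_eq_bernoulli, show i + 1 + 1 = i + 2 by ring]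
  have h1 := choose_add_two_mul (i + j + 1) i
  have h2 : (i + j + 1).choose (j + 1) = (i + j + 1).choose i := by
    rw [← Nat.choose_symm (by omega)]
    congr 1
    omega
  have e1 : ((i : ℂ) + 1) ≠ 0 := by exact_mod_cast i.succ_ne_zero
  have e2 : ((i : ℂ) + 2) ≠ 0 := by exact_mod_cast (i + 1).succ_ne_zero
  have e3 : ((i : ℂ) + j + 1 + 1) ≠ 0 := by exact_mod_cast (i + j + 1).succ_ne_zero
  have e4 : ((i : ℂ) + j + 1 + 2) ≠ 0 := by exact_mod_cast (i + j + 2).succ_ne_zero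
  have e5 : ((i : ℂ) + 1 + 1) ≠ 0 := by exact_mod_cast (i + 1).succ_ne_zero
  rw [h2]
  push_cast at h1 ⊢
  have h3 : ((i + j + 1).choose i : ℂ) = (i + 2) * (i + 1) * (i + j + 1 + 2).choose (i + 2) /
      ((i + j + 1 + 2) * (i + j + 1 + 1)) := by
    rw [eq_div_iff (mul_ne_zero e4 e3)]
    linear_combination h1
  have h4 : ((-1 : ℂ) ^ (i + j + 1 + 1)) * (-1) ^ (i + 2) = (-1) ^ j := by
    rw [← pow_add, show i + j + 1 + 1 + (i + 2) = 2 * (i + 2) + j by ring, pow_add, pow_mul]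
    norm_num
  have h5 : (-(M : ℂ)) ^ (j + 1) = -((-1) ^ j * (M : ℂ) ^ (j + 1)) := by
    rw [neg_pow]
    ring
  rw [h3, h5, ← h4]
  field_simp
  ring

lemma mob_add (c : ℂ) (g h : ℂ⟦X⟧) : mob c (g + h) = mob c g + mob c h := by
  ext n
  simp only [mob, expo, coeff_mk, map_add, sum_add_distrib]

lemma mob_sub (c : ℂ) (g h : ℂ⟦X⟧) : mob c (g - h) = mob c g - mob c h := by
  rw [eq_sub_iff_add_eq, ← mob_add, sub_add_cancel]

/-- The functional equation of the exponent. -/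
lemma expnt_sub_mob {N : ℕ} (hN : 2 ≤ N) :
    expnt (1 / N) (1 - 1 / N) - mob (1 - 1 / N) (expnt (1 / N) (1 - 1 / N)) =
      (-(1 / 2) : ℂ) • lg (1 - 1 / N) + lg 1 - ∑ j ∈ range N,
        (lg ((j + 1) / N) - lg ((j + 1) * (1 - 1 / N) / N)) := by
  have hN0 : (N : ℂ) ≠ 0 := by exact_mod_cast (by omega : N ≠ 0)
  ext n
  cases n with
  | zero =>
    simp [constantCoeff_mob, constantCoeff_lg]
  | succ m =>
  obtain ⟨M, rfl⟩ : ∃ M, N = M + 1 := ⟨N - 1, by omega⟩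
  set q : ℂ := 1 / (M + 1 : ℕ) with hq
  set p : ℂ := 1 - q with hp
  have hqN : q * (M + 1) = 1 := by rw [hq]; push_cast at hN0 ⊢; field_simp
  have hpM : (M : ℂ) * q = p := by rw [hp]; linear_combination hqN
  have hpq : p * q / (p + q) = p * q := by rw [hp]; simp
  -- Since p + q = 1 and q = 1/(M+1), the shift p equals 1 · p, M · q and (M+1) · pq. Each of the
  -- three rescaled Stirling series is therefore shifted by an integer.
  have h1 : expnt q p - mob p (expnt q p) =
      rescale p (stirling - mob (1 : ℕ) stirling) + rescale q (stirling - mob M stirling) -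
        rescale (p * q) (stirling - mob (M + 1 : ℕ) stirling) := by
    rw [expnt_eq, hpq, mob_sub, mob_add, map_sub, map_sub, map_sub, ← mob_rescale,
      ← mob_rescale, ← mob_rescale]
    have e3 : ((M + 1 : ℕ) : ℂ) * (p * q) = p := by push_cast; linear_combination p * hqN
    rw [Nat.cast_one, one_mul, hpM, e3]
    ring
  have e1 : ∑ j ∈ range (M + 1), ((j : ℂ) + 1) ^ (m + 1) =
      ∑ k ∈ Ico 1 (M + 1 + 1), (k : ℂ) ^ (m + 1) := by
    rw [sum_Ico_eq_sum_range]
    refine sum_congr rfl fun j _ => ?_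
    push_cast
    ring
  have e2 : ∑ k ∈ Ico 1 (M + 1 + 1), (k : ℂ) ^ (m + 1) =
      ∑ k ∈ Ico 1 (M + 1), (k : ℂ) ^ (m + 1) + ((M : ℂ) + 1) ^ (m + 1) := by
    rw [sum_Ico_succ_top (by omega)]
    push_cast
    rfl
  have h2 : ∀ j : ℕ, coeff (m + 1) (lg (((j : ℂ) + 1) / (M + 1 : ℕ)) -
      lg (((j : ℂ) + 1) * p / (M + 1 : ℕ))) =
      (-1) ^ (m + 2) / (m + 1) * (q ^ (m + 1) - (p * q) ^ (m + 1)) * ((j : ℂ) + 1) ^ (m + 1) := by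
    intro j
    rw [map_sub, coeff_lg, coeff_lg, show ((j : ℂ) + 1) / (M + 1 : ℕ) = (j + 1) * q by
      rw [hq]; ring, show ((j : ℂ) + 1) * p / (M + 1 : ℕ) = (j + 1) * (p * q) by rw [hq]; ring,
      mul_pow, mul_pow]
    push_cast
    ring
  rw [h1, map_sub, map_add, coeff_rescale, coeff_rescale, coeff_rescale, coeff_stirling_sub_mob,
    coeff_stirling_sub_mob, coeff_stirling_sub_mob, map_sub, map_add, PowerSeries.coeff_smul,
    coeff_lg, coeff_lg, map_sum, sum_congr rfl fun j _ => h2 j, ← mul_sum, e1, e2]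
  set P := ∑ k ∈ Ico 1 (M + 1), (k : ℂ) ^ (m + 1)
  have f1 : q ^ (m + 1) * ((M : ℂ) + 1) ^ (m + 1) = 1 := by rw [← mul_pow, hqN, one_pow]
  have f2 : q ^ (m + 1) * (M : ℂ) ^ (m + 1) = p ^ (m + 1) := by
    rw [← mul_pow, mul_comm q, hpM]
  have f3 : q ^ (m + 1) * (M : ℂ) ^ (m + 2) = M * p ^ (m + 1) := by rw [← f2]; ring
  have hs : ∑ k ∈ Ico (1 : ℕ) (1 + 1), (k : ℂ) ^ (m + 1) = 1 := by simp
  rw [hs]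
  push_cast
  rw [mul_pow p q, one_pow, one_pow, smul_eq_mul, pow_succ ((M : ℂ) + 1) (m + 1)]
  linear_combination (-1) ^ (m + 1) / (m + 1) * (-f3 / (m + 2) - f2 / 2 +
    p ^ (m + 1) * (-1 + (M + 1) / (m + 2) + 1 / 2) * f1 - f1 + p ^ (m + 1) * f1)


/-! ### The functional equation on the curves with α = 1 and β = 1/N -/

lemma lap_C_mul (α β : ℂ) (H : ℂ⟦X⟧) (c : ℂ) (g : ℂ⟦X⟧) :
    lap α β H (PowerSeries.C c * g) = PowerSeries.C c * lap α β H g := by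
  rw [← PowerSeries.smul_eq_C_mul, map_smul, PowerSeries.smul_eq_C_mul]

/-- The series `1 / (1 + c z)`. -/
def geom (c : ℂ) : ℂ⟦X⟧ := (1 + PowerSeries.C c * X)⁻¹

lemma mul_geom (c : ℂ) : (1 + PowerSeries.C c * X) * geom c = 1 :=
  PowerSeries.mul_inv_cancel _ (by simp)

lemma derivative_geom_pow (c : ℂ) (j : ℕ) : derivative ℂ (geom c ^ j) =
    -(PowerSeries.C (j * c) * geom c ^ (j + 1)) := by
  cases j with
  | zero => simp
  | succ j =>
    rw [derivative_pow, geom, derivative_inv']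
    simp only [map_add, derivative_one, Derivation.leibniz, derivative_X, derivative_C,
      Nat.add_sub_cancel, smul_eq_mul, mul_one, mul_zero, zero_add, add_zero, map_mul, map_natCast]
    ring

section Reciprocal

variable {N : ℕ} {H : ℂ⟦X⟧}

lemma one_add_X_mul_geom_pow (hN : 2 ≤ N) (j : ℕ) : (1 + X) * geom (1 / N) ^ (j + 1) =
    PowerSeries.C (N : ℂ) * geom (1 / N) ^ j - PowerSeries.C (N - 1 : ℂ) * geom (1 / N) ^ (j + 1) := by
  have hN0 : (N : ℂ) ≠ 0 := by exact_mod_cast (by omega : N ≠ 0)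
  have h1 := mul_geom (1 / N)
  have h2 : PowerSeries.C (N : ℂ) * PowerSeries.C (1 / N : ℂ) = 1 := by
    rw [← map_mul, mul_one_div_cancel hN0, map_one]
  rw [map_sub, map_one]
  linear_combination (PowerSeries.C (N : ℂ) * geom (1 / N) ^ j) * h1 -
    X * geom (1 / N) ^ (j + 1) * h2

/-- Here U times the derivative of a power of 1/(1+z/N) is again a combination of two consecutive
powers, so integration by parts closes up into a first order recursion. -/
lemma lap_geom_pow_succ (hN : 2 ≤ N) (hH : IsH 1 (1 / N) H) (j : ℕ) :
    lap 1 (1 / N) H (geom (1 / N) ^ (j + 1)) *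
        (1 + PowerSeries.C ((j + 1) * (1 - 1 / N) / N : ℂ) * X) =
      lap 1 (1 / N) H (geom (1 / N) ^ j) * (1 + PowerSeries.C ((j + 1) / N : ℂ) * X) := by
  have hN0 : (N : ℂ) ≠ 0 := by exact_mod_cast (by omega : N ≠ 0)
  have h1 := mul_geom (1 / N)
  set I := geom (1 / N) with hI
  have e1 : I ^ (j + 1) = I ^ j - PowerSeries.C (1 / N : ℂ) * (X * I ^ (j + 1)) := by
    linear_combination I ^ j * h1
  have e2 : curveU 1 (1 / N) * derivative ℂ (I ^ (j + 1)) =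
      -(PowerSeries.C ((j + 1 : ℕ) * (1 / N) : ℂ) * ((1 + X) * I ^ (j + 1))) := by
    rw [hI, derivative_geom_pow, ← hI, curveU, map_one, one_mul]
    linear_combination (-PowerSeries.C ((j + 1 : ℕ) * (1 / N) : ℂ) * (1 + X) * I ^ (j + 1)) * h1
  have e3 := congrArg (lap 1 (1 / N) H) e1
  rw [map_sub, lap_C_mul, hH.lap_X_mul, e2, map_neg, lap_C_mul, hI, one_add_X_mul_geom_pow hN,
    ← hI, map_sub, lap_C_mul, lap_C_mul] at e3
  set D := lap 1 (1 / N) H (I ^ j)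
  set D' := lap 1 (1 / N) H (I ^ (j + 1))
  have f1 : PowerSeries.C ((j + 1) / N : ℂ) = PowerSeries.C (1 / N : ℂ) *
      PowerSeries.C ((j + 1 : ℕ) * (1 / N) : ℂ) * PowerSeries.C (N : ℂ) := by
    rw [← map_mul, ← map_mul]
    congr 1
    push_cast
    field_simp
  have f2 : PowerSeries.C ((j + 1) * (1 - 1 / N) / N : ℂ) = PowerSeries.C (1 / N : ℂ) *
      PowerSeries.C ((j + 1 : ℕ) * (1 / N) : ℂ) * PowerSeries.C (N - 1 : ℂ) := by
    rw [← map_mul, ← map_mul]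
    congr 1
    push_cast
    field_simp
  rw [f1, f2]
  linear_combination e3

lemma lap_geom_pow (hN : 2 ≤ N) (hH : IsH 1 (1 / N) H) (n : ℕ) :
    lap 1 (1 / N) H (geom (1 / N) ^ n) *
        ∏ j ∈ range n, (1 + PowerSeries.C ((j + 1) * (1 - 1 / N) / N : ℂ) * X) =
      rhoH H * ∏ j ∈ range n, (1 + PowerSeries.C ((j + 1) / N : ℂ) * X) := by
  induction n with
  | zero => rw [pow_zero, hH.lap_one, prod_range_zero, prod_range_zero]
  | succ n ih =>
    rw [prod_range_succ, prod_range_succ, ← mul_assoc, ← mul_assoc, ← ih]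
    linear_combination (∏ j ∈ range n, (1 + PowerSeries.C ((j + 1) * (1 - 1 / N) / N : ℂ) * X)) *
      lap_geom_pow_succ hN hH n

/-- The exponential `e^{-p x}` on the curve is rational. -/
lemma pexp_x (hN : 2 ≤ N) (hH : IsH 1 (1 / N) H) :
    pexp ((-(1 - 1 / N : ℂ)) • ((1 / 2 : ℂ) • (X ^ 2 * H⁻¹ ^ 2))) =
      (1 + X) * geom (1 / N) ^ N := by
  have hN0 : (N : ℂ) ≠ 0 := by exact_mod_cast (by omega : N ≠ 0)
  have h0 : constantCoeff ((-(1 - 1 / N : ℂ)) • ((1 / 2 : ℂ) • (X ^ 2 * H⁻¹ ^ 2))) = 0 := by simp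
  have h1 := mul_geom (1 / N)
  -- The logarithmic derivatives agree: 1/(1+z) - 1/(1+z/N) = -(1-1/N) z / ((1+z)(1+z/N)).
  refine eq_of_derivative_eq_mul (derivative_pexp h0) ?_ (by simp [geom]) ?_
  · rw [Derivation.map_smul, hH.derivative_x, Derivation.leibniz, derivative_geom_pow,
      PowerSeries.smul_eq_C_mul, mul_one_div_cancel hN0]
    have h2 := curveU_mul_inv 1 (1 / N)
    set V := (curveU 1 (1 / N))⁻¹
    rw [curveU, map_one, one_mul] at h2
    set I := geom (1 / N)
    have h3 : V * (1 + X) = I := by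
      linear_combination I * h2 - V * (1 + X) * h1
    simp only [map_add, derivative_one, derivative_X, smul_eq_mul, map_neg, map_sub, map_one]
    linear_combination (-(I ^ N)) * h1 + (1 - PowerSeries.C (1 / N : ℂ)) * X * I ^ N * h3
  · rw [constantCoeff_pexp h0]
    simp [geom]

/-- The functional equation of the asymptotic expansion. -/
lemma rhoH_functional (hN : 2 ≤ N) (hH : IsH 1 (1 / N) H) :
    rhoH H * ∏ j ∈ range N, (1 + PowerSeries.C ((j + 1) / N : ℂ) * X) =
      (1 + X) * pexp ((-(1 / 2) : ℂ) • lg (1 - 1 / N)) * mob (1 - 1 / N) (rhoH H) *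
        ∏ j ∈ range N, (1 + PowerSeries.C ((j + 1) * (1 - 1 / N) / N : ℂ) * X) := by
  have hN0 : (N : ℂ) ≠ 0 := by exact_mod_cast (by omega : N ≠ 0)
  have h1 := hH.lap_pexp_mul (1 - 1 / N) 1
  obtain ⟨M, rfl⟩ : ∃ M, N = M + 1 := ⟨N - 1, by omega⟩
  rw [mul_one, pexp_x hN hH, hH.lap_one, one_add_X_mul_geom_pow hN, map_sub, lap_C_mul,
    lap_C_mul] at h1
  have h2 := lap_geom_pow_succ hN hH M
  rw [← lap_geom_pow hN hH, mul_assoc (1 + X), ← h1]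
  -- In the last step j = M of the recursion the factor (j+1)/N is 1; this produces the factor 1 + X
  -- of the functional equation.
  have e1 : ((M : ℂ) + 1) / ((M + 1 : ℕ) : ℂ) = 1 := by
    push_cast at hN0 ⊢
    exact div_self hN0
  have e2 : ((M : ℂ) + 1) * (1 - 1 / (M + 1 : ℕ)) / ((M + 1 : ℕ) : ℂ) = 1 - 1 / (M + 1 : ℕ) := by
    rw [mul_div_right_comm, e1, one_mul]
  rw [e1, e2, map_one, one_mul] at h2
  have e3 : (PowerSeries.C ((M + 1 : ℕ) : ℂ) : ℂ⟦X⟧) * PowerSeries.C (1 - 1 / (M + 1 : ℕ) : ℂ) =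
      PowerSeries.C ((M + 1 : ℕ) - 1 : ℂ) := by
    rw [← map_mul]
    congr 1
    field_simp
  have e4 : (PowerSeries.C ((M + 1 : ℕ) - 1 : ℂ) : ℂ⟦X⟧) = PowerSeries.C ((M + 1 : ℕ) : ℂ) - 1 := by
    rw [map_sub, map_one]
  set D := lap 1 (1 / ((M + 1 : ℕ) : ℂ)) H (geom (1 / (M + 1 : ℕ)) ^ M)
  set D' := lap 1 (1 / ((M + 1 : ℕ) : ℂ)) H (geom (1 / (M + 1 : ℕ)) ^ (M + 1))
  have e5 : D' = (1 + X) * (PowerSeries.C ((M + 1 : ℕ) : ℂ) * D -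
      PowerSeries.C ((M + 1 : ℕ) - 1 : ℂ) * D') := by
    linear_combination PowerSeries.C ((M + 1 : ℕ) : ℂ) * h2 - X * D' * e3 + D' * e4
  rw [← e5]

/-- Both sides solve the same functional equation, so their quotient `u` is fixed by `mob (1 - 1/N)`
and hence constant; its constant term is 1. -/
theorem rhoH_reciprocal (hN : 2 ≤ N) (hH : IsH 1 (1 / N) H) :
    rhoH H = pexp (expnt (1 / N) (1 - 1 / N)) := by
  have hp0 : (1 - 1 / N : ℂ) ≠ 0 := by
    have hN0 : (N : ℂ) ≠ 0 := by exact_mod_cast (by omega : N ≠ 0)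
    have hN1 : (N : ℂ) ≠ 1 := by exact_mod_cast (by omega : N ≠ 1)
    rw [sub_ne_zero, ne_eq, eq_div_iff hN0, one_mul]
    exact hN1
  have h0 := constantCoeff_expnt (1 / N) (1 - 1 / N)
  have hprod : ∀ c : ℕ → ℂ, ∏ j ∈ range N, (1 + PowerSeries.C (c j) * X) =
      pexp (∑ j ∈ range N, lg (c j)) := by
    intro c
    generalize N = n
    induction n with
    | zero => simp [pexp_zero]
    | succ n ih =>
      rw [prod_range_succ, sum_range_succ, pexp_add (by simp [constantCoeff_lg])
        (constantCoeff_lg _), ih, pexp_lg]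
  have h1 := rhoH_functional hN hH
  set r := expnt (1 / N) (1 - 1 / N) with hr
  set A := ∑ j ∈ range N, lg ((j + 1 : ℂ) / N) with hA
  set B := ∑ j ∈ range N, lg ((j + 1) * (1 - 1 / N) / N : ℂ) with hB
  have hA0 : constantCoeff A = 0 := by simp [hA, constantCoeff_lg]
  have hB0 : constantCoeff B = 0 := by simp [hB, constantCoeff_lg]
  have hl0 : constantCoeff ((-(1 / 2) : ℂ) • lg (1 - 1 / N)) = 0 := by simp [constantCoeff_lg]
  have hX : (1 + X : ℂ⟦X⟧) = pexp (lg 1) := by rw [pexp_lg, map_one, one_mul]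
  rw [hprod, hprod, ← hA, ← hB, hX] at h1
  have h2 : pexp r * pexp A = pexp (lg 1) * pexp ((-(1 / 2) : ℂ) • lg (1 - 1 / N)) *
      mob (1 - 1 / N) (pexp r) * pexp B := by
    have hm0 : constantCoeff (mob (1 - 1 / N) r) = 0 := by rw [constantCoeff_mob, h0]
    rw [mob_pexp hp0 h0, ← pexp_add h0 hA0, ← pexp_add (constantCoeff_lg _) hl0,
      ← pexp_add (by simp [constantCoeff_lg]) hm0,
      ← pexp_add (by rw [map_add, map_add, hm0, hl0, constantCoeff_lg]; simp) hB0]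
    congr 1
    have := expnt_sub_mob hN
    rw [sum_sub_distrib, ← hr, ← hA, ← hB] at this
    linear_combination this
  set E := pexp (lg 1) * pexp ((-(1 / 2) : ℂ) • lg (1 - 1 / N)) * pexp B with hE
  set u := rhoH H * pexp (-r) with hu
  have hur : u * pexp r = rhoH H := by
    rw [hu, mul_assoc, mul_comm (pexp (-r)), pexp_mul_pexp_neg h0, mul_one]
  have h3 : mob (1 - 1 / N) u = u := by
    have hc : ∀ v : ℂ⟦X⟧, constantCoeff v = 1 → v ≠ 0 := by
      rintro v hv rfl
      simp at hv
    have h4 : E * mob (1 - 1 / N) (pexp r) ≠ 0 := by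
      apply hc
      rw [map_mul, constantCoeff_mob, hE, map_mul, map_mul, constantCoeff_pexp h0,
        constantCoeff_pexp hl0, constantCoeff_pexp hB0, constantCoeff_pexp (constantCoeff_lg 1)]
      norm_num
    apply mul_left_cancel₀ h4
    have h5 := mob_mul (1 - 1 / N) u (pexp r)
    rw [hur] at h5
    rw [← hur, mob_mul] at h1
    linear_combination u * h2 - h1
  have h6 := eq_C_of_mob_eq hp0 h3
  have h7 : constantCoeff u = 1 := by
    rw [hu, map_mul, constantCoeff_pexp (by simp [h0]), mul_one,
      ← coeff_zero_eq_constantCoeff_apply, coeff_zero_rhoH]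
  rw [h7, map_one] at h6
  rw [← hur, h6, one_mul]

end Reciprocal


/-! ### Existence and uniqueness of the curve -/

/-- The series `2 x / z²`. -/
def curveE (α β : ℂ) : ℂ⟦X⟧ :=
  PowerSeries.mk fun n => 2 / ((n : ℂ) + 2) * coeff n (curveU α β)⁻¹

lemma constantCoeff_curveE (α β : ℂ) : constantCoeff (curveE α β) = 1 := by
  rw [← coeff_zero_eq_constantCoeff_apply, curveE, coeff_mk, coeff_zero_eq_constantCoeff_apply,
    constantCoeff_inv, constantCoeff_curveU]
  simp

lemma eq_curveE_iff {α β : ℂ} {E : ℂ⟦X⟧} :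
    2 * E + X * derivative ℂ E = 2 * (curveU α β)⁻¹ ↔ E = curveE α β := by
  have h2 : ∀ g : ℂ⟦X⟧, 2 * g = PowerSeries.C (2 : ℂ) * g := fun g => rfl
  rw [PowerSeries.ext_iff, PowerSeries.ext_iff]
  refine forall_congr' fun n => ?_
  have hn : ((n : ℂ) + 2) ≠ 0 := by exact_mod_cast (n + 1).succ_ne_zero
  rw [map_add, h2, h2, coeff_C_mul, coeff_C_mul, coeff_X_mul_derivative, curveE, coeff_mk,
    div_mul_eq_mul_div, eq_div_iff hn]
  constructor <;> intro h <;> linear_combination h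

/-- The solution `z / f` of the equation of the curve. -/
def curveH (α β : ℂ) : ℂ⟦X⟧ := pexp ((-(1 / 2) : ℂ) • logOf (curveE α β))

lemma constantCoeff_half_logOf (α β : ℂ) :
    constantCoeff ((-(1 / 2) : ℂ) • logOf (curveE α β)) = 0 := by
  rw [constantCoeff_smul, constantCoeff_logOf (constantCoeff_curveE α β), smul_zero]

lemma constantCoeff_curveH (α β : ℂ) : constantCoeff (curveH α β) = 1 :=
  constantCoeff_pexp (constantCoeff_half_logOf α β)

lemma curveH_sq_mul (α β : ℂ) : curveH α β ^ 2 * curveE α β = 1 := by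
  have h1 := constantCoeff_half_logOf α β
  have h2 := constantCoeff_logOf (constantCoeff_curveE α β)
  conv_lhs => rw [← pexp_logOf (constantCoeff_curveE α β)]
  rw [curveH, sq, ← pexp_add h1 h1, ← pexp_add (by simp [h2]) h2, ← pexp_zero]
  congr 1
  module

lemma isH_curveH (α β : ℂ) : IsH α β (curveH α β) where
  const := constantCoeff_curveH α β
  eqn := by
    set H := curveH α β with hH
    have h1 : H ^ 2 * curveE α β = 1 := curveH_sq_mul α β
    have h2 := eq_curveE_iff.mpr (rfl : curveE α β = curveE α β)
    have h3 := congrArg (derivative ℂ) h1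
    rw [Derivation.leibniz, derivative_pow, derivative_one] at h3
    simp only [Nat.cast_ofNat, smul_eq_mul, Nat.add_one_sub_one, pow_one] at h3
    have h4 := curveU_mul_inv α β
    set E := curveE α β
    set V := (curveU α β)⁻¹
    set U := curveU α β
    have hH0 : H ≠ 0 := by
      intro h
      have := constantCoeff_curveH α β
      rw [← hH, h, map_zero] at this
      exact zero_ne_one this
    have h20 : (2 : ℂ⟦X⟧) ≠ 0 := by
      intro h
      have h' := congrArg (constantCoeff (R := ℂ)) h
      rw [map_ofNat, map_zero] at h'
      exact two_ne_zero h'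
    have h5 : 2 * E * (H - X * derivative ℂ H) = 2 * H * V := by
      apply mul_left_cancel₀ hH0
      linear_combination H ^ 2 * h2 - X * h3
    have h6 : H - X * derivative ℂ H = H ^ 3 * V := by
      apply mul_left_cancel₀ h20
      linear_combination H ^ 2 * h5 - 2 * (H - X * derivative ℂ H) * h1
    rw [h6]
    linear_combination (-H ^ 3) * h4

/-- In terms of E = H⁻² = 2x/z² the cubic equation becomes the linear equation 2E + zE' = 2/U, which
determines E coefficientwise; the constant term fixes the sign of the square root. -/
lemma IsH.eq_curveH {α β : ℂ} {H : ℂ⟦X⟧} (hH : IsH α β H) : H = curveH α β := by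
  have h1 : H * H⁻¹ = 1 := PowerSeries.mul_inv_cancel H (by rw [hH.const]; exact one_ne_zero)
  have h2 : H⁻¹ ^ 2 = curveE α β := by
    rw [← eq_curveE_iff, derivative_pow, derivative_inv']
    simp only [Nat.cast_ofNat, Nat.add_one_sub_one, pow_one]
    linear_combination (-2 * H⁻¹ ^ 3) * hH.cube_mul_inv +
      2 * (curveU α β)⁻¹ * (H⁻¹ ^ 2 * H ^ 2 + H⁻¹ * H + 1) * h1 + 2 * H⁻¹ ^ 2 * (- h1)
  apply eq_of_sq_eq_sq hH.const (constantCoeff_curveH α β)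
  have h3 := curveH_sq_mul α β
  rw [← h2] at h3
  linear_combination (-H ^ 2) * h3 + curveH α β ^ 2 * (H * H⁻¹ + 1) * h1

/-! ### Families depending polynomially on a parameter -/

/-- The coefficients depend polynomially on the parameter. -/
def PolyFam (F : ℂ → ℂ⟦X⟧) : Prop :=
  ∀ n, ∃ P : Polynomial ℂ, ∀ b, coeff n (F b) = P.eval b

namespace PolyFam

variable {F G : ℂ → ℂ⟦X⟧}

lemma of_coeff (P : ℕ → Polynomial ℂ) (h : ∀ n b, coeff n (F b) = (P n).eval b) : PolyFam F :=
  fun n => ⟨P n, h n⟩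

lemma const (g : ℂ⟦X⟧) : PolyFam fun _ => g :=
  of_coeff (fun n => Polynomial.C (coeff n g)) fun n b => by simp

lemma mul (hF : PolyFam F) (hG : PolyFam G) : PolyFam fun b => F b * G b := by
  choose P hP using hF
  choose Q hQ using hG
  refine of_coeff (fun n => ∑ x ∈ antidiagonal n, P x.1 * Q x.2) fun n b => ?_
  rw [coeff_mul, Polynomial.eval_finsetSum]
  exact sum_congr rfl fun x _ => by rw [hP, hQ, Polynomial.eval_mul]

lemma pow (hF : PolyFam F) (k : ℕ) : PolyFam fun b => F b ^ k := by
  induction k with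
  | zero => simpa using const 1
  | succ k ih => simpa only [pow_succ] using ih.mul hF

lemma scale (hF : PolyFam F) (c : ℕ → ℂ) :
    PolyFam fun b => PowerSeries.mk fun n => c n * coeff n (F b) := by
  choose P hP using hF
  exact of_coeff (fun n => Polynomial.C (c n) * P n) fun n b => by
    rw [coeff_mk, Polynomial.eval_mul, Polynomial.eval_C, hP]

lemma sub (hF : PolyFam F) (hG : PolyFam G) : PolyFam fun b => F b - G b := by
  choose P hP using hF
  choose Q hQ using hG
  exact of_coeff (fun n => P n - Q n) fun n b => by
    rw [map_sub, Polynomial.eval_sub, hP, hQ]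

lemma subst (hF : PolyFam F) (h0 : ∀ b, constantCoeff (F b) = 0) (g : ℂ⟦X⟧) :
    PolyFam fun b => g.subst (F b) := by
  choose P hP using fun k => hF.pow k
  refine of_coeff (fun n => ∑ k ∈ range (n + 1), Polynomial.C (coeff k g) * P k n) fun n b => ?_
  rw [coeff_subst' (hasSubst_of (h0 b)), finsum_eq_sum_of_support_subset (s := range (n + 1)),
    Polynomial.eval_finsetSum]
  · refine sum_congr rfl fun k _ => ?_
    rw [Polynomial.eval_mul, Polynomial.eval_C, smul_eq_mul, hP]
  · intro k hk
    rw [Function.mem_support] at hk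
    by_contra hkn
    apply hk
    have : n < k := by simpa using hkn
    rw [coeff_of_lt_order (φ := F b ^ k), smul_zero]
    refine lt_of_lt_of_le ?_ (le_order_pow_of_constantCoeff_eq_zero k (h0 b))
    exact_mod_cast this

/-- Polynomial families that agree at infinitely many points agree. -/
lemma ext_of_infinite (hF : PolyFam F) (hG : PolyFam G) {s : Set ℂ} (hs : s.Infinite)
    (h : ∀ b ∈ s, F b = G b) (b : ℂ) : F b = G b := by
  ext n
  obtain ⟨P, hP⟩ := hF n
  obtain ⟨Q, hQ⟩ := hG n
  have : P = Q := by
    apply Polynomial.eq_of_infinite_eval_eq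
    refine hs.mono fun c hc => ?_
    rw [Set.mem_ofPred_eq, ← hP, ← hQ, h c hc]
  rw [hP, hQ, this]

end PolyFam

lemma coeff_geom (c : ℂ) (n : ℕ) : coeff n (geom c) = (-c) ^ n := by
  have h1 : (1 + PowerSeries.C c * X) * PowerSeries.mk (fun n => (-c) ^ n) = 1 := by
    ext n
    rw [add_mul, one_mul, map_add, mul_assoc, coeff_C_mul]
    cases n with
    | zero => simp
    | succ n => rw [coeff_succ_X_mul, coeff_mk, coeff_mk, coeff_one, if_neg n.succ_ne_zero]; ring
  have h2 : PowerSeries.mk (fun n => (-c) ^ n) = geom c := by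
    linear_combination (-PowerSeries.mk (fun n => (-c) ^ n)) * mul_geom c + geom c * h1
  rw [← h2, coeff_mk]

lemma curveU_inv (α β : ℂ) : (curveU α β)⁻¹ = geom α * geom β := by
  have h := curveU_mul_inv α β
  have h1 : curveU α β * (geom α * geom β) = 1 := by
    rw [curveU]
    linear_combination (1 + PowerSeries.C β * X) * geom β * mul_geom α + mul_geom β
  linear_combination (-(curveU α β)⁻¹) * h1 + geom α * geom β * h

lemma polyFam_curveH : PolyFam fun b => curveH 1 b := by
  have h1 : PolyFam fun b => (curveU 1 b)⁻¹ := by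
    simp only [curveU_inv]
    refine (PolyFam.const _).mul ?_
    exact PolyFam.of_coeff (fun n => (-Polynomial.X) ^ n) fun n b => by
      rw [coeff_geom]; simp
  have h2 : PolyFam fun b => curveE 1 b := h1.scale fun n => 2 / ((n : ℂ) + 2)
  have h3 : PolyFam fun b => logOf (curveE 1 b) :=
    (h2.sub (PolyFam.const 1)).subst (fun b => by simp [constantCoeff_curveE]) _
  have h4 : PolyFam fun b => (-(1 / 2) : ℂ) • logOf (curveE 1 b) := by
    convert h3.scale fun _ => (-(1 / 2) : ℂ) using 2 with b
    ext n
    rw [PowerSeries.coeff_smul, coeff_mk, smul_eq_mul]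
  exact h4.subst (fun b => constantCoeff_half_logOf 1 b) _

lemma polyFam_rhoH : PolyFam fun b => rhoH (curveH 1 b) := by
  intro n
  cases n with
  | zero => exact ⟨1, fun b => by rw [coeff_zero_rhoH]; simp⟩
  | succ n =>
    obtain ⟨P, hP⟩ := polyFam_curveH.pow (2 * n + 1) (2 * n + 2)
    exact ⟨Polynomial.C (-dfac n) * P, fun b => by
      rw [coeff_succ_rhoH, Polynomial.eval_mul, Polynomial.eval_C, hP]⟩

lemma polyFam_pexp_expnt : PolyFam fun b => pexp (expnt b (1 - b)) := by
  refine PolyFam.subst ?_ (fun b => constantCoeff_expnt b (1 - b)) _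
  refine PolyFam.of_coeff (fun n => Polynomial.C (coeff n stirling) *
    ((1 - Polynomial.X) ^ n + Polynomial.X ^ n - ((1 - Polynomial.X) * Polynomial.X) ^ n))
    fun n b => ?_
  rw [expnt_eq, sub_add_cancel, div_one]
  simp only [map_sub, map_add, coeff_rescale, Polynomial.eval_mul, Polynomial.eval_C,
    Polynomial.eval_add, Polynomial.eval_sub, Polynomial.eval_pow, Polynomial.eval_X,
    Polynomial.eval_one]
  ring

/-- Every coefficient of either side is a polynomial in b, and the points 1/N with N ≥ 2 are
infinite in number. -/
lemma rhoH_curveH_one (b : ℂ) : rhoH (curveH 1 b) = pexp (expnt b (1 - b)) := by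
  refine polyFam_rhoH.ext_of_infinite polyFam_pexp_expnt
    (s := Set.range fun N : ℕ => (1 / ((N + 2 : ℕ) : ℂ))) ?_ ?_ b
  · apply Set.infinite_range_of_injective
    intro N M h
    simp only [one_div, inv_inj] at h
    have : N + 2 = M + 2 := by exact_mod_cast h
    omega
  · rintro _ ⟨N, rfl⟩
    exact rhoH_reciprocal (by omega) (isH_curveH _ _)

lemma derivative_rescale (c : ℂ) (g : ℂ⟦X⟧) :
    X * derivative ℂ (rescale c g) = rescale c (X * derivative ℂ g) := by
  ext n
  rw [coeff_X_mul_derivative, coeff_rescale, coeff_rescale, coeff_X_mul_derivative]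
  ring

lemma rescale_curveU (c α β : ℂ) : rescale c (curveU α β) = curveU (c * α) (c * β) := by
  have h : ∀ a : ℂ, rescale c (1 + PowerSeries.C a * X) = 1 + PowerSeries.C (c * a) * X := by
    intro a
    have e : rescale c (PowerSeries.C a) = PowerSeries.C a := by
      ext n
      rw [coeff_rescale, coeff_C]
      split_ifs with hn <;> simp [hn]
    rw [map_add, map_one, map_mul, e, rescale_X, map_mul]
    ring
  rw [curveU, map_mul, h, h, curveU]

lemma IsH.rescale {α β : ℂ} {H : ℂ⟦X⟧} (hH : IsH α β H) (c : ℂ) :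
    IsH (c * α) (c * β) (rescale c H) where
  const := by
    rw [← coeff_zero_eq_constantCoeff_apply, coeff_rescale, coeff_zero_eq_constantCoeff_apply,
      hH.const, pow_zero, one_mul]
  eqn := by
    rw [derivative_rescale, ← rescale_curveU, ← map_sub, ← map_mul, ← hH.eqn, map_pow]

lemma rhoH_rescale (c : ℂ) (H : ℂ⟦X⟧) :
    rhoH (PowerSeries.rescale c H) = PowerSeries.rescale (c ^ 2) (rhoH H) := by
  ext n
  rw [coeff_rescale]
  cases n with
  | zero => rw [coeff_zero_rhoH, coeff_zero_rhoH, pow_zero, one_mul]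
  | succ n =>
    rw [coeff_succ_rhoH, coeff_succ_rhoH, ← map_pow, coeff_rescale]
    ring

/-- The asymptotic expansion attached to the curve. -/
theorem IsH.rhoH_eq {α β : ℂ} (hα : α ≠ 0) {H : ℂ⟦X⟧} (hH : IsH α β H) :
    rhoH H = pexp (expnt (α * β) (α * (α - β))) := by
  -- Homogeneity: rescaling z by α reduces to first parameter 1. Only even coefficients of powers of
  -- H enter `rhoH`, so it is rescaled by α².
  have h1 : H = PowerSeries.rescale α (curveH 1 (β / α)) := by
    have := (isH_curveH 1 (β / α)).rescale α
    rw [mul_one, mul_div_cancel₀ _ hα] at this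
    rw [hH.eq_curveH, this.eq_curveH]
  rw [h1, rhoH_rescale, rhoH_curveH_one, rescale_pexp _ (constantCoeff_expnt _ _)]
  congr 1
  rw [expnt_eq, expnt_eq, map_sub, map_add, rescale_rescale, rescale_rescale, rescale_rescale]
  congr 3
  · congr 1
    field_simp
  · congr 1
    field_simp
  · have e : α * (α - β) + α * β = α ^ 2 := by ring
    rw [e, sub_add_cancel, div_one]
    field_simp


/-! ### Linear forms -/

/-- Finite linear forms, in terms of the basis `e_i = i t_i`. -/
abbrev LinForm : Type := ℕ →₀ ℂ

/-- The basis vector `e_i`. -/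
def vecE (i : ℕ) : LinForm := Finsupp.single i 1

/-- The linear form as a function of the `t_i`. -/
def LinForm.toFun : LinForm →ₗ[ℂ] Funt :=
  Finsupp.linearCombination ℂ fun i : ℕ => (i : ℂ) • tVar i

lemma toFun_e (i : ℕ) : LinForm.toFun (vecE i) = (i : ℂ) • tVar i := by
  rw [LinForm.toFun, vecE, Finsupp.linearCombination_single, one_smul]

/-- The linear functional with prescribed values on the basis. -/
def LinForm.functional (c : ℕ → ℂ) : LinForm →ₗ[ℂ] ℂ := Finsupp.linearCombination ℂ c

lemma functional_e (c : ℕ → ℂ) (i : ℕ) : LinForm.functional c (vecE i) = c i := by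
  rw [LinForm.functional, vecE, Finsupp.linearCombination_single, one_smul]

/-- The recursion operator of the change of variables. -/
def opW (π σ : ℂ) : LinForm →ₗ[ℂ] LinForm :=
  Finsupp.linearCombination ℂ fun i : ℕ => (i : ℂ) • (π • vecE i + σ • vecE (i + 1) + vecE (i + 2))

lemma opW_e (π σ : ℂ) (i : ℕ) :
    opW π σ (vecE i) = (i : ℂ) • (π • vecE i + σ • vecE (i + 1) + vecE (i + 2)) := by
  rw [opW, vecE, Finsupp.linearCombination_single, one_smul]; rfl

/-- The negative part of `z⁻ⁱ g`. -/
def negPart (i : ℕ) (g : ℂ⟦X⟧) : LinForm := ∑ n ∈ range i, coeff n g • vecE (i - n)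

lemma functional_negPart (c : ℕ → ℂ) (i : ℕ) (g : ℂ⟦X⟧) :
    LinForm.functional c (negPart i g) = ∑ n ∈ range i, coeff n g * c (i - n) := by
  rw [negPart, map_sum]
  exact sum_congr rfl fun n _ => by rw [map_smul, functional_e, smul_eq_mul]

lemma linForm_ext {M : Type*} [AddCommGroup M] [Module ℂ M] {F G : LinForm →ₗ[ℂ] M}
    (h : ∀ i, F (vecE i) = G (vecE i)) : F = G :=
  Finsupp.lhom_ext' fun i => LinearMap.ext_ring (h i)

lemma curveU_eq (α β : ℂ) :
    curveU α β = 1 + PowerSeries.C (α + β) * X + PowerSeries.C (α * β) * X ^ 2 := by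
  rw [curveU, map_add, map_mul]
  ring

lemma negPart_add (i : ℕ) (g h : ℂ⟦X⟧) : negPart i (g + h) = negPart i g + negPart i h := by
  simp only [negPart, map_add, add_smul, sum_add_distrib]

lemma negPart_C_mul (i : ℕ) (c : ℂ) (g : ℂ⟦X⟧) :
    negPart i (PowerSeries.C c * g) = c • negPart i g := by
  simp only [negPart, coeff_C_mul, mul_smul, smul_sum]

lemma negPart_X_mul (i : ℕ) (g : ℂ⟦X⟧) : negPart (i + 1) (X * g) = negPart i g := by
  rw [negPart, sum_range_succ', negPart, coeff_zero_X_mul, zero_smul, add_zero]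
  refine sum_congr rfl fun n _ => ?_
  rw [coeff_succ_X_mul, Nat.add_sub_add_right]

/-- With e_i standing for z⁻ⁱ, `opW` is -z⁻² U z ∂/∂z = -d/dx. Taking negative parts first omits the
term of degree 1, which this operator would send to a multiple of z⁻¹; the summand with e_1
compensates for it. -/
lemma opW_negPart (α β : ℂ) (i : ℕ) (g : ℂ⟦X⟧) : opW (α * β) (α + β) (negPart i g) =
    negPart (i + 2) (curveU α β * (PowerSeries.C (i : ℂ) * g - X * derivative ℂ g)) +
      coeff (i + 1) g • vecE 1 := by
  set w : ℂ⟦X⟧ := PowerSeries.C (i : ℂ) * g - X * derivative ℂ g with hw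
  have hwn : ∀ n, coeff n w = ((i : ℂ) - n) * coeff n g := by
    intro n
    rw [hw, map_sub, coeff_C_mul, coeff_X_mul_derivative]
    ring
  have h1 : curveU α β * w = w + PowerSeries.C (α + β) * (X * w) +
      PowerSeries.C (α * β) * (X * (X * w)) := by
    rw [curveU_eq]
    ring
  have h2 : negPart (i + 2) w =
      ∑ n ∈ range i, (((i : ℂ) - n) * coeff n g) • vecE (i - n + 2) - coeff (i + 1) g • vecE 1 := by
    rw [negPart, sum_range_succ, sum_range_succ, hwn, hwn, sub_self, zero_mul, zero_smul, add_zero]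
    rw [show i + 2 - (i + 1) = 1 by omega, sub_eq_add_neg (∑ n ∈ range i, _), ← neg_smul]
    congr 1
    · refine sum_congr rfl fun n hn => ?_
      rw [mem_range] at hn
      rw [hwn, show i + 2 - n = i - n + 2 by omega]
    · congr 1
      push_cast
      ring
  have h3 : negPart (i + 1) w = ∑ n ∈ range i, (((i : ℂ) - n) * coeff n g) • vecE (i - n + 1) := by
    rw [negPart, sum_range_succ, hwn, sub_self, zero_mul, zero_smul, add_zero]
    refine sum_congr rfl fun n hn => ?_
    rw [mem_range] at hn
    rw [hwn, show i + 1 - n = i - n + 1 by omega]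
  have h4 : negPart i w = ∑ n ∈ range i, (((i : ℂ) - n) * coeff n g) • vecE (i - n) := by
    simp only [negPart, hwn]
  rw [h1, negPart_add, negPart_add, negPart_C_mul, negPart_C_mul, negPart_X_mul,
    negPart_X_mul, negPart_X_mul, h2, h3, h4, negPart, map_sum, smul_sum, smul_sum, sub_add_eq_add_sub, sub_add_eq_add_sub, sub_add_cancel,
    ← sum_add_distrib, ← sum_add_distrib]
  refine sum_congr rfl fun n hn => ?_
  rw [mem_range] at hn
  rw [map_smul, opW_e, Nat.cast_sub hn.le]
  module

/-- The linear forms `T_k` of the change of variables. -/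
def formT (π σ : ℂ) (k : ℕ) : LinForm := (opW π σ)^[k] (vecE 1)

lemma formT_succ (π σ : ℂ) (k : ℕ) : formT π σ (k + 1) = opW π σ (formT π σ k) :=
  Function.iterate_succ_apply' _ _ _

/-- The linear forms that are the means of the Virasoro operator. -/
def formM (H : ℂ⟦X⟧) (j : ℕ) : LinForm := dfac j • negPart (2 * j + 1) (H ^ (2 * j + 1))

namespace IsH

variable {α β : ℂ} {H : ℂ⟦X⟧}

/-- Since f df = dx, the operator -d/dx maps f^{-(j+1)} to (j+1) f^{-(j+3)}; here this is written in
terms of H = z/f. -/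
lemma pow_recursion (hH : IsH α β H) (j : ℕ) :
    PowerSeries.C ((j : ℂ) + 1) * H ^ (j + 3) = curveU α β *
      (PowerSeries.C ((j : ℂ) + 1) * H ^ (j + 1) - X * derivative ℂ (H ^ (j + 1))) := by
  rw [pow_add H j 3, hH.eqn, derivative_pow, Nat.add_sub_cancel, map_add, map_natCast, map_one]
  push_cast
  ring

/-- The means are truncations of (-d/dx)^j f⁻¹. The defect of truncation is a multiple of e_1, and
`rhoH` is defined so as to collect these multiples. -/
lemma formM_succ (hH : IsH α β H) (j : ℕ) : formM H (j + 1) =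
    opW (α * β) (α + β) (formM H j) + coeff (j + 1) (rhoH H) • vecE 1 := by
  have h1 := opW_negPart α β (2 * j + 1) (H ^ (2 * j + 1))
  have h2 := hH.pow_recursion (2 * j)
  have h3 : ((2 * j + 1 : ℕ) : ℂ) = ((2 * j : ℕ) : ℂ) + 1 := by push_cast; ring
  rw [h3, ← h2, negPart_C_mul] at h1
  rw [formM, formM, map_smul, h1, coeff_succ_rhoH, dfac_succ]
  rw [show 2 * (j + 1) + 1 = 2 * j + 3 by ring]
  push_cast
  module

lemma formM_eq (hH : IsH α β H) (j : ℕ) : formM H j =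
    ∑ m ∈ range (j + 1), coeff m (rhoH H) • formT (α * β) (α + β) (j - m) := by
  induction j with
  | zero =>
    rw [zero_add, sum_range_one, coeff_zero_rhoH, formM, dfac_zero, negPart, mul_zero, zero_add,
      sum_range_one, pow_one, coeff_zero_eq_constantCoeff_apply, hH.const, one_smul, one_smul, one_smul]
    rfl
  | succ j ih =>
    rw [hH.formM_succ, ih, map_sum, sum_range_succ _ (j + 1), Nat.sub_self]
    congr 1
    refine sum_congr rfl fun m hm => ?_
    rw [mem_range] at hm
    rw [map_smul, ← formT_succ, show j - m + 1 = j + 1 - m by omega]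

/-- The functional computing covariances. -/
def covFun (H : ℂ⟦X⟧) (j : ℕ) : LinForm →ₗ[ℂ] ℂ :=
  LinForm.functional fun r => dfac j * (r * coeff (2 * j + 1 + r) (H ^ (2 * j + 1)))

/-- Up to sign, `covFun H j` sends w to the residue of F dw, where F = (2j-1)!! f^{-(2j+1)}.
Integration by parts moves -d/dx from w to F, raising j by one. -/
lemma covFun_opW (hH : IsH α β H) (j : ℕ) (w : LinForm) :
    covFun H j (opW (α * β) (α + β) w) = -covFun H (j + 1) w := by
  have : covFun H j ∘ₗ opW (α * β) (α + β) = -covFun H (j + 1) := by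
    refine linForm_ext fun r => ?_
    rw [LinearMap.comp_apply, opW_e, LinearMap.neg_apply, covFun, covFun]
    simp only [map_smul, map_add, functional_e, smul_eq_mul]
    have h1 := congrArg (coeff (2 * j + 3 + r)) (hH.pow_recursion (2 * j))
    set G := H ^ (2 * j + 1) with hG
    set w : ℂ⟦X⟧ := PowerSeries.C (((2 * j : ℕ) : ℂ) + 1) * G - X * derivative ℂ G with hw
    have hwn : ∀ n, coeff n w = (2 * (j : ℂ) + 1 - n) * coeff n G := by
      intro n
      rw [hw, map_sub, coeff_C_mul, coeff_X_mul_derivative]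
      push_cast
      ring
    have h2 : curveU α β * w = w + PowerSeries.C (α + β) * (X * w) +
        PowerSeries.C (α * β) * (X * (X * w)) := by
      rw [curveU_eq]
      ring
    rw [h2, coeff_C_mul, map_add, map_add, coeff_C_mul, coeff_C_mul,
      show 2 * j + 3 + r = 2 * j + 1 + r + 1 + 1 by ring, coeff_succ_X_mul, coeff_succ_X_mul,
      coeff_succ_X_mul, hwn, hwn, hwn] at h1
    rw [dfac_succ, show 2 * (j + 1) + 1 = 2 * j + 3 by ring,
      show 2 * j + 3 + r = 2 * j + 1 + r + 1 + 1 by ring]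
    simp only [← add_assoc]
    rw [show 2 * j + 1 + r + 2 = 2 * j + 1 + r + 1 + 1 by ring]
    push_cast at h1 ⊢
    linear_combination dfac j * r * h1
  exact LinearMap.congr_fun this w

lemma covFun_formT (hH : IsH α β H) (j k : ℕ) :
    covFun H j (formT (α * β) (α + β) k) = (-1) ^ (k + 1) * coeff (j + 1 + k) (rhoH H) := by
  induction k generalizing j with
  | zero =>
    rw [add_zero, coeff_succ_rhoH]
    change covFun H j (vecE 1) = _
    rw [covFun, functional_e]
    push_cast
    ring
  | succ k ih =>
    rw [formT_succ, hH.covFun_opW, ih, show j + 1 + 1 + k = j + 1 + (k + 1) by ring]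
    ring

/-- The covariances of both sides agree. -/
theorem covOdd_eq (hH : IsH α β H) (j k : ℕ) : covOdd H j k = covR (rhoH H) j k := by
  have h1 : covOdd H j k = covFun H j (formM H k) := by
    rw [formM, map_smul, covFun, functional_negPart, covOdd, covH, smul_eq_mul, smul_eq_mul, mul_sum,
      mul_sum]
    refine sum_congr rfl fun n _ => ?_
    ring
  rw [h1, hH.formM_eq, map_sum, covR]
  refine sum_congr rfl fun n _ => ?_
  rw [map_smul, hH.covFun_formT, smul_eq_mul]

end IsH


/-! ### The shift operator -/

section Shift

variable (b : ℕ+ → Coef)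

/-- The constant vector field `∑ b_k ∂/∂t_k`. -/
def constDer : Derivation Coef Funt Funt :=
  MvPolynomial.mkDerivation Coef (fun k => MvPolynomial.C (b k) : ℕ+ → Funt)

lemma constDer_eq_finsum (P : Funt) : ∑ᶠ k : ℕ+, b k • opJ k P = constDer b P := by
  have h1 : ∀ k : ℕ+, b k • opJ k P =
      (b k • MvPolynomial.pderiv k : Derivation Coef Funt Funt) P := by
    intro k
    rw [opJ_of_pos (by exact_mod_cast k.pos), dDer_coe, Derivation.smul_apply]
  rw [finsum_eq_sum_of_support_subset (s := P.vars), sum_congr rfl fun k _ => h1 k,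
    ← derivation_sum_apply]
  · apply MvPolynomial.derivation_eq_of_forall_mem_vars
    intro j hj
    rw [constDer, MvPolynomial.mkDerivation_X, derivation_sum_apply, sum_eq_single_of_mem j hj]
    · rw [Derivation.smul_apply, MvPolynomial.pderiv_X_self, MvPolynomial.smul_eq_C_mul, mul_one]
    · intro n _ hn
      rw [Derivation.smul_apply, MvPolynomial.pderiv_X_of_ne (Ne.symm hn), smul_zero]
  · intro k hk
    rw [Function.mem_support, h1, Derivation.smul_apply] at hk
    by_contra h
    exact hk (by rw [MvPolynomial.pderiv_eq_zero_of_notMem_vars h, smul_zero])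

/-- The constant vector field as a complex linear map. -/
def constDerL : Module.End ℂ Funt where
  toFun := constDer b
  map_add' := map_add _
  map_smul' c P := derivation_smul_complex _ c P

lemma constDerL_X_mul (i : ℕ+) (P : Funt) : constDerL b (MvPolynomial.X i * P) =
    MvPolynomial.X i * constDerL b P + MvPolynomial.C (b i) * P := by
  change constDer b _ = _ * constDer b P + _
  rw [Derivation.leibniz, constDer, MvPolynomial.mkDerivation_X, smul_eq_mul, smul_eq_mul,
    mul_comm P]

lemma divPow_constDerL_X_mul (i : ℕ+) (P : Funt) (n : ℕ) :
    divPow (constDerL b) (n + 1) (MvPolynomial.X i * P) =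
      MvPolynomial.X i * divPow (constDerL b) (n + 1) P +
        MvPolynomial.C (b i) * divPow (constDerL b) n P := by
  have hC : ∀ (x : Coef) (Q : Funt), constDerL b (MvPolynomial.C x * Q) =
      MvPolynomial.C x * constDerL b Q := by
    intro x Q
    rw [← MvPolynomial.smul_eq_C_mul, ← MvPolynomial.smul_eq_C_mul]
    exact Derivation.map_smul _ _ _
  induction n with
  | zero =>
    have h1 := divPow_succ (constDerL b) 0 (MvPolynomial.X i * P)
    have h2 := divPow_succ (constDerL b) 0 P
    rw [divPow_zero, Nat.cast_zero, zero_add, zero_add, one_smul] at h1 h2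
    rw [zero_add, h1, h2, constDerL_X_mul, divPow_zero]
  | succ n ih =>
    have hn : (((n + 1 : ℕ) : ℂ) + 1) ≠ 0 := by exact_mod_cast (n + 1).succ_ne_zero
    apply smul_right_injective _ hn
    simp only
    have h2 := divPow_succ (constDerL b) (n + 1) P
    have h3 := divPow_succ (constDerL b) n P
    rw [divPow_succ, ih, map_add, constDerL_X_mul, hC, ← h2, ← h3, smul_add, mul_smul_comm,
      mul_smul_comm, add_assoc]
    congr 1
    push_cast
    module

/-- The shift `t_k ↦ t_k + b_k`. -/
def shiftHom : Funt →ₐ[Coef] Funt :=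
  MvPolynomial.aeval fun k => MvPolynomial.X k + MvPolynomial.C (b k)

lemma opExp_constDerL (P : Funt) :
    (∃ N, divPow (constDerL b) N P = 0) ∧ opExp (constDerL b) P = shiftHom b P := by
  induction P using MvPolynomial.induction_on with
  | C a =>
    have h1 : divPow (constDerL b) 1 (MvPolynomial.C a) = 0 := by
      have h1 := divPow_succ (constDerL b) 0 (MvPolynomial.C a)
      rw [divPow_zero, Nat.cast_zero, zero_add, zero_add, one_smul] at h1
      rw [h1]
      exact MvPolynomial.derivation_C _ _
    refine ⟨⟨1, h1⟩, ?_⟩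
    rw [opExp_eq_sum _ _ h1, sum_range_one, divPow_zero]
    exact ((shiftHom b).commutes a).symm
  | add P Q hP hQ =>
    obtain ⟨⟨N, hN⟩, hP⟩ := hP
    obtain ⟨⟨M, hM⟩, hQ⟩ := hQ
    have h1 : divPow (constDerL b) (max N M) P = 0 := divPow_eq_zero hN (le_max_left _ _)
    have h2 : divPow (constDerL b) (max N M) Q = 0 := divPow_eq_zero hM (le_max_right _ _)
    have h3 : divPow (constDerL b) (max N M) (P + Q) = 0 := by rw [map_add, h1, h2, add_zero]
    refine ⟨⟨_, h3⟩, ?_⟩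
    rw [map_add, ← hP, ← hQ, opExp_eq_sum _ _ h1, opExp_eq_sum _ _ h2, opExp_eq_sum _ _ h3,
      ← sum_add_distrib]
    exact sum_congr rfl fun n _ => map_add _ _ _
  | mul_X P i hP =>
    obtain ⟨⟨N, hN⟩, hP⟩ := hP
    have h2 : divPow (constDerL b) (N + 1) P = 0 := divPow_eq_zero hN (by omega)
    have h1 : divPow (constDerL b) (N + 1) (P * MvPolynomial.X i) = 0 := by
      rw [mul_comm, divPow_constDerL_X_mul, h2, hN, mul_zero, mul_zero, add_zero]
    refine ⟨⟨_, h1⟩, ?_⟩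
    rw [opExp_eq_sum _ _ h1, sum_range_succ', divPow_zero, mul_comm P]
    simp only [divPow_constDerL_X_mul]
    rw [sum_add_distrib, ← mul_sum, ← mul_sum, map_mul, ← hP, opExp_eq_sum _ _ hN, shiftHom,
      MvPolynomial.aeval_X]
    have h3 := sum_range_succ' (fun n => divPow (constDerL b) n P) N
    rw [sum_range_succ, hN, add_zero, divPow_zero] at h3
    rw [h3]
    ring

theorem expJ_eq (P : Funt) : expJ b P = shiftHom b P := by
  rw [← (opExp_constDerL b P).2, expJ]
  congr 1
  funext Q
  exact constDer_eq_finsum b Q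

end Shift

/-! ### The change of variables as linear forms -/

lemma opL_zero (P : Funt) : opL 0 P = derL 0 P := by
  rw [opL_of_nonneg le_rfl]
  simp

lemma opL_neg_one (P : Funt) : opL (-1) P = derL (-1) P := by
  have h : Finset.Ioo (0 : ℤ) (- -1) = ∅ := by rfl
  rw [opL, derL, h, Finset.Ioo_eq_empty (by omega)]
  simp

lemma opL_neg_two (P : Funt) :
    opL (-2) P - (1 / 2 : ℂ) • (tVar 1 ^ 2 * P) = derL (-2) P := by
  have h : Finset.Ioo (0 : ℤ) (- -2) = {1} := by rfl
  rw [opL, derL, h, sum_singleton, Finset.Ioo_eq_empty (by omega)]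
  norm_num
  rw [sq]
  ring

lemma derL_toFun (m : ℕ) (i : ℕ) :
    derL (-m) (LinForm.toFun (vecE i)) = (i : ℂ) • LinForm.toFun (vecE (i + m)) := by
  rw [toFun_e, toFun_e, derivation_smul_complex]
  rcases Nat.eq_zero_or_pos i with rfl | hi
  · simp
  · obtain ⟨j, rfl⟩ : ∃ j : ℕ+, (j : ℕ) = i := ⟨⟨i, hi⟩, rfl⟩
    rw [tVar_coe, derL, MvPolynomial.mkDerivation_X, ← Int.cast_smul_eq_zsmul ℂ]
    push_cast
    rw [sub_neg_eq_add]
    simp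

lemma toFun_opW (π σ : ℂ) (w : LinForm) : LinForm.toFun (opW π σ w) =
    π • opL 0 (LinForm.toFun w) + σ • opL (-1) (LinForm.toFun w) +
      (opL (-2) (LinForm.toFun w) - (1 / 2 : ℂ) • (tVar 1 ^ 2 * LinForm.toFun w)) := by
  rw [opL_zero, opL_neg_one, opL_neg_two]
  induction w using Finsupp.induction_linear with
  | zero => simp
  | add v w hv hw =>
    simp only [map_add, hv, hw, smul_add]
    abel
  | single i c =>
    have hs : Finsupp.single i c = c • vecE i := by rw [vecE, Finsupp.smul_single_one]
    have h0 := derL_toFun 0 i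
    have h1 := derL_toFun 1 i
    have h2 := derL_toFun 2 i
    simp only [Nat.cast_zero, neg_zero, Nat.cast_one, Nat.cast_ofNat, add_zero] at h0 h1 h2
    rw [hs, map_smul, map_smul, map_smul, derivation_smul_complex, derivation_smul_complex,
      derivation_smul_complex, h0, h1, h2, opW_e]
    simp only [map_smul, map_add]
    module

/-- The curve has parameters α = s and β = q/s: their product is q, and their sum is (2q+p)/s
because s² = p + q. -/
lemma Tqp_eq {q p s : ℂ} (hs : s ^ 2 = p + q) (hs0 : s ≠ 0) (k : ℕ) :
    Tqp q p s k = LinForm.toFun (formT (s * (q / s)) (s + q / s) k) := by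
  have h1 : s * (q / s) = q := by field_simp
  have h2 : s + q / s = (2 * q + p) / s := by
    field_simp
    linear_combination hs
  induction k with
  | zero =>
    change tVar 1 = LinForm.toFun (vecE 1)
    rw [toFun_e]
    simp
  | succ k ih => rw [Tqp, ih, formT_succ, toFun_opW, h1, h2]


/-! ### Conjugation by exponentials of vector fields -/

/-- The exponential of `-S` is inverse to the exponential of `S`. -/
lemma Raises.expo_expo_neg {S : Module.End ℂ ℂ⟦X⟧} (hS : Raises S) (g : ℂ⟦X⟧) :
    expo S (expo (-S) g) = g := by
  have hS' : Raises (-S) := fun n g hg m hm => by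
    rw [LinearMap.neg_apply, map_neg, hS n g hg m hm, neg_zero]
  ext k
  -- Evaluation of operators on series is invariant under right multiplication by S on operators
  -- paired with -S on series. The Leibniz formula then leaves only the term of order zero.
  let SU : Module.End ℂ (Module.End ℂ ℂ⟦X⟧) := LinearMap.mulRight ℂ S
  have hSU : ∀ m, divPow SU m 1 = divPow S m := by
    intro m
    have : ∀ m, (SU ^ m) 1 = S ^ m := by
      intro m
      induction m with
      | zero => rfl
      | succ m ih => rw [pow_succ', Module.End.mul_apply, ih, pow_succ]; rfl
    rw [divPow, divPow, LinearMap.smul_apply, this]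
  have key := sum_divPow_leibniz (β := (LinearMap.id : Module.End ℂ ℂ⟦X⟧ →ₗ[ℂ] _)) (SU := SU)
    (SV := -S) (SW := 0) (by intro u v; simp [SU]) (coeff k) 1 g (N := k + 1)
    (K := 2 * (k + 1) + 1) (by omega) ?_
  · rw [sum_range_succ', sum_eq_zero, zero_add, divPow_zero] at key
    · simp only [hSU, LinearMap.id_apply, Module.End.one_apply] at key
      rw [hS.coeff_expo _ (lt_add_one k), key, LinearMap.sum_apply, map_sum, map_sum]
      refine sum_congr rfl fun m _ => ?_
      rw [← sub_eq_zero, ← map_sub, ← map_sub]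
      refine hS.coeff_divPow_of_le (n := k + 1) _ (fun i hi => ?_) (by omega)
      rw [map_sub, hS'.coeff_expo _ hi, sub_self]
    · intro j _
      simp [divPow]
  · intro m n hmn
    rw [hSU, LinearMap.id_apply]
    rcases hmn with h | h
    · exact hS.coeff_divPow _ (by omega)
    · exact hS.coeff_divPow_of_le (n := k + 1) _ (fun i hi => hS'.coeff_divPow _ (by omega))
        (by omega)

/-- The zeroth order part of `∑ a_k l_k`. -/
def serC (a : ℕ+ → ℂ) : ℂ⟦X⟧ :=
  PowerSeries.mk fun n => -(((n : ℂ) + 1) / 2) * coeff n (serA a)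

lemma constantCoeff_serC (a : ℕ+ → ℂ) : constantCoeff (serC a) = 0 := by
  rw [← coeff_zero_eq_constantCoeff_apply, serC, coeff_mk, coeff_zero_eq_constantCoeff_apply,
    constantCoeff_serA, mul_zero]

lemma coeff_X_pow_mul_ite (k n : ℕ) (g : ℂ⟦X⟧) :
    coeff n (X ^ k * g) = if k ≤ n then coeff (n - k) g else 0 := by
  rw [mul_comm, coeff_mul_X_pow']

lemma suml_eq (a : ℕ+ → ℂ) (g : ℂ⟦X⟧) : suml a g = vf (serA a) (serC a) g := by
  ext n
  rw [suml, coeff_mk, vf_apply, map_sub, coeff_mul, coeff_mul, ← sum_sub_distrib,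
    Finset.Nat.sum_antidiagonal_eq_sum_range_succ_mk, sum_range_succ']
  have h0 : coeff 0 (serA a) = 0 := by
    rw [coeff_zero_eq_constantCoeff_apply, constantCoeff_serA]
  have h0' : coeff 0 (serC a) = 0 := by
    rw [coeff_zero_eq_constantCoeff_apply, constantCoeff_serC]
  simp only [h0, h0', zero_mul, sub_zero, add_zero]
  have hk : ∀ k : ℕ+, coeff n (opl k g) = if (k : ℕ) ≤ n then
      -(((n - k : ℕ) : ℂ) + ((k : ℕ) + 1) / 2) * coeff (n - k) g else 0 := by
    intro k
    rw [opl, map_neg, coeff_X_pow_mul_ite]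
    split_ifs
    · rw [map_add, coeff_X_mul_derivative, PowerSeries.coeff_smul, smul_eq_mul]
      ring
    · simp
  rw [finsum_eq_sum_of_support_subset (s := (range n).image Nat.succPNat)]
  · rw [sum_image fun x _ y _ h => Nat.succPNat_injective h]
    refine sum_congr rfl fun i hi => ?_
    rw [mem_range] at hi
    have h1 : coeff (i + 1) (serA a) = a i.succPNat := coeff_serA a i.succPNat
    rw [hk, if_pos (by simpa using hi), serC, coeff_mk, h1, coeff_X_mul_derivative]
    simp only [Nat.succPNat_coe, Nat.succ_eq_add_one]
    push_cast
    ring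
  · intro k hk'
    rw [Function.mem_support, hk] at hk'
    have h1 : (k : ℕ) ≤ n := by
      by_contra h
      rw [if_neg h, mul_zero] at hk'
      exact hk' rfl
    have h2 := k.pos
    rw [Finset.coe_image]
    refine ⟨k - 1, by simp; omega, ?_⟩
    apply PNat.eq
    simp
    omega

lemma suml_iterate (a : ℕ+ → ℂ) (j : ℕ) (g : ℂ⟦X⟧) :
    (suml a)^[j] g = (vf (serA a) (serC a) ^ j) g := by
  rw [Module.End.pow_apply]
  congr 1
  funext g
  exact suml_eq a g

lemma raises_suml (a : ℕ+ → ℂ) : Raises (vf (serA a) (serC a)) :=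
  raises_vf (constantCoeff_serA a) (constantCoeff_serC a)

lemma expl_eq (a : ℕ+ → ℂ) (g : ℂ⟦X⟧) : expl a g = expo (vf (serA a) (serC a)) g := by
  ext n
  rw [expl, coeff_mk, expo, coeff_mk, finsum_eq_sum_of_support_subset (s := range (n + 1))]
  · refine sum_congr rfl fun j _ => ?_
    rw [suml_iterate, divPow, LinearMap.smul_apply, PowerSeries.coeff_smul, smul_eq_mul]
  · intro j hj
    rw [Function.mem_support] at hj
    by_contra h
    apply hj
    have := (raises_suml a).coeff_divPow g (m := n) (k := j) (by simpa using h)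
    rwa [divPow, LinearMap.smul_apply, PowerSeries.coeff_smul, smul_eq_mul, ← suml_iterate] at this

lemma expl_neg (a : ℕ+ → ℂ) (g : ℂ⟦X⟧) : expl (-a) g = expo (-vf (serA a) (serC a)) g := by
  have h1 : serA (-a) = -serA a := by
    ext n
    rw [serA, map_neg, serA, coeff_mk, coeff_mk]
    split_ifs
    · rfl
    · rw [neg_zero]
  have h2 : serC (-a) = -serC a := by
    ext n
    rw [serC, map_neg, serC, coeff_mk, coeff_mk, h1, map_neg]
    ring
  rw [expl_eq, h1, h2]
  congr 1
  refine LinearMap.ext fun g => ?_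
  rw [LinearMap.neg_apply, vf_apply, vf_apply]
  ring

/-- The image of `z` under the flow of `∑ a_k l_k`. -/
def flow (a : ℕ+ → ℂ) : ℂ⟦X⟧ := expo (vf (serA a) 0) X

/-- The zeroth order part of ∑ a_k l_k may be assigned to g alone in the product z g, so it cancels
in the conjugation and only the flow of z remains. -/
lemma isConjugate_iff {a : ℕ+ → ℂ} {f : ℂ⟦X⟧} : IsConjugate a f ↔ flow a = f := by
  have h : ∀ g, expl a (X * expl (-a) g) = flow a * g := by
    intro g
    have h1 := expo_vf_mul (C := 0) (C' := serC a) (constantCoeff_serA a) (by simp)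
      (constantCoeff_serC a) X (expl (-a) g)
    rw [zero_add] at h1
    rw [expl_eq, h1, expl_neg, (raises_suml a).expo_expo_neg, flow]
  unfold IsConjugate
  simp only [h]
  constructor
  · intro h
    simpa using h 1
  · rintro rfl g
    rfl

/-! ### Recovering a vector field from its flow -/

section Recursion

variable {A A' : ℂ⟦X⟧}

lemma coeff_vf_congr {n m : ℕ} (hA : constantCoeff A = 0) (hA' : constantCoeff A' = 0)
    (h : ∀ i < n, coeff i A = coeff i A') {g g' : ℂ⟦X⟧} (hg : ∀ i < m, coeff i g = coeff i g')
    {l : ℕ} (hlow : ∀ i < l, coeff i g = 0) (hln : m < n + l) :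
    coeff m (vf A 0 g) = coeff m (vf A' 0 g') := by
  rw [vf_apply, vf_apply, zero_mul, zero_mul, zero_sub, zero_sub, map_neg, map_neg, coeff_mul,
    coeff_mul]
  congr 1
  refine sum_congr rfl fun x hx => ?_
  rw [HasAntidiagonal.mem_antidiagonal] at hx
  rw [coeff_X_mul_derivative, coeff_X_mul_derivative]
  rcases Nat.eq_zero_or_pos x.1 with h0 | h0
  · rw [h0, coeff_zero_eq_constantCoeff_apply, coeff_zero_eq_constantCoeff_apply, hA, hA', zero_mul,
      zero_mul]
  · rw [← hg x.2 (by omega)]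
    rcases lt_or_ge x.2 l with h1 | h1
    · rw [hlow _ h1, mul_zero, mul_zero, mul_zero]
    · rw [h x.1 (by omega)]

/-- If the lower coefficients agree, the n-th coefficient of A reaches degree n + 1 only through the
linear term -A z; the second and later iterates apply the field to series of order at least two. -/
lemma coeff_flow_congr {n : ℕ} (hA : constantCoeff A = 0) (hA' : constantCoeff A' = 0)
    (h : ∀ i < n, coeff i A = coeff i A') :
    coeff (n + 1) (expo (vf A 0) X - expo (vf A' 0) X) = -(coeff n A - coeff n A') := by
  have hr : ∀ {B : ℂ⟦X⟧}, constantCoeff B = 0 → Raises (vf B 0) := fun hB =>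
    raises_vf hB (by simp)
  have hpow : ∀ j, ∀ m ≤ n, coeff m ((vf A 0 ^ j) X) = coeff m ((vf A' 0 ^ j) X) := by
    intro j
    induction j with
    | zero => intro m _; rfl
    | succ j ih =>
      intro m hm
      rw [pow_succ', pow_succ', Module.End.mul_apply, Module.End.mul_apply]
      refine coeff_vf_congr (n := n) (l := 1) hA hA' h (fun i hi => ih i (by omega)) (fun i hi => ?_)
        (by omega)
      obtain rfl : i = 0 := by omega
      clear ih
      induction j with
      | zero => simp
      | succ j _ =>
        rw [pow_succ', Module.End.mul_apply]
        exact hr hA 0 _ (by simp) 0 (by omega)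
  have hord : ∀ j, ∀ i ≤ j, coeff i ((vf A 0 ^ j) X) = 0 := by
    intro j
    induction j with
    | zero => intro i hi; obtain rfl : i = 0 := by omega
              simp
    | succ j ih =>
      intro i hi
      rw [pow_succ', Module.End.mul_apply]
      exact hr hA (j + 1) _ (fun m hm => ih m (by omega)) i (by omega)
  have hbig : ∀ j, coeff (n + 1) (divPow (vf A 0) (j + 2) X) =
      coeff (n + 1) (divPow (vf A' 0) (j + 2) X) := by
    intro j
    rw [divPow, divPow, LinearMap.smul_apply, LinearMap.smul_apply, PowerSeries.coeff_smul,
      PowerSeries.coeff_smul]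
    congr 1
    rw [pow_succ', pow_succ' (vf A' 0), Module.End.mul_apply, Module.End.mul_apply]
    exact coeff_vf_congr (n := n) (l := 2) hA hA' h (fun i hi => hpow _ i (by omega))
      (fun i hi => hord _ i (by omega)) (by omega)
  have hone : ∀ B : ℂ⟦X⟧, coeff (n + 1) (divPow (vf B 0) 1 X) = -coeff n B := by
    intro B
    rw [divPow_apply]
    simp [vf_apply, coeff_succ_mul_X]
  rw [map_sub, (hr hA).coeff_expo X (N := n + 1 + 1) (by omega),
    (hr hA').coeff_expo X (N := n + 1 + 1) (by omega), map_sum, map_sum, ← sum_sub_distrib,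
    sum_range_succ', sum_range_succ', sum_eq_zero fun j _ => ?_, zero_add, divPow_zero, divPow_zero,
    sub_self, add_zero, zero_add, hone, hone]
  · ring
  · exact sub_eq_zero.mpr (hbig j)

end Recursion

lemma coeff_succ_flow_congr {a a' : ℕ+ → ℂ} (n : ℕ) (h : ∀ i : ℕ+, (i : ℕ) < n → a i = a' i) :
    coeff (n + 1) (flow a) - coeff (n + 1) (flow a') =
      -(coeff n (serA a) - coeff n (serA a')) := by
  rw [← map_sub]
  refine coeff_flow_congr (constantCoeff_serA a) (constantCoeff_serA a') fun i hi => ?_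
  rw [serA, serA, coeff_mk, coeff_mk]
  split_ifs with h0
  · exact h _ hi
  · rfl

lemma coeff_flow_zero (a : ℕ+ → ℂ) : coeff 0 (flow a) = 0 := by
  rw [coeff_zero_eq_constantCoeff_apply, flow, constantCoeff_expo, constantCoeff_X]

lemma coeff_flow_one (a : ℕ+ → ℂ) : coeff 1 (flow a) = 1 := by
  have h := coeff_succ_flow_congr (a := a) (a' := 0) 0 (by simp)
  have h0 : flow 0 = X := by
    refine expo_of_apply_eq_zero ?_
    have : serA (0 : ℕ+ → ℂ) = 0 := by
      ext n
      rw [serA, coeff_mk]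
      split_ifs <;> rfl
    rw [this]
    simp [vf_apply]
  rw [h0, coeff_zero_eq_constantCoeff_apply, coeff_zero_eq_constantCoeff_apply, constantCoeff_serA,
    constantCoeff_serA, zero_add, coeff_one_X] at h
  linear_combination h

lemma flow_injective : Function.Injective flow := by
  intro a a' h
  have key : ∀ n : ℕ, ∀ i : ℕ+, (i : ℕ) < n → a i = a' i := by
    intro n
    induction n with
    | zero => intro i hi; omega
    | succ n ih =>
      intro i hi
      rcases lt_or_eq_of_le (Nat.lt_succ_iff.mp hi) with h1 | rfl
      · exact ih i h1
      · have h2 := coeff_succ_flow_congr _ ih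
        rw [h, sub_self, coeff_serA, coeff_serA] at h2
        linear_combination h2
  funext i
  exact key _ i (lt_add_one _)

/-- Successive approximations to the logarithm of a change of coordinates. -/
def approxFlow (f : ℂ⟦X⟧) : ℕ → ℕ+ → ℂ
  | 0 => 0
  | n + 1 => Function.update (approxFlow f n) n.succPNat
      (approxFlow f n n.succPNat + coeff (n + 2) (flow (approxFlow f n)) - coeff (n + 2) f)

lemma approxFlow_of_le (f : ℂ⟦X⟧) {n m : ℕ} (h : n ≤ m) (i : ℕ+) (hi : (i : ℕ) ≤ n) :
    approxFlow f m i = approxFlow f n i := by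
  induction m, h using Nat.le_induction with
  | base => rfl
  | succ m hm ih =>
    rw [approxFlow, Function.update_of_ne, ih]
    rintro rfl
    simp at hi
    omega

/-- Triangularity: in degree n + 2 of the flow the only new parameter is a_{n+1}, entering with
coefficient -1, so the coefficients of f are matched one at a time. -/
lemma exists_flow {f : ℂ⟦X⟧} (h0 : coeff 0 f = 0) (h1 : coeff 1 f = 1) : ∃ a, flow a = f := by
  refine ⟨fun i => approxFlow f i i, ?_⟩
  ext n
  match n with
  | 0 => rw [coeff_flow_zero, h0]
  | 1 => rw [coeff_flow_one, h1]
  | n + 2 =>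
    have e1 := coeff_succ_flow_congr (a := fun i => approxFlow f i i) (a' := approxFlow f n) (n + 1)
      (fun i hi => (approxFlow_of_le f (by omega) i le_rfl).symm)
    have e2 : ∀ a : ℕ+ → ℂ, coeff (n + 1) (serA a) = a n.succPNat := fun a =>
      coeff_serA a n.succPNat
    rw [e2, e2] at e1
    have e3 : approxFlow f (n.succPNat : ℕ) n.succPNat =
        approxFlow f n n.succPNat + coeff (n + 2) (flow (approxFlow f n)) - coeff (n + 2) f := by
      rw [Nat.succPNat_coe, Nat.succ_eq_add_one, approxFlow, Function.update_self]
    rw [e3] at e1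
    linear_combination e1

theorem existsUnique_isConjugate {f : ℂ⟦X⟧} (h0 : coeff 0 f = 0) (h1 : coeff 1 f = 1) :
    ∃! a : ℕ+ → ℂ, IsConjugate a f := by
  obtain ⟨a, ha⟩ := exists_flow h0 h1
  refine ⟨a, isConjugate_iff.mpr ha, fun a' ha' => flow_injective ?_⟩
  rw [isConjugate_iff.mp ha', ha]

/-! ### Existence and uniqueness of `f` -/

lemma dyqp_eq (q s : ℂ) : dyqp q s = (curveU s (q / s))⁻¹ := rfl

lemma IsfSeries.isH {q s : ℂ} {f H : ℂ⟦X⟧} (hf : IsfSeries q s f) (hH : f * H = X)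
    (h1 : constantCoeff H = 1) : IsH s (q / s) H where
  const := h1
  eqn := by
    have h2 := hf.2.2
    rw [dxqp, dyqp_eq] at h2
    have h3 := congrArg (derivative ℂ) hH
    rw [Derivation.leibniz, derivative_X, smul_eq_mul, smul_eq_mul] at h3
    have h4 := curveU_mul_inv s (q / s)
    apply mul_left_cancel₀ (X_ne_zero (R := ℂ))
    set U := curveU s (q / s)
    set V := U⁻¹
    linear_combination (-U * H ^ 3) * h2 - X * H ^ 3 * h4 + U * H * X * h3 +
      U * H ^ 2 * derivative ℂ f * hH - X * U * derivative ℂ H * hH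

lemma isfSeries_of_isH {q s : ℂ} {f H : ℂ⟦X⟧} (hH : IsH s (q / s) H) (hf : f * H = X) :
    IsfSeries q s f := by
  have hc := congrArg (coeff 0) hf
  have hc1 := congrArg (coeff 1) hf
  have f0 : constantCoeff f = 0 := by simpa [hH.const] using hc
  refine ⟨by simpa using f0, ?_, ?_⟩
  · rw [coeff_mul, Finset.Nat.sum_antidiagonal_eq_sum_range_succ_mk, sum_range_succ,
      sum_range_one] at hc1
    simpa [hH.const, f0] using hc1
  · have h3 := congrArg (derivative ℂ) hf
    rw [Derivation.leibniz, derivative_X, smul_eq_mul, smul_eq_mul] at h3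
    have hH0 : H ≠ 0 := by
      intro h
      have := hH.const
      rw [h, map_zero] at this
      exact zero_ne_one this
    rw [dxqp, dyqp_eq]
    have h4 := hH.cube_mul_inv
    apply mul_left_cancel₀ (pow_ne_zero 3 hH0)
    linear_combination (H ^ 2 * derivative ℂ f) * hf + X * H * h3 - X * h4 -
      X * derivative ℂ H * hf

theorem existsUnique_isfSeries (q s : ℂ) : ∃! f : ℂ⟦X⟧, IsfSeries q s f := by
  have hH := isH_curveH s (q / s)
  have hinv : curveH s (q / s) * (curveH s (q / s))⁻¹ = 1 :=
    PowerSeries.mul_inv_cancel _ (by rw [hH.const]; exact one_ne_zero)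
  refine ⟨X * (curveH s (q / s))⁻¹, isfSeries_of_isH hH ?_, ?_⟩
  · rw [mul_assoc, mul_comm _ (curveH s (q / s)), hinv, mul_one]
  · intro f hf
    -- Writing an arbitrary solution as a flow supplies H with f H = z, to which the uniqueness of
    -- the curve applies.
    obtain ⟨a, ha⟩ := exists_flow hf.1 hf.2.1
    have h1 := flow_mul_flowH (constantCoeff_serA a)
    rw [← flow, ha] at h1
    have h2 := (hf.isH h1 (constantCoeff_flowH _)).eq_curveH
    rw [h2] at h1
    rw [← h1, mul_assoc, hinv, mul_one]


/-! ### The translation part -/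

/-- The functional `e_i ↦ [z^{i-1}] g`. -/
def resFun (g : ℂ⟦X⟧) : LinForm →ₗ[ℂ] ℂ := LinForm.functional fun i => coeff i (X * g)

lemma resFun_e (g : ℂ⟦X⟧) (i : ℕ) : resFun g (vecE i) = coeff i (X * g) := functional_e _ _

lemma resFun_sub (g h : ℂ⟦X⟧) (w : LinForm) : resFun (g - h) w = resFun g w - resFun h w := by
  have : resFun (g - h) = resFun g - resFun h := linForm_ext fun i => by
    rw [LinearMap.sub_apply, resFun_e, resFun_e, resFun_e, mul_sub, map_sub]
  rw [this, LinearMap.sub_apply]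

lemma resFun_negPart (g h : ℂ⟦X⟧) (i : ℕ) :
    resFun g (negPart i h) = coeff i (h * (X * g)) := by
  rw [resFun, functional_negPart, coeff_mul, Finset.Nat.sum_antidiagonal_eq_sum_range_succ_mk,
    sum_range_succ]
  simp

lemma resFun_opW (α β : ℂ) (g : ℂ⟦X⟧) (w : LinForm) :
    resFun g (opW (α * β) (α + β) w) =
      LinForm.functional (fun i => i * coeff (i + 1) (curveU α β * g)) w := by
  have : resFun g ∘ₗ opW (α * β) (α + β) =
      LinForm.functional (fun i => i * coeff (i + 1) (curveU α β * g)) := by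
    refine linForm_ext fun i => ?_
    rw [LinearMap.comp_apply, opW_e, functional_e]
    simp only [map_smul, map_add, resFun_e, smul_eq_mul]
    congr 1
    have h1 : X * (curveU α β * g) = X * g + PowerSeries.C (α + β) * (X * (X * g)) +
        PowerSeries.C (α * β) * (X * (X * (X * g))) := by
      rw [curveU_eq]
      ring
    have h2 := congrArg (coeff (i + 2)) h1
    rw [map_add, map_add, coeff_C_mul, coeff_C_mul] at h2
    simp only [coeff_succ_X_mul] at h2 ⊢
    rw [h2]
    ring
  exact LinearMap.congr_fun this w

lemma coeff_integ_mul (g : ℂ⟦X⟧) (n : ℕ) : n * coeff n (integ g) = coeff n (X * g) := by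
  cases n with
  | zero => simp
  | succ n =>
    rw [integ, coeff_mk, if_neg n.succ_ne_zero, coeff_succ_X_mul, Nat.add_sub_cancel]
    have : ((n + 1 : ℕ) : ℂ) ≠ 0 := by exact_mod_cast n.succ_ne_zero
    field_simp

/-- Integrate by parts with `opW` as -d/dx and dy = dx/z. The residue of y dx against -dw/dx is that
of w dy; another -d/dx leaves -z⁻¹ dw, which has no residue as w has only negative powers. Thus only
k = 1 contributes. -/
lemma resFun_y_formT (α β : ℂ) (k : ℕ) :
    resFun (integ (curveU α β)⁻¹ * (X * (curveU α β)⁻¹)) (formT (α * β) (α + β) k) =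
      if k = 1 then 1 else 0 := by
  have h0 := curveU_mul_inv α β
  set V := (curveU α β)⁻¹ with hV
  have hV0 : constantCoeff V = 1 := by
    rw [hV, constantCoeff_inv, constantCoeff_curveU, inv_one]
  have h1 : ∀ w, resFun (integ V * (X * V)) (opW (α * β) (α + β) w) = resFun V w := by
    intro w
    rw [resFun_opW, resFun]
    congr 2
    funext i
    rw [show curveU α β * (integ V * (X * V)) = X * integ V by
      linear_combination integ V * X * h0, coeff_succ_X_mul, coeff_integ_mul]
  have h2 : ∀ w, resFun V (opW (α * β) (α + β) w) = 0 := by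
    intro w
    rw [resFun_opW]
    have : (fun i : ℕ => (i : ℂ) * coeff (i + 1) (curveU α β * V)) = 0 := by
      funext i
      rw [h0, coeff_one, if_neg i.succ_ne_zero, mul_zero]
      rfl
    rw [this, LinForm.functional, Finsupp.linearCombination_zero, LinearMap.zero_apply]
  match k with
  | 0 =>
    change resFun _ (vecE 1) = _
    rw [resFun_e, coeff_succ_X_mul]
    simp
  | 1 =>
    rw [formT_succ, h1]
    change resFun _ (vecE 1) = _
    rw [resFun_e, coeff_succ_X_mul, coeff_zero_eq_constantCoeff_apply, hV0, if_pos rfl]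
  | k + 2 => rw [formT_succ, h1, formT_succ, h2, if_neg (by omega)]

/-- The form f dx has no pole, so the truncation in `formM` is harmless, and the value is (2j-1)!!
times the residue of f · f^{-(2j+1)} · f df = f^{1-2j} df. -/
lemma IsH.resFun_f_formM {α β : ℂ} {H f : ℂ⟦X⟧} (hH : IsH α β H) (hf : f * H = X) (j : ℕ) :
    resFun (f * (X * (curveU α β)⁻¹)) (formM H j) = if j = 1 then 1 else 0 := by
  rw [formM, map_smul, resFun_negPart]
  have h1 : H ^ (2 * j + 1) * (X * (f * (X * (curveU α β)⁻¹))) =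
      X ^ 3 * (H ^ (2 * j) * (1 * (curveU α β)⁻¹)) := by
    linear_combination (H ^ (2 * j) * X ^ 2 * (curveU α β)⁻¹) * hf
  rw [h1, coeff_X_pow_mul_ite]
  match j with
  | 0 => simp
  | 1 =>
    rw [if_pos (by omega), if_pos rfl, dfac_succ, dfac_zero]
    simp [hH.const, constantCoeff_curveU]
  | j + 2 =>
    rw [if_neg (show j + 2 ≠ 1 by omega), if_pos (by omega)]
    have h2 := hH.coeff_pow_mul 1 (2 * j + 1) (2 * j + 2)
    rw [derivative_one, mul_zero, mul_zero, map_zero, add_zero] at h2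
    have h3 : ((2 * j + 1 : ℕ) : ℂ) + 1 - ((2 * j + 2 : ℕ) : ℂ) = 0 := by push_cast; ring
    have h4 : ((2 * j + 1 : ℕ) : ℂ) + 1 ≠ 0 := by exact_mod_cast (2 * j + 1).succ_ne_zero
    rw [h3, zero_mul] at h2
    have h5 := (mul_eq_zero.mp h2).resolve_left h4
    rw [show 2 * (j + 2) + 1 - 3 = 2 * j + 2 by omega, show 2 * (j + 2) = 2 * j + 1 + 3 by ring,
      h5, smul_zero]

/-- The translation parameters of the second operator. -/
def shiftB (q s : ℂ) (f : ℂ⟦X⟧) (k : ℕ+) : Coef :=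
  if 4 ≤ (k : ℕ) then vCoef q s f k • hbarInv else 0

lemma vCoef_mul (q s : ℂ) {f : ℂ⟦X⟧} (hf : IsfSeries q s f) (k : ℕ+) :
    ((k : ℕ) : ℂ) • shiftB q s f k =
      coeff (k : ℕ) (X * ((f - integ (dyqp q s)) * dxqp q s)) • hbarInv := by
  have h1 := coeff_integ_mul ((f - integ (dyqp q s)) * dxqp q s) k
  unfold shiftB
  split_ifs with h
  · rw [← h1, smul_smul, vCoef]
  · rw [smul_zero]
    -- The series f and y agree up to first order and dx has order one, so the integral of (f - y)
    -- dx starts in degree four; the cutoff k ≥ 4 discards nothing.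
    have h2 : coeff (k : ℕ) (X * ((f - integ (dyqp q s)) * dxqp q s)) = 0 := by
      rw [show X * ((f - integ (dyqp q s)) * dxqp q s) =
        X ^ 2 * ((f - integ (dyqp q s)) * dyqp q s) by rw [dxqp]; ring, coeff_X_pow_mul_ite]
      split_ifs with h3
      · have hl : ∀ m < 2, coeff m (f - integ (dyqp q s)) = 0 := by
          intro m hm
          rw [map_sub, integ, coeff_mk]
          interval_cases m
          · rw [if_pos rfl, hf.1, sub_zero]
          · rw [hf.2.1, if_neg one_ne_zero, dyqp_eq, Nat.sub_self,
              coeff_zero_eq_constantCoeff_apply, constantCoeff_inv, constantCoeff_curveU]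
            norm_num
        exact coeff_mul_eq_zero (a := 2) (b := 0) (by omega) hl (by simp)
      · rfl
    rw [h2, zero_smul]

lemma shiftHom_toFun (q s : ℂ) {f : ℂ⟦X⟧} (hf : IsfSeries q s f) (w : LinForm) :
    shiftHom (shiftB q s f) (LinForm.toFun w) = LinForm.toFun w +
      resFun ((f - integ (dyqp q s)) * dxqp q s) w • MvPolynomial.C hbarInv := by
  induction w using Finsupp.induction_linear with
  | zero => simp
  | add v w hv hw =>
    rw [map_add, map_add, hv, hw, map_add, add_smul]
    abel
  | single i c =>
    have hs : Finsupp.single i c = c • vecE i := by rw [vecE, Finsupp.smul_single_one]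
    have hsm : ∀ (x : ℂ) (P : Funt), shiftHom (shiftB q s f) (x • P) =
        x • shiftHom (shiftB q s f) P := fun x P => by
      rw [← algebraMap_smul Coef x P, map_smul, algebraMap_smul]
    rw [hs, map_smul LinForm.toFun, hsm, map_smul (resFun _), smul_assoc, ← smul_add]
    congr 1
    rw [resFun_e, toFun_e, hsm]
    rcases Nat.eq_zero_or_pos i with rfl | hi
    · simp
    · obtain ⟨k, rfl⟩ : ∃ k : ℕ+, (k : ℕ) = i := ⟨⟨i, hi⟩, rfl⟩
      rw [tVar_nat_coe, shiftHom, MvPolynomial.aeval_X, smul_add]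
      congr 1
      have h1 := congrArg (MvPolynomial.C (σ := ℕ+)) (vCoef_mul q s hf k)
      have h2 : ∀ (x : ℂ) (y : Coef), (MvPolynomial.C (x • y) : Funt) = x • MvPolynomial.C y :=
        fun x y => by
          rw [← algebraMap_smul Coef x y, smul_eq_mul, map_mul, ← MvPolynomial.smul_eq_C_mul,
            algebraMap_smul]
      rw [h2, h2] at h1
      exact h1

lemma mulJ_map (i : ℕ) (g : ℂ⟦X⟧) :
    mulJ i (PowerSeries.map ofC.toRingHom g) = LinForm.toFun (negPart i g) := by
  rw [mulJ, negPart, map_sum]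
  refine sum_congr rfl fun n hn => ?_
  rw [mem_range] at hn
  rw [map_smul, toFun_e, PowerSeries.coeff_map, ← Nat.cast_sub hn.le]
  exact algebraMap_smul Coef (coeff n g) (_ : Funt)

lemma covH_map {𝕜 𝕜' : Type*} [CommRing 𝕜] [CommRing 𝕜'] (φ : 𝕜 →+* 𝕜') (H : 𝕜⟦X⟧) (i j : ℕ) :
    covH (PowerSeries.map φ H) i j = φ (covH H i j) := by
  rw [covH, covH, map_sum]
  refine sum_congr rfl fun n _ => ?_
  rw [map_mul, map_mul, map_natCast, ← map_pow, ← map_pow, PowerSeries.coeff_map,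
    PowerSeries.coeff_map]

lemma covOdd_map {𝕜 𝕜' : Type*} [CommRing 𝕜] [CommRing 𝕜'] [Algebra ℂ 𝕜] [Algebra ℂ 𝕜']
    (φ : 𝕜 →ₐ[ℂ] 𝕜') (H : 𝕜⟦X⟧) (i j : ℕ) :
    covOdd (PowerSeries.map φ.toRingHom H) i j = φ (covOdd H i j) := by
  rw [covOdd, covH_map, covOdd, map_smul]
  rfl

lemma s_ne_zero {q p s : ℂ} (h0 : p + q ≠ 0) (hs : s ^ 2 = p + q) : s ≠ 0 := by
  rintro rfl
  apply h0
  rw [← hs]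
  norm_num

lemma Rqp_inv {q p s : ℂ} (h0 : p + q ≠ 0) (hs : s ^ 2 = p + q)
    {H : ℂ⟦X⟧} (hH : IsH s (q / s) H) : (Rqp q p)⁻¹ = rhoH H := by
  have hs0 := s_ne_zero h0 hs
  have h1 := hH.rhoH_eq hs0
  rw [show s * (q / s) = q by field_simp,
    show s * (s - q / s) = p by field_simp; linear_combination hs] at h1
  have h2 := (isSymplectic_Rqp q p).1
  rw [h1, eq_comm, PowerSeries.eq_inv_iff_mul_eq_one (by rw [h2]; exact one_ne_zero), Rqp_eq,
    pexp_mul_pexp_neg (constantCoeff_expnt q p)]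

/-- The Givental operator and the Virasoro operator agree. -/
theorem lhsOp_eq_rhsOp {q p s : ℂ} (h0 : p + q ≠ 0) (hs : s ^ 2 = p + q)
    {f : ℂ⟦X⟧} (hf : IsfSeries q s f) {a : ℕ+ → ℂ} (ha : IsConjugate a f) (Z : FunT) : lhsOp q p s Z = rhsOp q s f a Z := by
  have hs0 := s_ne_zero h0 hs
  have hfH := flow_mul_flowH (constantCoeff_serA a)
  rw [← flow, isConjugate_iff.mp ha] at hfH
  set H := flowH (serA a) with hHdef
  have hH : IsH s (q / s) H := hf.isH hfH (constantCoeff_flowH _)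
  have hρ := Rqp_inv h0 hs hH
  -- Both operators, after their respective substitutions, are Gaussian; it remains to match
  -- covariances and means.
  have g1 := (isGaussian_givental (isSymplectic_Rqp q p)).comp_algHom
    (MvPolynomial.aeval (Tqp q p s) : FunT →ₐ[Coef] Funt)
  have g2 := (isGaussian_oddExpL (fun k => ofC (a k))).comp_algHom (shiftHom (shiftB q s f))
  rw [serA_map, flowH_map, ← hHdef] at g2
  rw [hρ] at g1
  have hcov : (fun j k => ofC (covR (rhoH H) j k)) =
      covOdd (PowerSeries.map ofC.toRingHom H) := by
    funext j k
    rw [covOdd_map, hH.covOdd_eq]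
  have hmean : (fun j => (MvPolynomial.aeval (Tqp q p s) : FunT →ₐ[Coef] Funt)
      (meanR (rhoH H) j)) = fun j => shiftHom (shiftB q s f) (dfac j •
        mulJ (2 * j + 1) (PowerSeries.map ofC.toRingHom H ^ (2 * j + 1))) := by
    funext j
    have e1 : dfac j • mulJ (2 * j + 1) (PowerSeries.map ofC.toRingHom H ^ (2 * j + 1)) =
        LinForm.toFun (formM H j) := by
      rw [← map_pow, mulJ_map, formM, map_smul]
    have e2 : ∀ (x : ℂ) (P : FunT), (MvPolynomial.aeval (Tqp q p s) : FunT →ₐ[Coef] Funt) (x • P) =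
        x • MvPolynomial.aeval (Tqp q p s) P := fun x P => by
      rw [← algebraMap_smul Coef x P, map_smul, algebraMap_smul]
    have e3 : ∀ k : ℕ, MvPolynomial.aeval (Tqp q p s)
        (if k = 1 then MvPolynomial.C hbarInv else 0 : FunT) =
        (if k = 1 then (1 : ℂ) else 0) • (MvPolynomial.C hbarInv : Funt) := by
      intro k
      split_ifs
      · rw [MvPolynomial.aeval_C, one_smul]
        rfl
      · rw [map_zero, zero_smul]
    -- The f part of the translation is the constant ħ⁻¹ δ_{j,1} of `meanR`; the y part reproduces
    -- the dilaton shifts inside the sum of ρ_n times the shifted variables.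
    rw [e1, shiftHom_toFun q s hf, sub_mul, resFun_sub, dxqp, dyqp_eq, hH.resFun_f_formM hfH,
      sub_smul, meanR, map_add, e3, map_sum]
    have e4 : ∀ n, MvPolynomial.aeval (Tqp q p s) (coeff n (rhoH H) • dilT (j - n)) =
        LinForm.toFun (coeff n (rhoH H) • formT (s * (q / s)) (s + q / s) (j - n)) -
        (coeff n (rhoH H) * if j - n = 1 then 1 else 0) • (MvPolynomial.C hbarInv : Funt) := by
      intro n
      rw [e2, dilT, map_sub, e3, MvPolynomial.aeval_X, Tqp_eq hs hs0, map_smul, smul_sub, smul_smul]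
    rw [sum_congr rfl fun n _ => e4 n, sum_sub_distrib, ← map_sum, ← hH.formM_eq, ← sum_smul]
    have e5 : resFun (integ (curveU s (q / s))⁻¹ * (X * (curveU s (q / s))⁻¹)) (formM H j) =
        ∑ n ∈ range (j + 1), coeff n (rhoH H) * if j - n = 1 then 1 else 0 := by
      rw [hH.formM_eq, map_sum]
      refine sum_congr rfl fun n _ => ?_
      rw [map_smul, resFun_y_formT, smul_eq_mul]
    rw [e5]
    abel
  rw [hcov, hmean] at g1
  have h := LinearMap.congr_fun (g1.ext g2) Z
  have r1 : lhsOp q p s Z = MvPolynomial.aeval (Tqp q p s) ((shiftZ (logOf (Rqp q p))).expA Z) := by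
    rw [lhsOp, givental_eq]
  have r2 : rhsOp q s f a Z = shiftHom (shiftB q s f) (oddExpL (fun k => ofC (a k)) Z) := by
    rw [← expJ_eq, oddExpL_apply, ← expL_eq]
    rfl
  rw [r1, r2]
  exact h


/-! ### Group elements without raising part -/

lemma expJneg_zero : expJneg 0 = 1 := by
  funext β
  have h1 : (1 : Sert) β = if β = 0 then 1 else 0 := by
    classical
    exact MvPowerSeries.coeff_one β
  rw [h1, expJneg]
  split_ifs with h
  · rw [h, Finsupp.prod_zero_index]
  · obtain ⟨k, hk⟩ := Finsupp.support_nonempty_iff.mpr h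
    refine Finset.prod_eq_zero hk ?_
    simp only
    rw [Pi.zero_apply, smul_zero, zero_pow (Finsupp.mem_support_iff.mp hk), smul_zero]

lemma expLneg_zero (P : Funt) : expLneg 0 P = (P : Sert) := by
  funext β
  rw [expLneg, sum_range_succ']
  have h1 : ∀ n, (fun Q : Funt => ∑ k ∈ Finset.Icc 1 (wt β),
      (0 : ℕ+ → Coef) k.toPNat' • opL (-(k : ℤ)) Q)^[n + 1] P = 0 := by
    intro n
    rw [Function.iterate_succ_apply']
    simp
  simp only [h1, MvPolynomial.coeff_zero, smul_zero, sum_const_zero, zero_add,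
    Function.iterate_zero, id_eq, Nat.factorial_zero, Nat.cast_one, inv_one, one_smul]
  rfl

lemma scaleL0_one (P : Funt) : scaleL0 1 P = P := by
  rw [scaleL0]
  simp

lemma isHeisenbergVirasoro_of_pos (a b : ℕ+ → Coef) :
    IsHeisenbergVirasoro fun P => ((expJ b (expL a P) : Funt) : Sert) := by
  refine ⟨1, 1, a, b, 0, 0, fun P => ?_⟩
  rw [expJneg_zero, expLneg_zero, scaleL0_one, one_mul, Units.val_one, one_smul]

lemma aeval_coe (T : ℕ → Funt) (Z : FunT) :
    MvPolynomial.aeval (fun k => (T k : Sert)) Z = ((MvPolynomial.aeval T Z : Funt) : Sert) := by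
  have : (MvPolynomial.aeval fun k => (T k : Sert)) =
      (MvPolynomial.coeToMvPowerSeries.algHom Coef).comp
        (MvPolynomial.aeval T : FunT →ₐ[Coef] Funt) := by
    apply MvPolynomial.algHom_ext
    intro k
    simp
  rw [this, AlgHom.comp_apply, MvPolynomial.coeToMvPowerSeries.algHom_apply]
  simp

lemma linearIndependent_of_triangular {R M : Type*} [CommRing R] [IsDomain R] [AddCommGroup M]
    [Module R M] (v : ℕ → M) (φ : ℕ → M →ₗ[R] R) (h : ∀ k, φ k (v k) ≠ 0)
    (h' : ∀ k m, k < m → φ m (v k) = 0) : LinearIndependent R v := by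
  rw [linearIndependent_iff]
  intro l hl
  by_contra hne
  have hs := Finsupp.support_nonempty_iff.mpr hne
  set m := l.support.max' hs
  have hm : m ∈ l.support := l.support.max'_mem hs
  have h1 := congrArg (φ m) hl
  rw [Finsupp.linearCombination_apply, Finsupp.sum, map_sum, map_zero,
    sum_eq_single_of_mem m hm] at h1
  · rw [map_smul, smul_eq_mul] at h1
    exact (mul_ne_zero (Finsupp.mem_support_iff.mp hm) (h m)) h1
  · intro k hk hkm
    rw [map_smul, h' k m (lt_of_le_of_ne (l.support.le_max' k hk) hkm), smul_zero]

lemma coeff_smul_complex (x : ℂ) (P : Funt) (β : ℕ+ →₀ ℕ) :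
    MvPolynomial.coeff β (x • P) = x • MvPolynomial.coeff β P := by
  rw [← algebraMap_smul Coef x P, MvPolynomial.coeff_smul, algebraMap_smul]

lemma coeff_toFun_single (w : LinForm) (j : ℕ+) :
    MvPolynomial.coeff (Finsupp.single j 1) (LinForm.toFun w) =
      ofC (((j : ℕ) : ℂ) * w j) := by
  classical
  induction w using Finsupp.induction_linear with
  | zero => simp
  | add v w hv hw => rw [map_add, MvPolynomial.coeff_add, hv, hw, Finsupp.add_apply, mul_add, map_add]
  | single i c =>
    have hs : Finsupp.single i c = c • vecE i := by rw [vecE, Finsupp.smul_single_one]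
    rw [hs, map_smul, coeff_smul_complex, toFun_e, coeff_smul_complex]
    have hc : ∀ x : ℂ, ofC x = x • (1 : Coef) := fun x => Algebra.algebraMap_eq_smul_one x
    rcases Nat.eq_zero_or_pos i with rfl | hi
    · simp [vecE]
    · obtain ⟨k, rfl⟩ : ∃ k : ℕ+, (k : ℕ) = i := ⟨⟨i, hi⟩, rfl⟩
      rw [tVar_nat_coe, MvPolynomial.coeff_X, hc, vecE, Finsupp.smul_apply, Finsupp.single_apply]
      by_cases hkj : k = j
      · subst hkj
        rw [if_pos rfl, if_pos rfl, smul_smul]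
        congr 1
        rw [smul_eq_mul]
        ring
      · have h1 : (k : ℕ) ≠ j := fun h => hkj (PNat.eq h)
        have h2 : Finsupp.single k 1 ≠ Finsupp.single j 1 := fun h =>
          hkj (Finsupp.single_left_injective one_ne_zero h)
        rw [if_neg h1, if_neg h2]
        simp

lemma isLinearForm_toFun (w : LinForm) : IsLinearForm (LinForm.toFun w : Sert) := by
  have h : (LinForm.toFun w).IsHomogeneous 1 := by
    induction w using Finsupp.induction_linear with
    | zero => rw [map_zero]; exact MvPolynomial.isHomogeneous_zero _ _ _
    | add v w hv hw => rw [map_add]; exact hv.add hw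
    | single i c =>
      have hs : Finsupp.single i c = c • vecE i := by rw [vecE, Finsupp.smul_single_one]
      rw [hs, map_smul, toFun_e, smul_smul, ← algebraMap_smul Coef, MvPolynomial.smul_eq_C_mul]
      rcases Nat.eq_zero_or_pos i with rfl | hi
      · rw [tVar_of_nonpos (by simp), mul_zero]
        exact MvPolynomial.isHomogeneous_zero _ _ _
      · obtain ⟨k, rfl⟩ : ∃ k : ℕ+, (k : ℕ) = i := ⟨⟨i, hi⟩, rfl⟩
        rw [tVar_nat_coe]
        exact MvPolynomial.isHomogeneous_C_mul_X _ _
  intro β hβ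
  rw [MvPolynomial.coeff_coe] at hβ
  have := h hβ
  rwa [Pi.one_def, ← Finsupp.degree_eq_weight_one] at this

lemma linearIndependent_toFun {w : ℕ → LinForm} (h : ∀ k, w k (2 * k + 1) ≠ 0)
    (h' : ∀ k i, 2 * k + 1 < i → w k i = 0) :
    LinearIndependent Coef fun k => (LinForm.toFun (w k) : Sert) := by
  have hφ : ∀ k m, MvPowerSeries.coeff (Finsupp.single (oddIdx m) 1)
      (LinForm.toFun (w k) : Sert) = ofC ((2 * m + 1 : ℕ) * w k (2 * m + 1)) := by
    intro k m
    rw [MvPolynomial.coeff_coe, coeff_toFun_single]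
    rfl
  refine linearIndependent_of_triangular _
    (fun m => MvPowerSeries.coeff (Finsupp.single (oddIdx m) 1)) (fun k => ?_) fun k m hkm => ?_
  · rw [hφ, map_ne_zero]
    exact mul_ne_zero (by exact_mod_cast (2 * k).succ_ne_zero) (h k)
  · rw [hφ, h' k _ (by omega), mul_zero, map_zero]

lemma opW_apply (π σ : ℂ) (w : LinForm) (n : ℕ) : opW π σ w (n + 2) =
    π * (n + 2) * w (n + 2) + σ * (n + 1) * w (n + 1) + n * w n := by
  induction w using Finsupp.induction_linear with
  | zero => simp
  | add v w hv hw =>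
    rw [map_add (opW π σ), Finsupp.add_apply, hv, hw]
    simp only [Finsupp.add_apply]
    ring
  | single i c =>
    have hs : Finsupp.single i c = c • vecE i := by rw [vecE, Finsupp.smul_single_one]
    rw [hs, map_smul, opW_e]
    simp only [Finsupp.smul_apply, Finsupp.add_apply, vecE, Finsupp.single_apply, smul_eq_mul]
    by_cases h1 : i = n + 2
    · subst h1
      simp
      ring
    · by_cases h2 : i = n + 1
      · subst h2
        simp
        ring
      · by_cases h3 : i = n
        · subst h3
          simp
          ring
        · rw [if_neg h1, if_neg (by omega), if_neg (by omega), if_neg h2, if_neg h3]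
          ring

lemma formT_apply (π σ : ℂ) (k : ℕ) :
    formT π σ k (2 * k + 1) = dfac k ∧ ∀ i, 2 * k + 1 < i → formT π σ k i = 0 := by
  induction k with
  | zero =>
    refine ⟨?_, fun i hi => ?_⟩
    · change vecE 1 1 = _
      rw [vecE, Finsupp.single_eq_same, dfac_zero]
    · change vecE 1 i = _
      rw [vecE, Finsupp.single_apply, if_neg (by omega)]
  | succ k ih =>
    refine ⟨?_, fun i hi => ?_⟩
    · rw [formT_succ, show 2 * (k + 1) + 1 = 2 * k + 1 + 2 by ring, opW_apply, ih.1,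
        ih.2 _ (by omega), ih.2 _ (by omega), dfac_succ]
      push_cast
      ring
    · obtain ⟨n, rfl⟩ : ∃ n, i = n + 2 := ⟨i - 2, by omega⟩
      rw [formT_succ, opW_apply, ih.2 _ (by omega), ih.2 _ (by omega), ih.2 _ (by omega)]
      ring

theorem coincidesWithHV_Rqp {q p : ℂ} (h0 : p + q ≠ 0) : CoincidesWithHV (Rqp q p) := by
  obtain ⟨s, hs⟩ := IsAlgClosed.exists_pow_nat_eq (p + q) (n := 2) (by norm_num)
  have hs0 := s_ne_zero h0 hs
  obtain ⟨f, hf, -⟩ := existsUnique_isfSeries q s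
  obtain ⟨a, ha, -⟩ := existsUnique_isConjugate hf.1 hf.2.1
  refine ⟨_, isHeisenbergVirasoro_of_pos (fun k => LaurentPolynomial.C (a k)) (shiftB q s f),
    fun k => (Tqp q p s k : Sert), fun k => ?_, ?_, fun Z => ?_⟩
  · simp only [Tqp_eq hs hs0]
    exact isLinearForm_toFun _
  · simp only [Tqp_eq hs hs0]
    refine linearIndependent_toFun (fun k => ?_) fun k => (formT_apply _ _ k).2
    rw [(formT_apply _ _ k).1]
    exact dfac_ne_zero k
  · rw [aeval_coe]
    exact congrArg _ (lhsOp_eq_rhsOp h0 hs hf ha Z)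

lemma opExp_zero {M : Type} [AddCommGroup M] [Module ℂ M] (P : M) :
    opExp (fun _ : M => 0) P = P := by
  have : divPow (0 : Module.End ℂ M) 1 P = 0 := by simp [divPow]
  have h := opExp_eq_sum (0 : Module.End ℂ M) P this
  rw [sum_range_one, divPow_zero] at h
  exact h

lemma logOf_one : logOf (1 : ℂ⟦X⟧) = 0 := by
  rw [← pexp_zero, logOf_pexp (map_zero _)]

/-- Both exponentials are trivial, and the change of variables is the identification T_k = (2k+1)!!
t_{2k+1} itself. -/
theorem coincidesWithHV_one : CoincidesWithHV 1 := by
  refine ⟨_, isHeisenbergVirasoro_of_pos 0 0,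
    fun k => (LinForm.toFun (dfac k • vecE (2 * k + 1)) : Sert), fun k => isLinearForm_toFun _,
    linearIndependent_toFun (fun k => ?_) (fun k i hi => ?_), fun Z => ?_⟩
  · simp [vecE, dfac_ne_zero]
  · rw [Finsupp.smul_apply, vecE, Finsupp.single_apply, if_neg (by omega), smul_zero]
  · have h1 : givental 1 Z = Z := by
      rw [givental, logOf_one]
      have : quantOdd 0 = fun _ => 0 := by
        funext Z
        simp [quantOdd]
      rw [this, opExp_zero]
    have h2 : ∀ P, expJ 0 P = P := by
      intro P
      rw [expJ]
      simp only [Pi.zero_apply, zero_smul, finsum_zero]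
      exact opExp_zero P
    have h3 : ∀ P, expL 0 P = P := by
      intro P
      rw [expL]
      simp only [Pi.zero_apply, zero_smul, finsum_zero]
      exact opExp_zero P
    have h4 : (MvPolynomial.aeval fun k => LinForm.toFun (dfac k • vecE (2 * k + 1))) = oddHom := by
      apply MvPolynomial.algHom_ext
      intro k
      have e1 : tVar ((2 * k + 1 : ℕ) : ℤ) = MvPolynomial.X (oddIdx k) := tVar_nat_coe (oddIdx k)
      have e2 : dfac k * ((2 * k + 1 : ℕ) : ℂ) = (2 * k + 1) * dfac k := by push_cast; ring
      rw [MvPolynomial.aeval_X, oddHom_X, map_smul, toFun_e, smul_smul, e1, e2]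
    rw [h1, h2, h3, aeval_coe, oddTimes_eq, h4]


/-! ### Constant terms -/

lemma constantCoeff_expJneg (b : ℕ+ → Coef) : MvPowerSeries.constantCoeff (expJneg b) = 1 := by
  rw [← MvPowerSeries.coeff_zero_eq_constantCoeff_apply]
  change expJneg b 0 = 1
  rw [expJneg, Finsupp.prod_zero_index]

lemma constantCoeff_expLneg (a : ℕ+ → Coef) (P : Funt) :
    MvPowerSeries.constantCoeff (expLneg a P) = MvPolynomial.constantCoeff P := by
  rw [← MvPowerSeries.coeff_zero_eq_constantCoeff_apply]
  change expLneg a P 0 = _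
  have : wt 0 = 0 := Finsupp.sum_zero_index
  rw [expLneg, this, zero_add, sum_range_one]
  simp [MvPolynomial.constantCoeff_eq]

lemma constantCoeff_scaleL0 (u : Coefˣ) (P : Funt) :
    MvPolynomial.constantCoeff (scaleL0 u P) = MvPolynomial.constantCoeff P := by
  rw [scaleL0]
  induction P using MvPolynomial.induction_on with
  | C a => simp
  | add P Q hP hQ => rw [map_add, map_add, hP, hQ, map_add]
  | mul_X P i hP => simp

lemma constantCoeff_aeval_linearForm {T : ℕ → Sert} (hT : ∀ k, IsLinearForm (T k)) (P : FunT) :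
    MvPowerSeries.constantCoeff (MvPolynomial.aeval T P) = MvPolynomial.constantCoeff P := by
  have hT0 : ∀ k, MvPowerSeries.constantCoeff (T k) = 0 := by
    intro k
    by_contra h
    rw [← MvPowerSeries.coeff_zero_eq_constantCoeff_apply] at h
    have := hT k 0 h
    simp at this
  induction P using MvPolynomial.induction_on with
  | C a =>
    rw [MvPolynomial.aeval_C, MvPolynomial.constantCoeff_C]
    exact MvPowerSeries.constantCoeff_C a
  | add P Q hP hQ => rw [map_add, map_add, hP, hQ, map_add]
  | mul_X P i hP => rw [map_mul, map_mul, MvPolynomial.aeval_X, hT0]; simp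

/-- The constant term as an algebra homomorphism. -/
def constHom (σ : Type) : MvPolynomial σ Coef →ₐ[Coef] Coef where
  toRingHom := MvPolynomial.constantCoeff
  commutes' x := by
    change MvPolynomial.constantCoeff (MvPolynomial.C x) = x
    rw [MvPolynomial.constantCoeff_C]

/-- Setting `ħ = 1`. -/
def setHbar : Coef →ₐ[ℂ] ℂ := AddMonoidAlgebra.lift ℂ ℂ ℤ 1

lemma setHbar_ofC (x : ℂ) : setHbar (ofC x) = x := setHbar.commutes x

lemma covR_zero {ρ : ℂ⟦X⟧} (hρ : coeff 0 ρ = 1) (j : ℕ) : covR ρ j 0 = -coeff (j + 1) ρ := by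
  rw [covR, zero_add, sum_range_one, hρ]
  simp

lemma covOdd_zero {H : ℂ⟦X⟧} (hH : constantCoeff H = 1) (j : ℕ) :
    covOdd H j 0 = -coeff (j + 1) (rhoH H) := by
  rw [covOdd, covH, mul_zero, zero_add, sum_range_one, coeff_succ_rhoH, dfac_zero,
    coeff_zero_eq_constantCoeff_apply, map_pow, hH]
  simp

/-- The column k = 0 of the covariance already contains all of ρ on one side and all of `rhoH H` on
the other. -/
lemma eq_rhoH {ρ H : ℂ⟦X⟧} (hρ : constantCoeff ρ = 1) (hH : constantCoeff H = 1)
    (h : ∀ j k, covOdd H j k = covR ρ j k) : ρ = rhoH H := by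
  ext n
  cases n with
  | zero => rw [coeff_zero_rhoH, coeff_zero_eq_constantCoeff_apply, hρ]
  | succ n =>
    have h1 := h n 0
    rw [covOdd_zero hH, covR_zero (by simpa using hρ)] at h1
    linear_combination h1

/-- A Givental operator in the Heisenberg–Virasoro group has the covariance of a curve. -/
theorem exists_covOdd_eq {R : ℂ⟦X⟧} (hR : IsSymplectic R) (h : CoincidesWithHV R) :
    ∃ H : ℂ⟦X⟧, constantCoeff H = 1 ∧ ∀ j k, covOdd H j k = covR R⁻¹ j k := by
  obtain ⟨G, ⟨c, u, a, b, a', b', hG⟩, T, hT, -, hTG⟩ := h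
  have g1 := (isGaussian_givental hR).comp_algHom (constHom ℕ)
  have g2 := ((isGaussian_oddExpL a).comp_algHom (shiftHom b)).comp_algHom (constHom ℕ+)
  set Φ := (constHom ℕ).toLinearMap ∘ₗ (shiftZ (logOf R)).expA
  set Ψ := (constHom ℕ+).toLinearMap ∘ₗ ((shiftHom b).toLinearMap ∘ₗ oddExpL a)
  -- Constant terms do not see the linear substitution, the raising exponentials or the scaling;
  -- only the scalar c and the lowering exponentials remain. The value at Z = 1 then gives c = 1.
  have key : ∀ Z, Φ Z = c * Ψ Z := by
    intro Z
    have h1 := congrArg MvPowerSeries.constantCoeff (hTG Z)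
    rw [constantCoeff_aeval_linearForm hT, hG, MvPowerSeries.constantCoeff_smul, map_mul,
      constantCoeff_expJneg, constantCoeff_expLneg, constantCoeff_scaleL0, expJ_eq, expL_eq,
      givental_eq, one_mul] at h1
    exact h1
  have hc : (c : Coef) = 1 := by
    have h1 := key 1
    rw [g1.map_one, g2.map_one, mul_one] at h1
    exact h1.symm
  have hΦΨ : ∀ Z, Φ Z = Ψ Z := fun Z => by rw [key, hc, one_mul]
  -- The parameters a_k may involve ħ. Setting ħ = 1 gives a curve over ℂ and keeps the equality of
  -- covariances, as those of the Givental side are free of ħ.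
  refine ⟨PowerSeries.map setHbar.toRingHom (flowH (serA a)), ?_, fun j k => ?_⟩
  · rw [← coeff_zero_eq_constantCoeff_apply, PowerSeries.coeff_map,
      coeff_zero_eq_constantCoeff_apply, constantCoeff_flowH, map_one]
  · have h1 := hΦΨ (MvPolynomial.X j * MvPolynomial.X k)
    have h2 := hΦΨ (MvPolynomial.X j)
    have h3 := hΦΨ (MvPolynomial.X k)
    rw [g1.map_X, g2.map_X] at h2 h3
    rw [g1.map_X_mul_X, g2.map_X_mul_X, h2, h3] at h1
    have h4 := congrArg setHbar (add_left_cancel h1)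
    rw [covOdd_map]
    exact h4.symm.trans (setHbar_ofC _)

/-- The quadratic relation between covariances of a Givental operator. -/
lemma covR_succ (ρ : ℂ⟦X⟧) (j k : ℕ) : covR ρ (j + 1) k + covR ρ j (k + 1) =
    -(coeff (j + 1) ρ * coeff (k + 1) ρ) := by
  rw [covR, covR, sum_range_succ _ (k + 1), ← add_assoc, ← sum_add_distrib, sum_eq_zero, zero_add,
    Nat.sub_self]
  · ring_nf
  · intro n hn
    rw [mem_range] at hn
    rw [show k + 1 - n = k - n + 1 by omega, show j + 1 + 1 + (k - n) = j + 1 + (k - n + 1) by ring]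
    ring

/-! ### Invariance of the covariance under Möbius transformations -/

/-- The pairing defining the covariance. -/
def covPair (i j : ℕ) : ℂ⟦X⟧ →ₗ[ℂ] ℂ⟦X⟧ →ₗ[ℂ] ℂ :=
  LinearMap.mk₂ ℂ (fun g h => ∑ n ∈ range j, ((j - n : ℕ) : ℂ) * coeff n h * coeff (i + (j - n)) g)
    (fun g g' h => by simp only [map_add, mul_add, sum_add_distrib])
    (fun c g h => by
      simp only [PowerSeries.coeff_smul, smul_eq_mul, mul_sum]
      exact sum_congr rfl fun n _ => by ring)
    (fun g h h' => by simp only [map_add, mul_add, add_mul, sum_add_distrib])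
    (fun c g h => by
      simp only [PowerSeries.coeff_smul, smul_eq_mul, mul_sum]
      exact sum_congr rfl fun n _ => by ring)

lemma covPair_apply (i j : ℕ) (g h : ℂ⟦X⟧) : covPair i j g h =
    ∑ n ∈ range j, ((j - n : ℕ) : ℂ) * coeff n h * coeff (i + (j - n)) g := rfl

lemma covH_eq_covPair (H : ℂ⟦X⟧) (i j : ℕ) : covH H i j = covPair i j (H ^ i) (H ^ j) := rfl

/-- The gauge transform `(1 + c z) H (z / (1 + c z))`. -/
def gauge (c : ℂ) (H : ℂ⟦X⟧) : ℂ⟦X⟧ := expo (vf (PowerSeries.C c * X) (PowerSeries.C c * X)) H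

lemma constantCoeff_gauge (c : ℂ) (H : ℂ⟦X⟧) : constantCoeff (gauge c H) = constantCoeff H :=
  constantCoeff_expo _ _

lemma coeff_succ_vf_gauge (c : ℂ) (i : ℕ) (g : ℂ⟦X⟧) (m : ℕ) :
    coeff (m + 1) (vf (PowerSeries.C c * X) ((i : ℂ⟦X⟧) * (PowerSeries.C c * X)) g) =
      c * (i - m) * coeff m g := by
  have : vf (PowerSeries.C c * X) ((i : ℂ⟦X⟧) * (PowerSeries.C c * X)) g =
      PowerSeries.C c * (X * (PowerSeries.C (i : ℂ) * g - X * derivative ℂ g)) := by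
    rw [vf_apply, map_natCast]
    ring
  rw [this, coeff_C_mul, coeff_succ_X_mul, map_sub, coeff_C_mul, coeff_X_mul_derivative]
  ring

lemma coeff_zero_vf_gauge (c : ℂ) (i : ℕ) (g : ℂ⟦X⟧) :
    coeff 0 (vf (PowerSeries.C c * X) ((i : ℂ⟦X⟧) * (PowerSeries.C c * X)) g) = 0 := by
  simp [vf_apply]

/-- The pairing is, up to sign, a residue of z⁻ⁱ g against the differential of the negative part of
z⁻ʲ h. The field z² ∂/∂z respects the truncation: it sends z⁻¹ to constants, whose differential
vanishes, and kills constants. This reflects that L_1 has no second order term. -/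
theorem covH_gauge (c : ℂ) (H : ℂ⟦X⟧) (i j : ℕ) : covH (gauge c H) i j = covH H i j := by
  have hc : constantCoeff (PowerSeries.C c * X : ℂ⟦X⟧) = 0 := by simp
  have hr : ∀ i : ℕ, Raises (vf (PowerSeries.C c * X) ((i : ℂ⟦X⟧) * (PowerSeries.C c * X))) :=
    fun i => raises_vf hc (by simp)
  rw [covH_eq_covPair, covH_eq_covPair, gauge, ← expo_vf_nsmul hc, ← expo_vf_nsmul hc]
  refine expo_pairing (hr i) (hr j) (covPair i j) (i + j + 1) (fun g k hg => ?_) (fun g k hk => ?_)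
    (fun g k => ?_) _ _
  · rw [covPair_apply]
    exact sum_eq_zero fun n _ => by rw [hg _ (by omega), mul_zero]
  · rw [covPair_apply]
    refine sum_eq_zero fun n hn => ?_
    rw [mem_range] at hn
    rw [hk _ (by omega), mul_zero, zero_mul]
  · rw [covPair_apply, covPair_apply]
    cases j with
    | zero => simp
    | succ j =>
      rw [sum_range_succ, sum_range_succ' (fun n => ((j + 1 - n : ℕ) : ℂ) *
        coeff n (vf (PowerSeries.C c * X) (((j + 1 : ℕ) : ℂ⟦X⟧) * (PowerSeries.C c * X)) k) *
        coeff (i + (j + 1 - n)) g), coeff_zero_vf_gauge]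
      rw [show i + (j + 1 - j) = i + 1 by omega, coeff_succ_vf_gauge, sub_self, mul_zero, zero_mul,
        mul_zero, mul_zero, zero_mul, add_zero, add_zero, ← sum_add_distrib]
      refine sum_eq_zero fun n hn => ?_
      rw [mem_range] at hn
      obtain ⟨r, rfl⟩ : ∃ r, j = n + r + 1 := ⟨j - n - 1, by omega⟩
      rw [show n + r + 1 + 1 - n = r + 1 + 1 by omega, show n + r + 1 + 1 - (n + 1) = r + 1 by omega,
        ← add_assoc, coeff_succ_vf_gauge, coeff_succ_vf_gauge]
      push_cast
      ring

lemma covOdd_gauge (c : ℂ) (H : ℂ⟦X⟧) (j k : ℕ) : covOdd (gauge c H) j k = covOdd H j k := by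
  rw [covOdd, covH_gauge, covOdd]

lemma coeff_one_gauge (c : ℂ) {H : ℂ⟦X⟧} (hH : constantCoeff H = 1) :
    coeff 1 (gauge c H) = coeff 1 H + c := by
  have hr : Raises (vf (PowerSeries.C c * X) (PowerSeries.C c * X) : Module.End ℂ ℂ⟦X⟧) :=
    raises_vf (by simp) (by simp)
  have h := coeff_succ_vf_gauge c 1 H 0
  rw [Nat.cast_one, one_mul] at h
  rw [gauge, hr.coeff_expo H (N := 2) (by omega), sum_range_succ, sum_range_one, divPow_zero,
    map_add, divPow_apply]
  simp only [Function.iterate_one, Nat.factorial_one, Nat.cast_one, inv_one, one_smul]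
  rw [h, coeff_zero_eq_constantCoeff_apply, hH]
  simp

lemma gauge_one_add (c α : ℂ) :
    gauge c (1 + PowerSeries.C α * X) = 1 + PowerSeries.C (α + c) * X := by
  have hr : Raises (vf (PowerSeries.C c * X) (PowerSeries.C c * X) : Module.End ℂ ℂ⟦X⟧) :=
    raises_vf (by simp) (by simp)
  have e0 : vf (PowerSeries.C c * X) (PowerSeries.C c * X) (1 + PowerSeries.C α * X) =
      PowerSeries.C c * X := by
    rw [vf_apply, map_add, Derivation.leibniz, derivative_one, derivative_C, derivative_X]
    simp only [smul_eq_mul]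
    ring
  have e1 : vf (PowerSeries.C c * X) (PowerSeries.C c * X) (PowerSeries.C c * X) = 0 := by
    rw [vf_apply, Derivation.leibniz, derivative_C, derivative_X]
    simp only [smul_eq_mul]
    ring
  have e2 : divPow (vf (PowerSeries.C c * X) (PowerSeries.C c * X)) 2
      (1 + PowerSeries.C α * X) = 0 := by
    rw [divPow_apply, Function.iterate_succ_apply, Function.iterate_one, e0, e1, smul_zero]
  ext n
  rw [gauge, hr.coeff_expo _ (N := n + 1 + 1) (by omega), sum_range_succ', sum_range_succ',
    sum_eq_zero, zero_add, divPow_zero, zero_add, divPow_apply, Function.iterate_one, e0,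
    Nat.factorial_one, Nat.cast_one, inv_one, one_smul, map_add PowerSeries.C]
  · congr 1
    ring
  · intro j _
    exact divPow_eq_zero e2 (by omega)

/-- The gauge transformation of the equation of the curve. -/
lemma gauge_eqn (c : ℂ) {H U : ℂ⟦X⟧} (h : H ^ 3 = U * (H - X * derivative ℂ H)) :
    gauge c H ^ 3 = expo (vf (PowerSeries.C c * X)
      (((3 : ℕ) : ℂ⟦X⟧) * (PowerSeries.C c * X))) U *
        (gauge c H - X * derivative ℂ (gauge c H)) := by
  have hc : constantCoeff (PowerSeries.C c * X : ℂ⟦X⟧) = 0 := by simp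
  -- The operator g ↦ g - z g' intertwines the zeroth order term c z with 0. As H³ carries 3 c z, so
  -- must U.
  have h1 : expo (vf (PowerSeries.C c * X) 0) (H - X * derivative ℂ H) =
      gauge c H - X * derivative ℂ (gauge c H) := by
    let L : ℂ⟦X⟧ →ₗ[ℂ] ℂ⟦X⟧ := vf 1 1
    have hL : ∀ g, L g = g - X * derivative ℂ g := fun g => by
      change vf 1 1 g = _
      rw [vf_apply, one_mul, one_mul]
    rw [← hL, ← hL]
    refine (Raises.apply_expo (raises_vf hc hc) (raises_vf hc (by simp)) (e := id) (fun n => le_rfl)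
      (fun n g hg => ?_) (fun g => ?_) H).symm
    · rw [hL, map_sub, coeff_X_mul_derivative, hg n le_rfl]
      ring
    · rw [hL, hL, vf_apply, vf_apply]
      simp only [map_sub, Derivation.leibniz, derivative_X, derivative_C, smul_eq_mul]
      ring
  rw [← h1, gauge, ← expo_vf_nsmul hc, h, ← expo_vf_mul hc (by simp) (by simp), add_zero]

/-- Each linear factor absorbs one of the three terms c z, so a Möbius transformation adds c to all
three parameters; a suitable c makes one factor equal to 1. -/
lemma expo_vf_three (c α₁ α₂ α₃ : ℂ) :
    expo (vf (PowerSeries.C c * X) (((3 : ℕ) : ℂ⟦X⟧) * (PowerSeries.C c * X)))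
      ((1 + PowerSeries.C α₁ * X) * (1 + PowerSeries.C α₂ * X) * (1 + PowerSeries.C α₃ * X)) =
    (1 + PowerSeries.C (α₁ + c) * X) * (1 + PowerSeries.C (α₂ + c) * X) *
      (1 + PowerSeries.C (α₃ + c) * X) := by
  have hc : constantCoeff (PowerSeries.C c * X : ℂ⟦X⟧) = 0 := by simp
  rw [← gauge_one_add, ← gauge_one_add, ← gauge_one_add, gauge, gauge, gauge, ← expo_vf_mul hc hc hc,
    ← expo_vf_mul hc (by simp) hc]
  congr 2
  push_cast
  ring


/-! ### The quadratic relations of a curve -/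

/-- The polar part of the quadratic relation. -/
def quadN (H U : ℂ⟦X⟧) (n k : ℕ) : ℂ :=
  ∑ m ∈ range k, (k - m : ℂ) * coeff m (H ^ k) *
    ∑ l ∈ range n, (n - l : ℂ) * coeff l (H ^ n) * coeff (n - l + (k - m) + 2) U

lemma coeff_pow_add_two {H U : ℂ⟦X⟧} (h : H ^ 3 = U * (H - X * derivative ℂ H)) (n k : ℕ) :
    n * coeff k (H ^ (n + 2)) =
      ∑ m ∈ range (k + 1), (n - m : ℂ) * coeff m (H ^ n) * coeff (k - m) U := by
  have h1 : PowerSeries.C (n : ℂ) * H ^ (n + 2) =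
      (PowerSeries.C (n : ℂ) * H ^ n - X * derivative ℂ (H ^ n)) * U := by
    cases n with
    | zero => simp
    | succ n =>
      rw [derivative_pow, Nat.add_sub_cancel, map_natCast]
      linear_combination ((n + 1 : ℕ) : ℂ⟦X⟧) * H ^ n * h
  have h2 := congrArg (coeff k) h1
  rw [coeff_C_mul, coeff_mul, Nat.sum_antidiagonal_eq_sum_range_succ_mk] at h2
  rw [h2]
  refine sum_congr rfl fun m _ => ?_
  rw [map_sub, coeff_C_mul, coeff_X_mul_derivative]
  ring

lemma coeff_pow_add_two_split {H U : ℂ⟦X⟧} (h : H ^ 3 = U * (H - X * derivative ℂ H)) (n r : ℕ) :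
    n * coeff (n + 2 + r) (H ^ (n + 2)) =
      ∑ l ∈ range n, (n - l : ℂ) * coeff l (H ^ n) * coeff (n - l + r + 2) U -
      ∑ t ∈ range (r + 2), (t + 1 : ℂ) * coeff (n + 1 + t) (H ^ n) * coeff (r + 1 - t) U := by
  rw [coeff_pow_add_two h, show n + 2 + r + 1 = n + 1 + (r + 2) by ring, sum_range_add,
    sum_range_succ, sub_self, zero_mul, zero_mul, add_zero, sub_eq_add_neg, ← sum_neg_distrib]
  congr 1
  · refine sum_congr rfl fun l hl => ?_
    rw [mem_range] at hl
    rw [show n + 2 + r - l = n - l + r + 2 by omega]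
  · refine sum_congr rfl fun t ht => ?_
    rw [show n + 2 + r - (n + 1 + t) = r + 1 - t by omega]
    push_cast
    ring

/-- The cubic equation expands H^{n+2} and H^{k+2} in terms of H^n, H^k and U. The terms with
coefficients of H^n beyond degree n cancel between the two expansions, except for the one with m = k
+ 1 and t = 0; what remains is `quadN`. -/
theorem covH_add_covH {H U : ℂ⟦X⟧} (h : H ^ 3 = U * (H - X * derivative ℂ H)) (n k : ℕ) :
    n * covH H (n + 2) k + k * covH H n (k + 2) =
      quadN H U n k - coeff 0 U * coeff (n + 1) (H ^ n) * coeff (k + 1) (H ^ k) := by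
  have h1 : n * covH H (n + 2) k = quadN H U n k -
      ∑ m ∈ range k, ∑ t ∈ range (k - m + 2), (k - m : ℂ) * coeff m (H ^ k) *
        ((t + 1 : ℂ) * coeff (n + 1 + t) (H ^ n) * coeff (k - m + 1 - t) U) := by
    rw [covH, quadN, mul_sum, ← sum_sub_distrib]
    refine sum_congr rfl fun m hm => ?_
    rw [mem_range] at hm
    have h2 := coeff_pow_add_two_split h n (k - m)
    rw [← mul_sum, ← mul_sub, ← h2, Nat.cast_sub hm.le]
    ring
  have h2 : k * covH H n (k + 2) = ∑ m ∈ range (k + 2), ∑ t ∈ range (k + 2 - m),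
      (k - m : ℂ) * coeff m (H ^ k) *
        ((t + 1 : ℂ) * coeff (n + 1 + t) (H ^ n) * coeff (k + 1 - m - t) U) := by
    rw [covH, ← sum_range_reflect, mul_sum,
      sum_comm' (t' := range (k + 2)) (s' := fun t => range (k + 2 - t))
        (fun m t => by simp only [mem_range]; omega)]
    refine sum_congr rfl fun t ht => ?_
    rw [mem_range] at ht
    rw [show k + 2 - (k + 2 - 1 - t) = t + 1 by omega, show k + 2 - 1 - t = k + 1 - t by omega,
      show k + 2 - t = k + 1 - t + 1 by omega, ← add_assoc, add_right_comm n]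
    have h3 := coeff_pow_add_two h k (k + 1 - t)
    rw [show (k : ℂ) * (((t + 1 : ℕ) : ℂ) * coeff (k + 1 - t) (H ^ (k + 2)) *
      coeff (n + 1 + t) (H ^ n)) = (k : ℂ) * coeff (k + 1 - t) (H ^ (k + 2)) *
      (((t + 1 : ℕ) : ℂ) * coeff (n + 1 + t) (H ^ n)) by ring, h3, sum_mul]
    refine sum_congr rfl fun m _ => ?_
    rw [Nat.sub_right_comm]
    push_cast
    ring
  rw [h1, h2, sum_range_succ, sum_range_succ, show k + 2 - (k + 1) = 1 by omega, sum_range_one,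
    sub_self]
  simp only [zero_mul, sum_const_zero, add_zero, Nat.sub_self]
  rw [sum_congr rfl fun m hm => by
    rw [show k - m + 2 = k + 2 - m by rw [mem_range] at hm; omega,
      show k - m + 1 = k + 1 - m by rw [mem_range] at hm; omega]]
  push_cast
  ring

/-- The quadratic relations satisfied by a curve with the covariance of a Givental operator. -/
theorem quadN_eq_zero {ρ H U : ℂ⟦X⟧} (hρ : constantCoeff ρ = 1) (hH : constantCoeff H = 1)
    (hU : constantCoeff U = 1) (h : H ^ 3 = U * (H - X * derivative ℂ H))
    (hc : ∀ j k, covOdd H j k = covR ρ j k) (j k : ℕ) :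
    quadN H U (2 * j + 1) (2 * k + 1) = 0 := by
  have h1 := covR_succ ρ j k
  rw [← hc, ← hc, eq_rhoH hρ hH hc, coeff_succ_rhoH, coeff_succ_rhoH, covOdd, covOdd, dfac_succ,
    dfac_succ] at h1
  -- The product of coefficients here is the product of two coefficients of ρ in `covR_succ` up to
  -- double factorials, so only the polar part is left.
  have h2 := covH_add_covH h (2 * j + 1) (2 * k + 1)
  rw [coeff_zero_eq_constantCoeff_apply, hU] at h2
  have h3 : dfac j * dfac k ≠ 0 := mul_ne_zero (dfac_ne_zero j) (dfac_ne_zero k)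
  refine (mul_eq_zero.mp ?_).resolve_left h3
  rw [smul_eq_mul, smul_eq_mul, show 2 * (j + 1) + 1 = 2 * j + 1 + 2 by ring,
    show 2 * (k + 1) + 1 = 2 * k + 1 + 2 by ring] at h1
  push_cast at h2
  linear_combination h1 - dfac j * dfac k * h2


/-! ### Series without odd terms of low degree -/

/-- The odd coefficients below degree `d` vanish. -/
def OddFree (d : ℕ) (g : ℂ⟦X⟧) : Prop := ∀ m, Odd m → m < d → coeff m g = 0

lemma OddFree.coeff_mul {d : ℕ} (hd : Odd d) {g h : ℂ⟦X⟧} (hg : OddFree d g) (hh : OddFree d h) :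
    coeff d (g * h) = coeff d g * coeff 0 h + coeff 0 g * coeff d h := by
  rw [PowerSeries.coeff_mul]
  refine sum_eq_add (d, 0) (0, d) (fun h => hd.pos.ne' (Prod.ext_iff.mp h).1) (fun x hx hne => ?_)
    (fun h => absurd (HasAntidiagonal.mem_antidiagonal.mpr (add_zero d)) h)
    (fun h => absurd (HasAntidiagonal.mem_antidiagonal.mpr (zero_add d)) h)
  obtain ⟨i, j⟩ := x
  rw [HasAntidiagonal.mem_antidiagonal] at hx
  change i + j = d at hx
  have hi : i ≠ 0 := by
    rintro rfl
    exact hne.2 (by rw [← hx, zero_add])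
  have hj : j ≠ 0 := by
    rintro rfl
    exact hne.1 (by rw [← hx, add_zero])
  rcases Nat.even_or_odd i with hi' | hi'
  · have : Odd j := by
      rw [← hx, Nat.odd_add'] at hd
      exact hd.mpr hi'
    change _ * coeff j h = 0
    rw [hh j this (by omega), mul_zero]
  · change coeff i g * _ = 0
    rw [hg i hi' (by omega), zero_mul]

lemma OddFree.mono {d e : ℕ} (hde : d ≤ e) {g : ℂ⟦X⟧} (hg : OddFree e g) : OddFree d g :=
  fun m hm hmd => hg m hm (hmd.trans_le hde)

lemma OddFree.mul {d : ℕ} {g h : ℂ⟦X⟧} (hg : OddFree d g) (hh : OddFree d h) :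
    OddFree d (g * h) := fun m hm hmd => by
  rw [(hg.mono hmd.le).coeff_mul hm (hh.mono hmd.le), hg m hm hmd, hh m hm hmd, zero_mul, mul_zero,
    add_zero]

lemma oddFree_one (d : ℕ) : OddFree d 1 := fun m hm _ => by
  rw [coeff_one, if_neg hm.pos.ne']

lemma OddFree.pow {d : ℕ} {g : ℂ⟦X⟧} (hg : OddFree d g) (n : ℕ) : OddFree d (g ^ n) := by
  induction n with
  | zero => exact pow_zero g ▸ oddFree_one d
  | succ n ih => exact pow_succ g n ▸ ih.mul hg

lemma OddFree.coeff_pow {d : ℕ} (hd : Odd d) {g : ℂ⟦X⟧} (hg : OddFree d g)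
    (h0 : constantCoeff g = 1) (n : ℕ) : coeff d (g ^ n) = n * coeff d g := by
  induction n with
  | zero => simp [coeff_one, hd.pos.ne']
  | succ n ih =>
    rw [pow_succ, (hg.pow n).coeff_mul hd hg, ih, coeff_zero_eq_constantCoeff_apply,
      coeff_zero_eq_constantCoeff_apply, map_pow, h0]
    push_cast
    ring

section

variable {H U : ℂ⟦X⟧}

/-- In the odd degree d only products with constant terms survive in the cubic equation: 3 h_d = u_d
+ (1 - d) h_d. -/
lemma coeff_eq_of_oddFree (hH : constantCoeff H = 1) (hU : constantCoeff U = 1)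
    (h : H ^ 3 = U * (H - X * derivative ℂ H)) {d : ℕ} (hd : Odd d) (hHd : OddFree d H)
    (hUd : OddFree d U) : (d + 2) * coeff d H = coeff d U := by
  have hc : ∀ m, coeff m (H - X * derivative ℂ H) = (1 - m) * coeff m H := fun m => by
    rw [map_sub, coeff_X_mul_derivative]
    ring
  have hG : OddFree d (H - X * derivative ℂ H) := fun m hm hmd => by
    rw [hc, hHd m hm hmd, mul_zero]
  have h1 := congrArg (coeff d) h
  rw [hHd.coeff_pow hd hH, hUd.coeff_mul hd hG, hc, hc, coeff_zero_eq_constantCoeff_apply,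
    coeff_zero_eq_constantCoeff_apply, hH, hU] at h1
  push_cast at h1
  linear_combination h1

lemma oddFree_of_oddFree (hH : constantCoeff H = 1) (hU : constantCoeff U = 1)
    (h : H ^ 3 = U * (H - X * derivative ℂ H)) {d : ℕ} (hUd : OddFree d U) : OddFree d H := by
  intro m hm
  induction m using Nat.strong_induction_on with
  | _ m ih =>
    intro hmd
    have h1 := coeff_eq_of_oddFree hH hU h hm (fun i hi him => ih i him hi (him.trans hmd))
      (hUd.mono hmd.le)
    rw [hUd m hm hmd] at h1
    exact (mul_eq_zero.mp h1).resolve_left (by exact_mod_cast (m + 1).succ_ne_zero)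

/-! ### Vanishing of the higher coefficients of the curve -/

lemma quadN_one (hH : constantCoeff H = 1) (k : ℕ) : quadN H U 1 k =
    ∑ m ∈ range k, (k - m : ℂ) * coeff m (H ^ k) * coeff (k + 3 - m) U := by
  refine sum_congr rfl fun m hm => ?_
  rw [mem_range] at hm
  rw [sum_range_one, pow_one, coeff_zero_eq_constantCoeff_apply, hH,
    show 1 - 0 + (k - m) + 2 = k + 3 - m by omega]
  simp

lemma quadN_three (hH : constantCoeff H = 1) (h1 : coeff 1 H = 0) (k : ℕ) : quadN H U 3 k =
    3 * ∑ m ∈ range k, (k - m : ℂ) * coeff m (H ^ k) * coeff (k + 5 - m) U +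
    coeff 2 (H ^ 3) * ∑ m ∈ range k, (k - m : ℂ) * coeff m (H ^ k) * coeff (k + 3 - m) U := by
  have h3 : coeff 1 (H ^ 3) = 0 := by
    rw [OddFree.coeff_pow odd_one (fun m hm hm1 => absurd hm.pos (by omega)) hH, h1, mul_zero]
  rw [quadN, mul_sum, mul_sum, ← sum_add_distrib]
  refine sum_congr rfl fun m hm => ?_
  rw [mem_range] at hm
  rw [sum_range_succ, sum_range_succ, sum_range_one, h3,
    show coeff 0 (H ^ 3) = 1 by simp [hH], show 3 - 0 + (k - m) + 2 = k + 5 - m by omega, show 3 - 2 + (k - m) + 2 = k + 3 - m by omega]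
  push_cast
  ring

lemma sum_eq_two_terms (hH : constantCoeff H = 1) {d κ : ℕ} (N : ℕ) (hd : d ≠ 0) (hκ : κ ≠ 0)
    (hdκ : d ≤ κ)
    (hz : ∀ m, m ≠ 0 → m < κ → m ≠ d → coeff m (H ^ κ) * coeff (N - m) U = 0) :
    ∑ m ∈ range κ, (κ - m : ℂ) * coeff m (H ^ κ) * coeff (N - m) U =
      κ * coeff N U + (κ - d) * coeff d (H ^ κ) * coeff (N - d) U := by
  rw [sum_eq_add 0 d hd.symm (fun m hm hne => ?_) (fun h0 => ?_) (fun hd' => ?_)]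
  · rw [coeff_zero_eq_constantCoeff_apply, map_pow, hH]
    simp
  · rw [mul_assoc, hz m hne.1 (mem_range.mp hm) hne.2, mul_zero]
  · exact absurd (mem_range.mpr (Nat.pos_of_ne_zero hκ)) h0
  · rw [mem_range, not_lt] at hd'
    rw [le_antisymm hdκ hd', sub_self, zero_mul, zero_mul]

lemma sum_eq_first_term (hH : constantCoeff H = 1) {κ : ℕ} (N : ℕ) (hκ : κ ≠ 0)
    (hz : ∀ m, m ≠ 0 → m < κ → coeff m (H ^ κ) * coeff (N - m) U = 0) :
    ∑ m ∈ range κ, (κ - m : ℂ) * coeff m (H ^ κ) * coeff (N - m) U = κ * coeff N U := by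
  rw [sum_eq_two_terms hH N hκ hκ le_rfl fun m h0 hm _ => hz m h0 hm, sub_self, zero_mul, zero_mul,
    add_zero]

/-- The relation with first index 1 reads κ u_{κ+3} + (products of coefficients of H^κ and U) = 0.
The products with odd m vanish by `hz`, those with even m by induction. -/
lemma coeff_even_eq_zero (hH : constantCoeff H = 1) (hN : ∀ k, quadN H U 1 (2 * k + 1) = 0)
    {M : ℕ} (hz : ∀ N m κ, Even N → N ≤ M → Odd m → 4 ≤ N - m →
      coeff m (H ^ κ) * coeff (N - m) U = 0) (i : ℕ) (hi : Even i) (h4 : 4 ≤ i) (hiM : i ≤ M) :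
    coeff i U = 0 := by
  induction i using Nat.strong_induction_on with
  | _ i ih =>
    obtain ⟨r, rfl⟩ : ∃ r, i = 2 * r + 1 + 3 := by
      obtain ⟨s, rfl⟩ := hi
      exact ⟨s - 2, by omega⟩
    have h := hN r
    rw [quadN_one hH, sum_eq_first_term hH _ (by omega) (fun m h0 hm => ?_)] at h
    · exact (mul_eq_zero.mp h).resolve_left (by exact_mod_cast (2 * r).succ_ne_zero)
    · rcases Nat.even_or_odd m with hm' | hm'
      · rw [ih _ (by omega) (hi.tsub hm') (by omega) (by omega), mul_zero]
      · exact hz _ _ _ hi hiM hm' (by omega)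

/-- Induction on k; even k follow from the relations with first index 1. For odd k with u_k ≠ 0, let
d be the lowest odd degree in which U is nonzero. In total degree k + d only u_{k+d} and h_d u_k
survive, and the relations with first index 1 and 3 give u_{k+d} + (κ - d) h_d u_k = 0 for κ = k + d
- 3 and κ = k + d - 5. Subtracting them forces h_d u_k = 0. -/
theorem coeff_eq_zero_of_quadN (hH : constantCoeff H = 1) (hU : constantCoeff U = 1)
    (h : H ^ 3 = U * (H - X * derivative ℂ H)) (h1 : coeff 1 H = 0)
    (hN : ∀ j k, quadN H U (2 * j + 1) (2 * k + 1) = 0) {k : ℕ} (hk : 4 ≤ k) : coeff k U = 0 := by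
  have hN1 : ∀ k, quadN H U 1 (2 * k + 1) = 0 := fun k => hN 0 k
  have hN3 : ∀ k, quadN H U 3 (2 * k + 1) = 0 := fun k => hN 1 k
  have hU1 : coeff 1 U = 0 := by
    rw [← coeff_eq_of_oddFree hH hU h odd_one (fun m hm hm1 => absurd hm.pos (by omega))
      (fun m hm hm1 => absurd hm.pos (by omega)), h1, mul_zero]
  induction k using Nat.strong_induction_on with
  | _ k ih =>
  by_contra hne
  rcases Nat.even_or_odd k with hke | hko
  · refine hne (coeff_even_eq_zero hH hN1 (M := k) (fun N m κ _ hNk hm h4 => ?_) k hke hk le_rfl)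
    have := hm.pos
    rw [ih _ (by omega) h4, mul_zero]
  -- By the induction hypothesis and [z]U = 0, the lowest odd degree occurring in U can only be 3 or
  -- k.
  · obtain ⟨d, hdo, hd3, hUd, hd0⟩ : ∃ d, Odd d ∧ 3 ≤ d ∧ OddFree d U ∧ coeff d U ≠ 0 := by
      by_cases h3 : coeff 3 U = 0
      · refine ⟨k, hko, by omega, fun m hm hmk => ?_, hne⟩
        by_cases hm4 : 4 ≤ m
        · exact ih m hmk hm4
        · obtain rfl | rfl : m = 1 ∨ m = 3 := by
            obtain ⟨r, rfl⟩ := hm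
            omega
          exacts [hU1, h3]
      · refine ⟨3, by decide, le_rfl, fun m hm hmk => ?_, h3⟩
        obtain rfl : m = 1 := by
          obtain ⟨r, rfl⟩ := hm
          omega
        exact hU1
    have hHd := oddFree_of_oddFree hH hU h hUd
    have hHd0 : coeff d H ≠ 0 := by
      intro h0
      rw [← coeff_eq_of_oddFree hH hU h hdo hHd hUd, h0, mul_zero] at hd0
      exact hd0 rfl
    have hodd : ∀ N m κ, Odd m → N < k + d ∨ N = k + d ∧ m ≠ d → 4 ≤ N - m →
        coeff m (H ^ κ) * coeff (N - m) U = 0 := by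
      intro N m κ hm hN h4
      rcases lt_or_ge m d with hmd | hmd
      · rw [hHd.pow κ m hm hmd, zero_mul]
      · rw [ih _ (by omega) h4, mul_zero]
    have heven : ∀ i, Even i → 4 ≤ i → i < k + d → coeff i U = 0 := fun i hi h4 hik =>
      coeff_even_eq_zero hH hN1 (M := i)
        (fun N m κ _ hNi hm h4 => hodd N m κ hm (Or.inl (by omega)) h4) i hi h4 le_rfl
    have hz : ∀ N m κ, Even N → N ≤ k + d → m ≠ 0 → N < k + d ∨ m ≠ d → 4 ≤ N - m →
        coeff m (H ^ κ) * coeff (N - m) U = 0 := by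
      intro N m κ hN hNk hm0 hmd h4
      rcases Nat.even_or_odd m with hm | hm
      · rw [heven _ (hN.tsub hm) h4 (by omega), mul_zero]
      · exact hodd N m κ hm (by omega) h4
    obtain ⟨r, hr⟩ : ∃ r, k + d = 2 * r + 3 + 3 := by
      obtain ⟨a, rfl⟩ := hko
      obtain ⟨b, rfl⟩ := hdo
      exact ⟨a + b - 2, by omega⟩
    have hk5 : 5 ≤ k := by
      obtain ⟨a, rfl⟩ := hko
      omega
    have hNe : Even (2 * r + 6) := ⟨r + 3, by ring⟩
    have e1 := hN1 (r + 1)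
    have e3 := hN3 r
    rw [quadN_one hH, show 2 * (r + 1) + 1 + 3 = 2 * r + 6 by ring,
      sum_eq_two_terms hH (d := d) _ (by omega) (by omega) (by omega)
        (fun m h0 hm hmd => hz _ m _ hNe (by omega) h0 (Or.inr hmd) (by omega)),
      hHd.coeff_pow hdo hH, show 2 * r + 6 - d = k by omega] at e1
    rw [quadN_three hH h1, show 2 * r + 1 + 5 = 2 * r + 6 by ring,
      sum_eq_two_terms hH (d := d) _ (by omega) (by omega) (by omega)
        (fun m h0 hm hmd => hz _ m _ hNe (by omega) h0 (Or.inr hmd) (by omega)),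
      hHd.coeff_pow hdo hH, show 2 * r + 6 - d = k by omega,
      sum_eq_first_term hH _ (by omega)
        (fun m h0 hm => hz _ m _ ⟨r + 2, by ring⟩ (by omega) h0 (Or.inl (by omega)) (by omega)),
      heven (2 * r + 1 + 3) ⟨r + 2, by ring⟩ (by omega) (by omega), mul_zero, mul_zero, add_zero] at e3
    have hr1 : (2 * r + 1 : ℂ) ≠ 0 := by exact_mod_cast (2 * r).succ_ne_zero
    have hr3 : (2 * r + 3 : ℂ) ≠ 0 := by exact_mod_cast (2 * r + 2).succ_ne_zero
    push_cast at e1 e3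
    have e1' : (2 * r + 3 : ℂ) * (coeff (2 * r + 6) U +
        (2 * r + 3 - d) * coeff d H * coeff k U) = 0 := by linear_combination e1
    have e3' : (2 * r + 1 : ℂ) * (coeff (2 * r + 6) U +
        (2 * r + 1 - d) * coeff d H * coeff k U) = 0 := by linear_combination e3 / 3
    have e4 := (mul_eq_zero.mp e1').resolve_left hr3
    have e5 := (mul_eq_zero.mp e3').resolve_left hr1
    refine mul_ne_zero hHd0 hne ?_
    linear_combination (e4 - e5) / 2

end


/-! ### Classification of the Givental operators in the Heisenberg–Virasoro group -/

lemma exists_factorization (u v : ℂ) : ∃ a b c : ℂ,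
    a + b + c = 0 ∧ a * b + b * c + c * a = u ∧ a * b * c = v := by
  obtain ⟨a, ha⟩ := IsAlgClosed.exists_root
    (Polynomial.X ^ 3 + Polynomial.C u * Polynomial.X - Polynomial.C v : Polynomial ℂ) (by
      have : (Polynomial.X ^ 3 + Polynomial.C u * Polynomial.X - Polynomial.C v :
        Polynomial ℂ).degree = 3 := by compute_degree!
      rw [this]
      decide)
  -- The other two roots have sum -a and product u + a²; δ is a square root of the discriminant of
  -- their quadratic equation.
  obtain ⟨δ, hδ⟩ := IsAlgClosed.exists_pow_nat_eq (a ^ 2 - 4 * (u + a ^ 2)) (n := 2) (by omega)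
  simp only [Polynomial.IsRoot, Polynomial.eval_sub, Polynomial.eval_add, Polynomial.eval_pow,
    Polynomial.eval_mul, Polynomial.eval_X, Polynomial.eval_C] at ha
  refine ⟨a, (-a + δ) / 2, (-a - δ) / 2, by ring, ?_, ?_⟩
  · linear_combination -hδ / 4
  · linear_combination ha - a * hδ / 4

lemma exists_eq_prod {U : ℂ⟦X⟧} (h0 : constantCoeff U = 1) (h1 : coeff 1 U = 0)
    (hU : ∀ k, 4 ≤ k → coeff k U = 0) : ∃ a b c : ℂ, U =
      (1 + PowerSeries.C a * X) * (1 + PowerSeries.C b * X) * (1 + PowerSeries.C c * X) := by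
  obtain ⟨a, b, c, e1, e2, e3⟩ := exists_factorization (coeff 2 U) (coeff 3 U)
  refine ⟨a, b, c, ?_⟩
  have : (1 + PowerSeries.C a * X) * (1 + PowerSeries.C b * X) * (1 + PowerSeries.C c * X) =
      (1 + PowerSeries.C (a + b + c) * X + PowerSeries.C (a * b + b * c + c * a) * X ^ 2 +
        PowerSeries.C (a * b * c) * X ^ 3 : ℂ⟦X⟧) := by
    simp only [map_add, map_mul]
    ring
  rw [this, e1, e2, e3]
  ext n
  simp only [map_add, coeff_C_mul, map_zero, zero_mul, add_zero, coeff_X_pow, coeff_one]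
  match n with
  | 0 => simp [h0]
  | 1 => simp [h1]
  | 2 => simp
  | 3 => simp
  | n + 4 => simp [hU]

lemma rhoH_one : rhoH 1 = 1 := by
  ext n
  cases n with
  | zero => rw [coeff_zero_rhoH]; simp
  | succ n => rw [coeff_succ_rhoH, one_pow, coeff_one, coeff_one, if_neg (by omega), if_neg (by omega),
      mul_zero]

/-- The curve of a Givental operator in the Heisenberg–Virasoro group. -/
theorem exists_isH {ρ H : ℂ⟦X⟧} (hρ : constantCoeff ρ = 1) (hH : constantCoeff H = 1)
    (hc : ∀ j k, covOdd H j k = covR ρ j k) : ∃ α β K, IsH α β K ∧ ρ = rhoH K := by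
  -- The Möbius freedom is used to normalize [z]K = 0, without changing the covariance.
  set K := gauge (-coeff 1 H) H with hK
  have hK0 : constantCoeff K = 1 := by rw [hK, constantCoeff_gauge, hH]
  have hK1 : coeff 1 K = 0 := by rw [hK, coeff_one_gauge _ hH, add_neg_cancel]
  have hKc : ∀ j k, covOdd K j k = covR ρ j k := fun j k => by rw [hK, covOdd_gauge, hc]
  have hG : constantCoeff (K - X * derivative ℂ K) = 1 := by simp [hK0]
  obtain ⟨U, hU⟩ : ∃ U, U = K ^ 3 * (K - X * derivative ℂ K)⁻¹ := ⟨_, rfl⟩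
  have hU0 : constantCoeff U = 1 := by rw [hU, map_mul, constantCoeff_inv, hG, map_pow, hK0]; simp
  have hKU : K ^ 3 = U * (K - X * derivative ℂ K) := by
    rw [hU, mul_assoc, PowerSeries.inv_mul_cancel _ (by rw [hG]; exact one_ne_zero), mul_one]
  have hU1 : coeff 1 U = 0 := by
    rw [← coeff_eq_of_oddFree hK0 hU0 hKU odd_one (fun m hm hm1 => absurd hm.pos (by omega))
      (fun m hm hm1 => absurd hm.pos (by omega)), hK1, mul_zero]
  obtain ⟨a, b, c, habc⟩ := exists_eq_prod hU0 hU1 fun k hk =>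
    coeff_eq_zero_of_quadN hK0 hU0 hKU hK1 (quadN_eq_zero hρ hK0 hU0 hKU hKc) hk
  -- A second Möbius transformation turns the third linear factor of U into 1 and leaves a quadratic
  -- denominator.
  have h2 := gauge_eqn (-c) hKU
  rw [habc, expo_vf_three, add_neg_cancel, map_zero, zero_mul, add_zero, mul_one] at h2
  have h3 : constantCoeff (gauge (-c) K) = 1 := by rw [constantCoeff_gauge, hK0]
  exact ⟨a + -c, b + -c, gauge (-c) K, ⟨h3, h2⟩,
    eq_rhoH hρ h3 fun j k => by rw [covOdd_gauge, hKc]⟩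

lemma eq_Rqp_of_inv_eq {R H : ℂ⟦X⟧} {α β : ℂ} (hR : constantCoeff R = 1) (hα : α ≠ 0)
    (hH : IsH α β H) (h : R⁻¹ = rhoH H) : ∃ q p : ℂ, p + q ≠ 0 ∧ R = Rqp q p := by
  refine ⟨α * β, α * (α - β), ?_, ?_⟩
  · rw [show α * (α - β) + α * β = α ^ 2 by ring]
    exact pow_ne_zero 2 hα
  · rw [hH.rhoH_eq hα] at h
    rw [Rqp_eq]
    have h1 := pexp_mul_pexp_neg (constantCoeff_expnt (α * β) (α * (α - β)))
    rw [← h] at h1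
    have h2 := PowerSeries.mul_inv_cancel R (by rw [hR]; exact one_ne_zero)
    linear_combination -R * h1 + pexp (-expnt (α * β) (α * (α - β))) * h2

theorem eq_one_or_eq_Rqp {R : ℂ⟦X⟧} (hR : IsSymplectic R) (h : CoincidesWithHV R) :
    R = 1 ∨ ∃ q p : ℂ, p + q ≠ 0 ∧ R = Rqp q p := by
  obtain ⟨H, hH, hc⟩ := exists_covOdd_eq hR h
  have hρ : constantCoeff R⁻¹ = 1 := by rw [constantCoeff_inv, hR.1, inv_one]
  obtain ⟨α, β, K, hK, hRK⟩ := exists_isH hρ hH hc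
  by_cases hα : α = 0
  · by_cases hβ : β = 0
    · left
      have h1 : IsH α β 1 := ⟨map_one _, by simp [curveU, hα, hβ]⟩
      rw [hK.eq_curveH, ← h1.eq_curveH, rhoH_one] at hRK
      have h2 := PowerSeries.mul_inv_cancel R (by rw [hR.1]; exact one_ne_zero)
      rwa [hRK, mul_one] at h2
    · exact Or.inr (eq_Rqp_of_inv_eq hR.1 hβ hK.symm hRK)
  · exact Or.inr (eq_Rqp_of_inv_eq hR.1 hα hK hRK)

end

end GiventalKP

open GiventalKP in
theorem mainTheorem1 :
    (∀ R : PowerSeries ℂ, IsSymplectic R →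
      (CoincidesWithHV R ↔ R = 1 ∨ ∃ q p : ℂ, p + q ≠ 0 ∧ R = Rqp q p)) ∧
    (∀ q p s : ℂ, p + q ≠ 0 → s ^ 2 = p + q →
      IsSymplectic (Rqp q p) ∧
      (∃! f : PowerSeries ℂ, IsfSeries q s f) ∧
      ∀ f : PowerSeries ℂ, IsfSeries q s f →
        (∃! a : ℕ+ → ℂ, IsConjugate a f) ∧
        ∀ a : ℕ+ → ℂ, IsConjugate a f →
          (∀ Z : FunT, lhsOp q p s Z = rhsOp q s f a Z) ∧
          (∀ Z : FormalFun, MakesSense (lhsOp q p s) Z → MakesSense (rhsOp q s f a) Z →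
            formalApply (lhsOp q p s) Z = formalApply (rhsOp q s f a) Z)) := by
  refine ⟨fun R hR => ⟨eq_one_or_eq_Rqp hR, ?_⟩, fun q p s h0 hs =>
    ⟨isSymplectic_Rqp q p, existsUnique_isfSeries q s, fun f hf =>
      ⟨existsUnique_isConjugate hf.1 hf.2.1, fun a ha => ?_⟩⟩⟩
  · rintro (rfl | ⟨q, p, h0, rfl⟩)
    · exact coincidesWithHV_one
    · exact coincidesWithHV_Rqp h0
  -- Since the operators agree on polynomials, in particular on monomials, every term of a formal
  -- series contributes the same to both sides.
  · have h : lhsOp q p s = rhsOp q s f a := funext (lhsOp_eq_rhsOp h0 hs hf ha)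
    exact ⟨fun Z => by rw [h], fun Z _ _ => by rw [h]⟩
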